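/- All logarithms are to base 2, and $[K]=\{0,\dots,K-1\}$. Let $\mathcal F$ be a nonempty finite family of probability distributions with finite supports, and let $w\ge 1$ and $q\ge 1$ be integers. For every $D\in\mathcal F$ and $\psi\in\operatorname{supp}(D)$ let $M_{in}^D(\psi)\ge 0$ and $K_{in}^D(\psi)\ge 1$ be integers. Assume that $w$ is the word size and that, for a constant $c$, the numbers $q$, $|\mathcal F|$, $|\operatorname{supp}(D)|$, $K_{in}^D(\psi)$ and $M_{in}^D(\psi)$ are all at most $2^{cw}$. Distributions and the symbols of each support are named by their indices $0,1,2,\dots$. Let $$H_{in}^D=\max_{\psi\in\operatorname{supp}(D)}\Bigl\{\log\tfrac1{D(\psi)}+w\,M_{in}^D(\psi)+\log K_{in}^D(\psi)\Bigr\}.$$ The model is the word RAM, in which arithmetic (addition, subtraction, multiplication, division, shifts, comparison) and random memory access on integers of $O(1)$ words, i.e. of at most $Cw$ bits for a constant $C$, take constant time. A virtual memory (VM) of $M$ words is an array of $M$ words of $w$ bits each; when a VM is resized, its common prefix is kept, and newly allocated words have arbitrary content. **Theorem.** There is a way to encode a symbol $\phi\in\operatorname{supp}(D)$, $D\in\mathcal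 F$, together with an input VM $m_{in}$ of $M_{in}^D(\phi)$ words and an input spill $k_{in}\in[K_{in}^D(\phi)]$, by an output VM $m_{out}$ of $M_{out}^D$ words and an output spill $k_{out}\in[K_{out}^D]$, where $M_{out}^D$ and $K_{out}^D$ depend on $D$ and not on $\phi$ (every $(\phi,m_{in},k_{in})$ has at least one encoding, and $D,m_{out},k_{out}$ determine $(\phi,m_{in},k_{in})$), such that: 1. $w\,M_{out}^D+\log K_{out}^D\le H_{in}^D+O(1/q)$, with an absolute constant in the $O(\cdot)$, and $\log K_{out}^D=O(w)$. 2. Given $D$, the output spill $k_{out}$, and a static lookup table that is shared by all $D\in\mathcal F$, each of the following operations takes $O(1)$ time; the updates return the new output spill and modify $m_{out}$ in place: * reading $\phi$, reading $k_{in}$, and replacing $k_{in}$ by another element of $[K_{in}^D(\phi)]$, all without any access to $m_{out}$; * reading or writing one word of $m_{in}$, with at most one word access to $m_{out}$; * changing $(D,\phi)$ to any $(\widehat D,\hat\phi)$ with $\widehat D\in\mathcal F$ and $\hat\phi\in\operatorname{supp}(\widehat D)$, and setting the new input spill to a given element of $[K_{in}^{\widehat D}(\hat\phi)]$; the input VM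 is resized from $M_{in}^D(\phi)$ to $M_{in}^{\widehat D}(\hat\phi)$ words and the output VM from $M_{out}^D$ to $M_{out}^{\widehat D}$ words, with at most $|M_{out}^{\widehat D}-M_{out}^D|$ word accesses to the output VM. Given the table, $M_{out}^D$ and $K_{out}^D$ (from $D$) and $M_{in}^D(\psi)$, $K_{in}^D(\psi)$ and $D(\psi)$ (from $D$ and $\psi\in\operatorname{supp}(D)$) can also be queried in $O(1)$ time, $D(\psi)$ being represented by its first $bw$ fractional bits $\lfloor D(\psi)2^{bw}\rfloor$ for an arbitrary constant $b$. 3. The lookup table has $$O\Bigl(|\mathcal F|\cdot\max_{D\in\mathcal F}|\operatorname{supp}(D)|\cdot q\cdot\min\bigl\{q,\ \max_{D\in\mathcal F,\,\psi\in\operatorname{supp}(D)}K_{in}^D(\psi)\bigr\}\Bigr)$$ words, and it can be computed, in time linear in this bound, from an array that lists $w$, $q$, $|\mathcal F|$, $\max_D|\operatorname{supp}(D)|$, the support sizes, and the values $M_{in}^D(\psi)$, $K_{in}^D(\psi)$ and $\lfloor D(\psi)2^{bw}\rfloor$. The constants in items 2 and 3 and in $\log K_{out}^D=O(w)$, the constant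 $C$, and the programs for the operations and for the construction of the table depend only on $c$ and $b$. -/

import Mathlib

/-! ## The word RAM -/

namespace WordRAM

/-- Arithmetic of the machine. Results are truncated to the register width by `Instr.step`. -/
inductive BinOp where
  | add | sub | mul | div | mod | shl | shr

def BinOp.eval : BinOp → ℕ → ℕ → ℕ
  | .add, x, y => x + y
  | .sub, x, y => x - y
  | .mul, x, y => x * y
  | .div, x, y => x / y
  | .mod, x, y => x % y
  | .shl, x, y => x * 2 ^ y
  | .shr, x, y => x / 2 ^ y

/-- Unit-cost instructions. Register names are literal numbers occurring in the program text,
so a program uses a constant number of registers. -/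
inductive Instr where
  /-- `reg r := n` -/
  | const (r n : ℕ)
  /-- `reg r := op (reg x) (reg y)` -/
  | bin (op : BinOp) (r x y : ℕ)
  /-- `reg r := mem[reg x]` -/
  | load (r x : ℕ)
  /-- `mem[reg x] := reg y` -/
  | store (x y : ℕ)
  /-- `reg r := vm[reg x]` (one word access to the virtual memory) -/
  | vmRead (r x : ℕ)
  /-- `vm[reg x] := reg y` (one word access to the virtual memory) -/
  | vmWrite (x y : ℕ)

/-- The number of accesses to the virtual memory made by an instruction. -/
def Instr.accesses : Instr → ℕ
  | .vmRead _ _ => 1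
  | .vmWrite _ _ => 1
  | _ => 0

/-- Comparisons of two registers. -/
inductive Test where
  | lt (x y : ℕ)
  | eq (x y : ℕ)

/-- Programs of the machine: finite syntax trees. -/
inductive Prog where
  | instr (i : Instr)
  | seq (p r : Prog)
  | ite (t : Test) (p r : Prog)
  | while (t : Test) (p : Prog)

/-- A machine state: registers, random access memory, and a virtual memory of `w`-bit words. -/
structure State (w : ℕ) where
  reg : ℕ → ℕ
  mem : ℕ → ℕ
  vm : ℕ → BitVec w

variable {w : ℕ}

/-- Assign `v` to register `r`, truncated to `W` bits. -/
def State.setReg (W : ℕ) (s : State w) (r v : ℕ) : State w :=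
  { s with reg := Function.update s.reg r (v % 2 ^ W) }

/-- The effect of one instruction on a machine whose registers and memory cells have `W` bits. -/
def Instr.step (W : ℕ) (s : State w) : Instr → State w
  | .const r n => s.setReg W r n
  | .bin op r x y => s.setReg W r (op.eval (s.reg x) (s.reg y))
  | .load r x => s.setReg W r (s.mem (s.reg x))
  | .store x y => { s with mem := Function.update s.mem (s.reg x) (s.reg y % 2 ^ W) }
  | .vmRead r x => s.setReg W r (s.vm (s.reg x)).toNat
  | .vmWrite x y => { s with vm := Function.update s.vm (s.reg x) (BitVec.ofNat w (s.reg y)) }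

def Test.holds (s : State w) : Test → Prop
  | .lt x y => s.reg x < s.reg y
  | .eq x y => s.reg x = s.reg y

/-- `Exec W p s t a s'`: started in `s`, the program `p` halts in `s'` after `t` steps, among
them `a` word accesses to the virtual memory. Every instruction and every test is one step. -/
inductive Exec (W : ℕ) : Prog → State w → ℕ → ℕ → State w → Prop where
  | instr (i : Instr) (s : State w) :
      Exec W (.instr i) s 1 i.accesses (i.step W s)
  | seq {p r : Prog} {s s₁ s₂ : State w} {t₁ t₂ a₁ a₂ : ℕ} :
      Exec W p s t₁ a₁ s₁ → Exec W r s₁ t₂ a₂ s₂ →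
      Exec W (.seq p r) s (t₁ + t₂) (a₁ + a₂) s₂
  | ite_true {b : Test} {p r : Prog} {s s' : State w} {t a : ℕ} :
      b.holds s → Exec W p s t a s' → Exec W (.ite b p r) s (t + 1) a s'
  | ite_false {b : Test} {p r : Prog} {s s' : State w} {t a : ℕ} :
      ¬ b.holds s → Exec W r s t a s' → Exec W (.ite b p r) s (t + 1) a s'
  | while_true {b : Test} {p : Prog} {s s₁ s₂ : State w} {t₁ t₂ a₁ a₂ : ℕ} :
      b.holds s → Exec W p s t₁ a₁ s₁ → Exec W (.while b p) s₁ t₂ a₂ s₂ →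
      Exec W (.while b p) s (t₁ + t₂ + 1) (a₁ + a₂) s₂
  | while_false {b : Test} {p : Prog} {s : State w} :
      ¬ b.holds s → Exec W (.while b p) s 1 0 s

/-- Started in `s`, the program `p` halts within `T` steps and `A` accesses to the virtual
memory, in a state satisfying `post`. -/
def RunsTo (W : ℕ) (p : Prog) (T A : ℕ) (s : State w) (post : State w → Prop) : Prop :=
  ∃ (t a : ℕ) (s' : State w), Exec W p s t a s' ∧ t ≤ T ∧ a ≤ A ∧ post s'

end WordRAM

/-! ## Entropy encoders -/

namespace EntropyEncoder

open WordRAM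

/-- The input parameters: a finite family of distributions with finite supports, the symbols of
each support being numbered so that they can be named to a machine, and, for each distribution
`D` and symbol `φ ∈ supp D`, the number of words of the input virtual memory and the size of
the universe of the input spill. -/
structure Params (Φ : Type*) where
  numDist : ℕ
  dist : Fin numDist → PMF Φ
  suppSize : Fin numDist → ℕ
  name : ∀ d, (dist d).support ≃ Fin (suppSize d)
  Min : ∀ d, (dist d).support → ℕ
  Kin : ∀ d, (dist d).support → ℕ
  Kin_pos : ∀ d φ, 0 < Kin d φ

variable {Φ : Type*} (P : Params Φ)

/-- The largest support size of a distribution of the family. -/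
def Params.maxSupp : ℕ := Finset.univ.sup P.suppSize

/-- The largest size of an input spill universe. -/
def Params.maxKin : ℕ :=
  Finset.univ.sup fun d => Finset.univ.sup fun i : Fin (P.suppSize d) => P.Kin d ((P.name d).symm i)

/-- `max_{ψ ∈ supp D} (log (1 / D ψ) + w * Min ψ + log (Kin ψ))`; the support is finite and
nonempty, so this supremum is a maximum. -/
noncomputable def Params.Hin (w : ℕ) (d : Fin P.numDist) : ℝ :=
  ⨆ ψ : (P.dist d).support,
    (Real.logb 2 (1 / (P.dist d ψ).toReal) + (w : ℝ) * (P.Min d ψ : ℝ)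
      + Real.logb 2 (P.Kin d ψ : ℝ))

/-- The probability of a symbol in fixed-point binary representation, with `n` fractional bits. -/
noncomputable def Params.probCode (n : ℕ) (d : Fin P.numDist) (φ : (P.dist d).support) : ℕ :=
  ⌊(P.dist d φ).toReal * 2 ^ n⌋₊

/-- The size bound for the lookup tables, up to a constant factor. -/
def Params.tableBound (q : ℕ) : ℕ := P.numDist * P.maxSupp * q * min q P.maxKin

/-- The memory contains, from address `0` on, a description of the parameters. -/
def Params.Described (w q n : ℕ) (mem : ℕ → ℕ) : Prop :=
  mem 0 = w ∧ mem 1 = q ∧ mem 2 = P.numDist ∧ mem 3 = P.maxSupp ∧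
  ∀ d : Fin P.numDist,
    mem (4 + d) = P.suppSize d ∧
    ∀ φ : (P.dist d).support,
      mem (4 + P.numDist + 3 * (d * P.maxSupp + P.name d φ)) = P.Min d φ ∧
      mem (4 + P.numDist + 3 * (d * P.maxSupp + P.name d φ) + 1) = P.Kin d φ ∧
      mem (4 + P.numDist + 3 * (d * P.maxSupp + P.name d φ) + 2) = P.probCode n d φ

/-- What is encoded under the distribution `d`: a symbol, and an input virtual memory and an
input spill of the sizes belonging to this symbol. -/
structure Content (w : ℕ) (d : Fin P.numDist) where
  symbol : (P.dist d).support
  vm : Fin (P.Min d symbol) → BitVec w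
  spill : Fin (P.Kin d symbol)

/-- A code for the given parameters: the size of the output virtual memory (in words) and of the
universe of the output spill, which depend on the distribution only; the decoding map, which
is `none` on unused outputs; and a static lookup table. -/
structure Code (w : ℕ) where
  Mout : Fin P.numDist → ℕ
  Kout : Fin P.numDist → ℕ
  decode : ∀ d, (Fin (Mout d) → BitVec w) → Fin (Kout d) → Option (Content P w d)
  tableLen : ℕ
  table : ℕ → ℕ

namespace Code

variable {P} {w : ℕ} (E : Code P w)

/-- The first `Mout d` words of `vm` together with the spill `k` encode `x`. -/
def Encodes (d : Fin P.numDist) (vm : ℕ → BitVec w) (k : ℕ) (x : Content P w d) : Prop :=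
  ∃ hk : k < E.Kout d, E.decode d (fun j => vm j) ⟨k, hk⟩ = some x

/-- Every content has an encoding. (As `decode` is a function, no output encodes two contents.) -/
def Total : Prop :=
  ∀ (d : Fin P.numDist) (x : Content P w d), ∃ (vm : ℕ → BitVec w) (k : ℕ), E.Encodes d vm k x

/-- The table has at most `L` cells, each of at most `W` bits. -/
def TableFits (W L : ℕ) : Prop :=
  E.tableLen ≤ L ∧ ∀ j < E.tableLen, E.table j < 2 ^ W

/-- The lookup table is in memory, at addresses `0, …, tableLen - 1`. -/
def Loaded (mem : ℕ → ℕ) : Prop := ∀ j < E.tableLen, mem j = E.table j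

/-- `p` computes the table from a description of the parameters, within `T` steps. -/
def Builds (W q n T : ℕ) (p : Prog) : Prop :=
  ∀ s : State w, P.Described w q n s.mem →
    RunsTo W p T 0 s fun s' => E.Loaded s'.mem

/-- Query for the output sizes. Input: `D`. -/
def QueriesSizes (W T : ℕ) (p : Prog) : Prop :=
  ∀ (s : State w) (d : Fin P.numDist), E.Loaded s.mem → s.reg 0 = d →
    RunsTo W p T 0 s fun s' =>
      s'.mem = s.mem ∧ s'.vm = s.vm ∧ s'.reg 0 = E.Mout d ∧ s'.reg 1 = E.Kout d

/-- Query for the input sizes and the probability of a symbol. Input: `D` and `φ`. -/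
def QueriesSymbol (W n T : ℕ) (p : Prog) : Prop :=
  ∀ (s : State w) (d : Fin P.numDist) (φ : (P.dist d).support), E.Loaded s.mem →
    s.reg 0 = d → s.reg 1 = P.name d φ →
    RunsTo W p T 0 s fun s' =>
      s'.mem = s.mem ∧ s'.vm = s.vm ∧
      s'.reg 0 = P.Min d φ ∧ s'.reg 1 = P.Kin d φ ∧ s'.reg 2 = P.probCode n d φ

/-- Reading the symbol. Input: `D` and the output spill. No access to the output memory. -/
def ReadsSymbol (W T : ℕ) (p : Prog) : Prop :=
  ∀ (s : State w) (d : Fin P.numDist) (x : Content P w d), E.Loaded s.mem →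
    s.reg 0 = d → E.Encodes d s.vm (s.reg 1) x →
    RunsTo W p T 0 s fun s' =>
      s'.mem = s.mem ∧ s'.vm = s.vm ∧ s'.reg 0 = P.name d x.symbol

/-- Reading the input spill. Input: `D` and the output spill. No access to the output memory. -/
def ReadsSpill (W T : ℕ) (p : Prog) : Prop :=
  ∀ (s : State w) (d : Fin P.numDist) (x : Content P w d), E.Loaded s.mem →
    s.reg 0 = d → E.Encodes d s.vm (s.reg 1) x →
    RunsTo W p T 0 s fun s' =>
      s'.mem = s.mem ∧ s'.vm = s.vm ∧ s'.reg 0 = x.spill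

/-- Setting the input spill to `k`. Input: `D`, the output spill, and `k`. Result: the new
output spill. No access to the output memory. -/
def WritesSpill (W T : ℕ) (p : Prog) : Prop :=
  ∀ (s : State w) (d : Fin P.numDist) (x : Content P w d) (k : Fin (P.Kin d x.symbol)),
    E.Loaded s.mem → s.reg 0 = d → E.Encodes d s.vm (s.reg 1) x → s.reg 2 = k →
    RunsTo W p T 0 s fun s' =>
      s'.mem = s.mem ∧ s'.vm = s.vm ∧
      E.Encodes d s'.vm (s'.reg 0) { x with spill := k }

/-- Reading word `j` of the input memory. Input: `D`, the output spill, and `j`. At most one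
access to the output memory. -/
def ReadsWord (W T : ℕ) (p : Prog) : Prop :=
  ∀ (s : State w) (d : Fin P.numDist) (x : Content P w d) (j : Fin (P.Min d x.symbol)),
    E.Loaded s.mem → s.reg 0 = d → E.Encodes d s.vm (s.reg 1) x → s.reg 2 = j →
    RunsTo W p T 1 s fun s' =>
      s'.mem = s.mem ∧ s'.vm = s.vm ∧ s'.reg 0 = (x.vm j).toNat

/-- Writing `v` to word `j` of the input memory. Input: `D`, the output spill, `j` and `v`.
Result: the new output spill. At most one access to the output memory, inside its bounds. -/
def WritesWord (W T : ℕ) (p : Prog) : Prop :=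
  ∀ (s : State w) (d : Fin P.numDist) (x : Content P w d) (j : Fin (P.Min d x.symbol))
    (v : BitVec w),
    E.Loaded s.mem → s.reg 0 = d → E.Encodes d s.vm (s.reg 1) x → s.reg 2 = j →
    s.reg 3 = v.toNat →
    RunsTo W p T 1 s fun s' =>
      s'.mem = s.mem ∧ (∀ i, E.Mout d ≤ i → s'.vm i = s.vm i) ∧
      E.Encodes d s'.vm (s'.reg 0) { x with vm := Function.update x.vm j v }

/-- Changing the distribution and symbol to `d'`, `φ'`, with new input spill `k'`. Input: `D`,
the output spill, `d'`, `φ'`, `k'`. Result: the new output spill. The output memory is resized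
from `Mout d` to `Mout d'` words (new words have arbitrary content), and the number of accesses
to it is at most the difference of these sizes. The input memory keeps the words that are in
range both before and after the change; newly allocated input words have arbitrary content. -/
def Changes (W T : ℕ) (p : Prog) : Prop :=
  ∀ (s : State w) (d d' : Fin P.numDist) (x : Content P w d) (φ' : (P.dist d').support)
    (k' : Fin (P.Kin d' φ')),
    E.Loaded s.mem → s.reg 0 = d → E.Encodes d s.vm (s.reg 1) x → s.reg 2 = d' →
    s.reg 3 = P.name d' φ' → s.reg 4 = k' →
    RunsTo W p T (Nat.dist (E.Mout d') (E.Mout d)) s fun s' =>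
      s'.mem = s.mem ∧ (∀ i, max (E.Mout d) (E.Mout d') ≤ i → s'.vm i = s.vm i) ∧
      ∃ m' : Fin (P.Min d' φ') → BitVec w,
        (∀ (i : ℕ) (h : i < P.Min d x.symbol) (h' : i < P.Min d' φ'),
          m' ⟨i, h'⟩ = x.vm ⟨i, h⟩) ∧
        E.Encodes d' s'.vm (s'.reg 0) ⟨φ', m', k'⟩

end Code

/-- The programs of a dynamic entropy encoder. -/
structure Programs where
  build : Prog
  querySizes : Prog
  querySymbol : Prog
  readSymbol : Prog
  readSpill : Prog
  writeSpill : Prog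
  readWord : Prog
  writeWord : Prog
  change : Prog

end EntropyEncoder

/-! ## A program logic for the word RAM

Registers `0, …, 31` are the variables of a program, the registers from `32` on hold temporary
values. -/

namespace WordRAM

variable {w W : ℕ}

/-! Fix a distribution `d`, and let the output memory have `M = max Min - L` words (truncated
subtraction), where `L = 3 * c`. Input words with index below `M` stay at their own address. The
remaining words of the symbol, at most `L` of them, are packed in base `2 ^ w` below the input spill
into one number `y`, which has `Kin * 2 ^ (w * (Min - M))` possible values. The output spill
universe is a concatenation of intervals, one per symbol, and the output spill is the point at
offset `y` in the interval of the current symbol. To find the symbol in constant time, interval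
lengths are rounded up to multiples of a grain of about `total / (q * m)`. A table with `O(q * m)`
cells then gives the symbol that owns each cell. The probabilities play no role in the encoding;
they are only stored for queries.

Space is lost in two places. Rounding adds at most `m` grains, a factor `1 + 1 / q`
(`Sizes.mul_kout_le`). Symbols with fewer than `M` words leave output words unused. Together they
take at most `m * 2 ^ (c * w) * 2 ^ (w * M)` outputs, whereas a longest symbol with at least `L`
words has at least `2 ^ (w * (M + L))` contents. As `q * m * 2 ^ (c * w) ≤ 2 ^ (w * L)`, this is
again a factor `1 + 1 / q` (`Sizes.mul_total_le`). Finally the number of contents is at most `2 ^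
Hin`, because each symbol has at most its probability times `2 ^ Hin` contents and the probabilities
sum to one (`Params.contents_le`). The redundancy is therefore at most `2 * log (1 + 1 / q) ≤ 3 / q`
(`Params.redundancy`).

All operations except `change` extract or replace digits of `y`, or make one access to a word at its
own address. In `change` every word keeps its index, so a word crosses between memory and spill only
if its index lies between the old and the new memory size, and only words that lie in the old or the
new spill are moved (`Params.changes_code`). The table is the description itself, with missing
records filled by zeros, followed by one block per distribution with prefix sums, sizes and the
owners of the cells (`Sizes.build_spec`).

The programs are verified with triples `Sat` over untruncated values. The absence of overflow is the
side condition `Expr.Ok`, and `Params.fits_sizes` supplies the bounds for it. -/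

@[simp] theorem State.setReg_mem (s : State w) (r v : ℕ) : (s.setReg W r v).mem = s.mem := rfl

@[simp] theorem State.setReg_vm (s : State w) (r v : ℕ) : (s.setReg W r v).vm = s.vm := rfl

theorem State.setReg_reg (s : State w) (r v k : ℕ) :
    (s.setReg W r v).reg k = if k = r then v % 2 ^ W else s.reg k := by
  simp [State.setReg, Function.update_apply]

theorem RunsTo.instr (i : Instr) {s : State w} {post : State w → Prop}
    (h : post (i.step W s)) : RunsTo W (.instr i) 1 i.accesses s post :=
  ⟨_, _, _, .instr i s, le_rfl, le_rfl, h⟩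

theorem RunsTo.seq {p r : Prog} {s : State w} {T₁ T₂ A₁ A₂ : ℕ} {post : State w → Prop}
    (h : RunsTo W p T₁ A₁ s fun s' => RunsTo W r T₂ A₂ s' post) :
    RunsTo W (.seq p r) (T₁ + T₂) (A₁ + A₂) s post := by
  obtain ⟨t, a, s', e, ht, ha, t', a', s'', e', ht', ha', hp⟩ := h
  exact ⟨_, _, _, .seq e e', by omega, by omega, hp⟩

theorem RunsTo.mono {p : Prog} {s : State w} {T T' A A' : ℕ} {post post' : State w → Prop}
    (h : RunsTo W p T A s post) (hT : T ≤ T') (hA : A ≤ A') (hp : ∀ s', post s' → post' s') :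
    RunsTo W p T' A' s post' := by
  obtain ⟨t, a, s', e, ht, ha, h⟩ := h
  exact ⟨t, a, s', e, ht.trans hT, ha.trans hA, hp _ h⟩

/-- The states agree on everything except the temporary registers. -/
def State.Agree (s t : State w) : Prop :=
  (∀ j < 32, s.reg j = t.reg j) ∧ s.mem = t.mem ∧ s.vm = t.vm

theorem State.Agree.refl (s : State w) : s.Agree s := ⟨fun _ _ => rfl, rfl, rfl⟩

/-- The number of instructions and tests of a program without loops. -/
def Prog.len : Prog → ℕ
  | .instr _ => 1
  | .seq p r => p.len + r.len
  | .ite _ p r => p.len + r.len + 1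
  | .while _ p => p.len + 1

/-! ### Expressions, their overflow condition and their compilation. -/

/-- Arithmetic expressions over registers and memory cells. -/
inductive Expr where
  | reg (r : ℕ)
  | lit (n : ℕ)
  | bin (op : BinOp) (a b : Expr)
  | load (a : Expr)

namespace Expr

instance : Add Expr := ⟨.bin .add⟩
instance : Sub Expr := ⟨.bin .sub⟩
instance : Mul Expr := ⟨.bin .mul⟩
instance : Div Expr := ⟨.bin .div⟩
instance : Mod Expr := ⟨.bin .mod⟩
instance : ShiftLeft Expr := ⟨.bin .shl⟩
instance : ShiftRight Expr := ⟨.bin .shr⟩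

/-- The value of an expression. -/
def eval (s : State w) : Expr → ℕ
  | .reg r => s.reg r
  | .lit n => n
  | .bin op a b => op.eval (a.eval s) (b.eval s)
  | .load a => s.mem (a.eval s)

/-- The expression mentions no temporary registers, and no overflow occurs in its evaluation. -/
def Ok (W : ℕ) (s : State w) : Expr → Prop
  | .reg r => r < 32 ∧ s.reg r < 2 ^ W
  | .lit n => n < 2 ^ W
  | .bin op a b => a.Ok W s ∧ b.Ok W s ∧ op.eval (a.eval s) (b.eval s) < 2 ^ W
  | .load a => a.Ok W s ∧ s.mem (a.eval s) < 2 ^ W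

section
variable (s : State w) (a b : Expr) (n : ℕ)

@[simp] theorem eval_reg : (reg n).eval s = s.reg n := rfl
@[simp] theorem eval_lit : (lit n).eval s = n := rfl
@[simp] theorem eval_load : (load a).eval s = s.mem (a.eval s) := rfl
@[simp] theorem eval_add : (a + b).eval s = a.eval s + b.eval s := rfl
@[simp] theorem eval_sub : (a - b).eval s = a.eval s - b.eval s := rfl
@[simp] theorem eval_mul : (a * b).eval s = a.eval s * b.eval s := rfl
@[simp] theorem eval_div : (a / b).eval s = a.eval s / b.eval s := rfl
@[simp] theorem eval_mod : (a % b).eval s = a.eval s % b.eval s := rfl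
@[simp] theorem eval_shl : (a <<< b).eval s = a.eval s * 2 ^ b.eval s := rfl
@[simp] theorem eval_shr : (a >>> b).eval s = a.eval s / 2 ^ b.eval s := rfl

@[simp] theorem ok_reg : (reg n).Ok W s ↔ n < 32 ∧ s.reg n < 2 ^ W := Iff.rfl
@[simp] theorem ok_lit : (lit n).Ok W s ↔ n < 2 ^ W := Iff.rfl
@[simp] theorem ok_load : (load a).Ok W s ↔ a.Ok W s ∧ s.mem (a.eval s) < 2 ^ W := Iff.rfl
@[simp] theorem ok_add :
    (a + b).Ok W s ↔ a.Ok W s ∧ b.Ok W s ∧ a.eval s + b.eval s < 2 ^ W := Iff.rfl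
@[simp] theorem ok_mul :
    (a * b).Ok W s ↔ a.Ok W s ∧ b.Ok W s ∧ a.eval s * b.eval s < 2 ^ W := Iff.rfl
@[simp] theorem ok_shl :
    (a <<< b).Ok W s ↔ a.Ok W s ∧ b.Ok W s ∧ a.eval s * 2 ^ b.eval s < 2 ^ W := Iff.rfl

variable {a s}

theorem Ok.eval_lt (h : a.Ok W s) : a.eval s < 2 ^ W := by
  cases a with
  | reg r => exact h.2
  | lit n => exact h
  | bin op a b => exact h.2.2
  | load a => exact h.2

variable (a s)

@[simp] theorem ok_sub : (a - b).Ok W s ↔ a.Ok W s ∧ b.Ok W s :=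
  ⟨fun h => ⟨h.1, h.2.1⟩, fun h => ⟨h.1, h.2, (Nat.sub_le _ _).trans_lt h.1.eval_lt⟩⟩
@[simp] theorem ok_div : (a / b).Ok W s ↔ a.Ok W s ∧ b.Ok W s :=
  ⟨fun h => ⟨h.1, h.2.1⟩, fun h => ⟨h.1, h.2, (Nat.div_le_self _ _).trans_lt h.1.eval_lt⟩⟩
@[simp] theorem ok_mod : (a % b).Ok W s ↔ a.Ok W s ∧ b.Ok W s :=
  ⟨fun h => ⟨h.1, h.2.1⟩, fun h => ⟨h.1, h.2, (Nat.mod_le _ _).trans_lt h.1.eval_lt⟩⟩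
@[simp] theorem ok_shr : (a >>> b).Ok W s ↔ a.Ok W s ∧ b.Ok W s :=
  ⟨fun h => ⟨h.1, h.2.1⟩, fun h => ⟨h.1, h.2, (Nat.div_le_self _ _).trans_lt h.1.eval_lt⟩⟩

end

/-- Compute an expression into register `k`, with temporaries from `k` on. -/
def compile : Expr → ℕ → Prog
  -- There is no move instruction; a register is copied by adding it to `0`.
  | .reg r, k => .seq (.instr (.const k 0)) (.instr (.bin .add k k r))
  | .lit n, k => .instr (.const k n)
  | .bin op a b, k =>
      .seq (a.compile k) (.seq (b.compile (k + 1)) (.instr (.bin op k k (k + 1))))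
  | .load a, k => .seq (a.compile k) (.instr (.load k k))

/-- The temporaries form a stack. The clause on registers below `k` carries the induction: the left
operand, kept in `k`, survives the evaluation of the right one from `k + 1` on. -/
theorem runsTo_compile (e : Expr) (k : ℕ) (hk : 32 ≤ k) (s t : State w) (hst : t.Agree s)
    (he : e.Ok W s) :
    RunsTo W (e.compile k) (e.compile k).len 0 t fun t' =>
      t'.Agree s ∧ t'.reg k = e.eval s ∧ ∀ j < k, t'.reg j = t.reg j := by
  induction e generalizing k t with
  | reg r =>
    refine RunsTo.seq (A₁ := 0) (A₂ := 0) (T₁ := 1) (T₂ := 1) (RunsTo.instr _ (RunsTo.instr _ ?_))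
    obtain ⟨hr, hlt⟩ := he
    have hrk : r ≠ k := by omega
    refine ⟨⟨fun j hj => ?_, hst.2.1, hst.2.2⟩, ?_, fun j hj => ?_⟩
    · have : j ≠ k := by omega
      simp [Instr.step, State.setReg_reg, this, hst.1 j hj]
    · simp [Instr.step, State.setReg_reg, hrk, hst.1 r hr, BinOp.eval, Nat.mod_eq_of_lt hlt]
    · have : j ≠ k := by omega
      simp [Instr.step, State.setReg_reg, this]
  | lit n =>
    refine RunsTo.instr _ ⟨⟨fun j hj => ?_, hst.2.1, hst.2.2⟩, ?_, fun j hj => ?_⟩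
    · have : j ≠ k := by omega
      simp [Instr.step, State.setReg_reg, this, hst.1 j hj]
    · simp [Instr.step, State.setReg_reg, Nat.mod_eq_of_lt (show n < 2 ^ W from he)]
    · have : j ≠ k := by omega
      simp [Instr.step, State.setReg_reg, this]
  | bin op a b iha ihb =>
    obtain ⟨ha, hb, hab⟩ := he
    refine RunsTo.seq (A₁ := 0) (A₂ := 0) ((iha k hk t hst ha).mono le_rfl le_rfl ?_)
    rintro t₁ ⟨h₁, h₁', h₁''⟩
    refine RunsTo.seq (A₁ := 0) (A₂ := 0)
      ((ihb (k + 1) (by omega) t₁ h₁ hb).mono le_rfl le_rfl ?_)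
    rintro t₂ ⟨h₂, h₂', h₂''⟩
    refine RunsTo.instr _ ⟨⟨fun j hj => ?_, h₂.2.1, h₂.2.2⟩, ?_, fun j hj => ?_⟩
    · have : j ≠ k := by omega
      simp [Instr.step, State.setReg_reg, this, h₂.1 j hj]
    · simp [Instr.step, State.setReg_reg, h₂', h₂'' k (by omega), h₁', Expr.eval,
        Nat.mod_eq_of_lt hab]
    · have : j ≠ k := by omega
      simp [Instr.step, State.setReg_reg, this, h₂'' j (by omega), h₁'' j hj]
  | load a iha =>
    obtain ⟨ha, hlt⟩ := he
    refine RunsTo.seq (A₁ := 0) (A₂ := 0) ((iha k hk t hst ha).mono le_rfl le_rfl ?_)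
    rintro t₁ ⟨h₁, h₁', h₁''⟩
    refine RunsTo.instr _ ⟨⟨fun j hj => ?_, h₁.2.1, h₁.2.2⟩, ?_, fun j hj => ?_⟩
    · have : j ≠ k := by omega
      simp [Instr.step, State.setReg_reg, this, h₁.1 j hj]
    · simp [Instr.step, State.setReg_reg, h₁', h₁.2.1, Expr.eval, Nat.mod_eq_of_lt hlt]
    · have : j ≠ k := by omega
      simp [Instr.step, State.setReg_reg, this, h₁'' j hj]

end Expr

/-! ### Program triples that ignore temporary registers. -/

/-- The register update of the program logic, without truncation. -/
def State.set (s : State w) (r v : ℕ) : State w := { s with reg := Function.update s.reg r v }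

/-- The memory update of the program logic, without truncation. -/
def State.put (s : State w) (a v : ℕ) : State w := { s with mem := Function.update s.mem a v }

/-- The update of the virtual memory. -/
def State.write (s : State w) (a : ℕ) (v : BitVec w) : State w :=
  { s with vm := Function.update s.vm a v }

@[simp] theorem State.set_reg (s : State w) (r v k : ℕ) :
    (s.set r v).reg k = if k = r then v else s.reg k := by
  simp [State.set, Function.update_apply]

@[simp] theorem State.set_mem (s : State w) (r v : ℕ) : (s.set r v).mem = s.mem := rfl

@[simp] theorem State.set_vm (s : State w) (r v : ℕ) : (s.set r v).vm = s.vm := rfl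

@[simp] theorem State.put_reg (s : State w) (a v : ℕ) : (s.put a v).reg = s.reg := rfl

@[simp] theorem State.put_vm (s : State w) (a v : ℕ) : (s.put a v).vm = s.vm := rfl

theorem State.put_mem (s : State w) (a v k : ℕ) :
    (s.put a v).mem k = if k = a then v else s.mem k := by
  simp [State.put, Function.update_apply]

@[simp] theorem State.write_reg (s : State w) (a : ℕ) (v : BitVec w) :
    (s.write a v).reg = s.reg := rfl

@[simp] theorem State.write_mem (s : State w) (a : ℕ) (v : BitVec w) :
    (s.write a v).mem = s.mem := rfl

theorem State.write_vm (s : State w) (a : ℕ) (v : BitVec w) (k : ℕ) :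
    (s.write a v).vm k = if k = a then v else s.vm k := by
  simp [State.write, Function.update_apply]

/-- `RunsTo`, up to the content of the temporary registers. -/
def Sat (W : ℕ) (p : Prog) (T A : ℕ) (s : State w) (post : State w → Prop) : Prop :=
  ∀ t : State w, t.Agree s → RunsTo W p T A t fun t' => ∃ s', t'.Agree s' ∧ post s'

theorem Sat.runsTo {p : Prog} {T A : ℕ} {s : State w} {post post' : State w → Prop}
    (h : Sat W p T A s post) (hp : ∀ t' s', t'.Agree s' → post s' → post' t') :
    RunsTo W p T A s post' :=
  (h s (.refl s)).mono le_rfl le_rfl fun t' ⟨s', h₁, h₂⟩ => hp t' s' h₁ h₂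

theorem Sat.mono {p : Prog} {s : State w} {T T' A A' : ℕ} {post post' : State w → Prop}
    (h : Sat W p T A s post) (hT : T ≤ T') (hA : A ≤ A') (hp : ∀ s', post s' → post' s') :
    Sat W p T' A' s post' := fun t ht =>
  (h t ht).mono hT hA fun _ ⟨s', h₁, h₂⟩ => ⟨s', h₁, hp s' h₂⟩

theorem Sat.seq {p r : Prog} {s : State w} {T₁ T₂ A₁ A₂ : ℕ} {post : State w → Prop}
    (h : Sat W p T₁ A₁ s fun s' => Sat W r T₂ A₂ s' post) :
    Sat W (.seq p r) (T₁ + T₂) (A₁ + A₂) s post := fun t ht =>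
  RunsTo.seq ((h t ht).mono le_rfl le_rfl fun t' ⟨_, h₁, h₂⟩ => h₂ t' h₁)

/-- `reg r := e` -/
def Prog.assign (r : ℕ) (e : Expr) : Prog :=
  .seq (e.compile 32) (.seq (.instr (.const 33 0)) (.instr (.bin .add r 32 33)))

/-- `mem[a] := e` -/
def Prog.put (a e : Expr) : Prog :=
  .seq (a.compile 32) (.seq (e.compile 33) (.instr (.store 32 33)))

/-- Since `Ok` excludes overflow, the truncation done by the machine is vacuous and the
postcondition can use the plain value. -/
theorem Sat.assign {r : ℕ} {e : Expr} (v : ℕ) {s : State w} {post : State w → Prop}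
    (hv : e.eval s = v) (he : e.Ok W s) (h : post (s.set r v)) :
    Sat W (.assign r e) (Prog.assign r e).len 0 s post := by
  intro t ht
  refine RunsTo.seq (A₁ := 0) (A₂ := 0)
    ((e.runsTo_compile 32 le_rfl s t ht he).mono le_rfl le_rfl ?_)
  rintro t₁ ⟨h₁, h₁', -⟩
  refine RunsTo.seq (A₁ := 0) (A₂ := 0) (T₁ := 1) (T₂ := 1)
    (RunsTo.instr _ (RunsTo.instr _ ⟨s.set r v, ⟨fun j hj => ?_, h₁.2.1, h₁.2.2⟩, h⟩))
  have : j ≠ 33 := by omega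
  simp [Instr.step, State.setReg_reg, BinOp.eval, this, h₁', h₁.1 j hj, hv]
  rw [Nat.mod_eq_of_lt (hv ▸ he.eval_lt)]

theorem Sat.put {a e : Expr} (i v : ℕ) {s : State w} {post : State w → Prop}
    (ha : a.eval s = i) (hv : e.eval s = v) (hao : a.Ok W s) (he : e.Ok W s)
    (h : post (s.put i v)) :
    Sat W (.put a e) (Prog.put a e).len 0 s post := by
  intro t ht
  refine RunsTo.seq (A₁ := 0) (A₂ := 0)
    ((a.runsTo_compile 32 le_rfl s t ht hao).mono le_rfl le_rfl ?_)
  rintro t₁ ⟨h₁, h₁', -⟩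
  refine RunsTo.seq (A₁ := 0) (A₂ := 0)
    ((e.runsTo_compile 33 (by omega) s t₁ h₁ he).mono le_rfl le_rfl ?_)
  rintro t₂ ⟨h₂, h₂', h₂''⟩
  refine RunsTo.instr _ ⟨s.put i v, ⟨fun j hj => h₂.1 j hj, ?_, h₂.2.2⟩, h⟩
  simp [Instr.step, State.put, h₂', h₂'', h₁', ha, hv, h₂.2.1, Nat.mod_eq_of_lt (hv ▸ he.eval_lt)]

theorem Sat.vmRead {r x : ℕ} {s : State w} {post : State w → Prop} (hW : w ≤ W)
    (hx : x < 32) (h : post (s.set r (s.vm (s.reg x)).toNat)) :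
    Sat W (.instr (.vmRead r x)) 1 1 s post := by
  intro t ht
  refine RunsTo.instr _ ⟨s.set r (s.vm (s.reg x)).toNat, ⟨fun j hj => ?_, ht.2.1, ht.2.2⟩, h⟩
  have : (s.vm (s.reg x)).toNat < 2 ^ W :=
    (BitVec.isLt _).trans_le (Nat.pow_le_pow_right (by norm_num) hW)
  simp [Instr.step, State.setReg_reg, ht.2.2, ht.1 x hx, ht.1 j hj, Nat.mod_eq_of_lt this]

theorem Sat.vmWrite {x y : ℕ} {s : State w} {post : State w → Prop} (hx : x < 32) (hy : y < 32)
    (h : post (s.write (s.reg x) (BitVec.ofNat w (s.reg y)))) :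
    Sat W (.instr (.vmWrite x y)) 1 1 s post := by
  intro t ht
  refine RunsTo.instr _ ⟨s.write (s.reg x) (BitVec.ofNat w (s.reg y)),
    ⟨fun j hj => ?_, ht.2.1, ?_⟩, h⟩
  · simp [Instr.step, ht.1 j hj]
  · simp [Instr.step, State.write, ht.2.2, ht.1 x hx, ht.1 y hy]

theorem Sat.ite {x y : ℕ} {p r : Prog} {T₁ T₂ A : ℕ} {s : State w} {post : State w → Prop}
    (hx : x < 32) (hy : y < 32)
    (h₁ : s.reg x < s.reg y → Sat W p T₁ A s post)
    (h₂ : s.reg y ≤ s.reg x → Sat W r T₂ A s post) :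
    Sat W (.ite (.lt x y) p r) (T₁ + T₂ + 1) A s post := by
  intro t ht
  by_cases hlt : s.reg x < s.reg y
  · obtain ⟨t₁, a, s', e, hT, hA, hp⟩ := h₁ hlt t ht
    refine ⟨_, _, _, .ite_true ?_ e, by omega, hA, hp⟩
    simpa [Test.holds, ht.1 x hx, ht.1 y hy] using hlt
  · obtain ⟨t₁, a, s', e, hT, hA, hp⟩ := h₂ (not_lt.1 hlt) t ht
    refine ⟨_, _, _, .ite_false ?_ e, by omega, hA, hp⟩
    simpa [Test.holds, ht.1 x hx, ht.1 y hy] using hlt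

/-- The rule for loops, where `k` bounds the number of remaining iterations. -/
theorem Sat.while_of_le {x y : ℕ} {p : Prog} {T A : ℕ} (I : ℕ → State w → Prop)
    (hx : x < 32) (hy : y < 32)
    (hstep : ∀ k s, I (k + 1) s → s.reg x < s.reg y → Sat W p T A s (I k))
    (hend : ∀ s, I 0 s → s.reg y ≤ s.reg x) (k : ℕ) (s : State w) (h : I k s) :
    Sat W (.while (.lt x y) p) (k * (T + 1) + 1) (k * A) s
      fun s' => (∃ j, I j s') ∧ s'.reg y ≤ s'.reg x := by
  have hexit : ∀ (k : ℕ) (s : State w), I k s → s.reg y ≤ s.reg x →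
      Sat W (.while (.lt x y) p) (k * (T + 1) + 1) (k * A) s
        fun s' => (∃ j, I j s') ∧ s'.reg y ≤ s'.reg x := by
    intro k s h hle t ht
    refine ⟨_, _, _, .while_false ?_, by omega, by omega, s, ht, ⟨k, h⟩, hle⟩
    simpa [Test.holds, ht.1 x hx, ht.1 y hy] using hle
  induction k generalizing s with
  | zero => exact hexit 0 s h (hend s h)
  | succ k ih =>
    rcases le_or_gt (s.reg y) (s.reg x) with hle | hlt
    · exact hexit _ s h hle
    intro t ht
    obtain ⟨t₁, a₁, s₁, e₁, hT₁, hA₁, s₁', hs₁, hI⟩ := hstep k s h hlt t ht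
    obtain ⟨t₂, a₂, s₂, e₂, hT₂, hA₂, hp⟩ := ih s₁' hI s₁ hs₁
    refine ⟨_, _, _, .while_true ?_ e₁ e₂, ?_, ?_, hp⟩
    · simpa [Test.holds, ht.1 x hx, ht.1 y hy] using hlt
    · rw [Nat.succ_mul]; omega
    · rw [Nat.succ_mul]; omega

/-- Here the count is exact: the test holds whenever the counter is positive, so the loop can only
be left with `I 0`. -/
theorem Sat.while {x y : ℕ} {p : Prog} {T A : ℕ} (I : ℕ → State w → Prop)
    (hx : x < 32) (hy : y < 32)
    (hstep : ∀ k s, I (k + 1) s → s.reg x < s.reg y ∧ Sat W p T A s (I k))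
    (hend : ∀ s, I 0 s → s.reg y ≤ s.reg x) (k : ℕ) (s : State w) (h : I k s) :
    Sat W (.while (.lt x y) p) (k * (T + 1) + 1) (k * A) s (I 0) := by
  refine (Sat.while_of_le I hx hy (fun k s h _ => (hstep k s h).2) hend k s h).mono le_rfl le_rfl ?_
  rintro s' ⟨⟨j, hj⟩, hle⟩
  cases j with
  | zero => exact hj
  | succ j => exact absurd (hstep j s' hj).1 (not_lt.2 hle)

/-- Sequential composition of a list of programs. -/
def Prog.block : List Prog → Prog
  -- A no-op: register `32` is temporary, and `Agree` does not look at it.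
  | [] => .instr (.const 32 0)
  | p :: l => .seq p (block l)

theorem Sat.nil {s : State w} {post : State w → Prop} (h : post s) :
    Sat W (.block []) (Prog.block []).len 0 s post := by
  intro t ht
  refine RunsTo.instr _ ⟨s, ⟨fun j hj => ?_, ht.2.1, ht.2.2⟩, h⟩
  have : j ≠ 32 := by omega
  simp [Instr.step, State.setReg_reg, this, ht.1 j hj]

theorem Sat.bind {p : Prog} {l : List Prog} {T₁ T₂ A₁ A₂ : ℕ} {s : State w}
    {Q post : State w → Prop} (h : Sat W p T₁ A₁ s Q)
    (h' : ∀ s', Q s' → Sat W (.block l) T₂ A₂ s' post) :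
    Sat W (.block (p :: l)) (T₁ + T₂) (A₁ + A₂) s post :=
  Sat.seq (h.mono le_rfl le_rfl h')

theorem Sat.bind₀ {p : Prog} {l : List Prog} {T₁ T₂ A : ℕ} {s : State w}
    {Q post : State w → Prop} (h : Sat W p T₁ 0 s Q)
    (h' : ∀ s', Q s' → Sat W (.block l) T₂ A s' post) :
    Sat W (.block (p :: l)) (T₁ + T₂) A s post :=
  (Sat.bind h h').mono le_rfl (by omega) fun _ h => h

theorem Sat.set {r T A : ℕ} {e : Expr} {l : List Prog} (v : ℕ) {s : State w}
    {post : State w → Prop} (hv : e.eval s = v) (he : e.Ok W s)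
    (h : Sat W (.block l) T A (s.set r v) post) :
    Sat W (.block (.assign r e :: l)) ((Prog.assign r e).len + T) A s post :=
  Sat.bind₀ (Sat.assign v hv he h) fun _ h => h

theorem Sat.store {T A : ℕ} {a e : Expr} {l : List Prog} (i v : ℕ) {s : State w}
    {post : State w → Prop} (ha : a.eval s = i) (hv : e.eval s = v) (hao : a.Ok W s)
    (he : e.Ok W s) (h : Sat W (.block l) T A (s.put i v) post) :
    Sat W (.block (.put a e :: l)) ((Prog.put a e).len + T) A s post :=
  Sat.bind₀ (Sat.put i v ha hv hao he h) fun _ h => h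

end WordRAM

/-! ## Sizes, cells and lookup tables -/

namespace EntropyEncoder

/-- The numbers that describe the parameters of an encoder: `n` distributions, with supports of
size at most `m`, and the sizes and probabilities belonging to distribution `d` and symbol `i`,
which are `0` for `i ≥ supp d`. At most `L` input words are moved into the output spill. -/
structure Sizes where
  w : ℕ
  q : ℕ
  n : ℕ
  m : ℕ
  L : ℕ
  supp : ℕ → ℕ
  mn : ℕ → ℕ → ℕ
  kn : ℕ → ℕ → ℕ
  pr : ℕ → ℕ → ℕ

namespace Sizes

variable (D : Sizes)

/-- The size of the output memory. -/
def mout (d : ℕ) : ℕ := (Finset.range D.m).sup (D.mn d) - D.L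

/-- The number of values of the part of the output spill that belongs to symbol `i`: the input
spill and the input words that do not fit into the output memory. -/
def size (d i : ℕ) : ℕ := D.kn d i * 2 ^ (D.w * (D.mn d i - D.mout d))

def total (d : ℕ) : ℕ := ∑ i ∈ Finset.range D.m, D.size d i

/-- The output spill universe is divided into cells of this size. -/
def grain (d : ℕ) : ℕ := max 1 (D.total d / (D.q * D.m))

/-- The number of cells that symbol `i` occupies. -/
def cnt (d i : ℕ) : ℕ := (D.size d i + D.grain d - 1) / D.grain d

/-- The first cell of symbol `i`. -/
def start (d i : ℕ) : ℕ := ∑ j ∈ Finset.range i, D.cnt d j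

/-- The size of the output spill universe. -/
def kout (d : ℕ) : ℕ := D.start d D.m * D.grain d

/-- The symbol that occupies a cell. -/
def owner (d c : ℕ) : ℕ := Nat.findGreatest (fun i => D.start d i ≤ c) D.m

/-! ### The layout of the output spill universe in cells. -/

theorem one_le_grain (d : ℕ) : 1 ≤ D.grain d := le_max_left _ _

theorem size_le_cnt_mul (d i : ℕ) : D.size d i ≤ D.cnt d i * D.grain d := by
  have h := Nat.div_add_mod (D.size d i + D.grain d - 1) (D.grain d)
  have h' := Nat.mod_lt (D.size d i + D.grain d - 1) (D.one_le_grain d)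
  have := D.one_le_grain d
  rw [cnt, mul_comm]
  omega

theorem cnt_mul_le (d i : ℕ) : D.cnt d i * D.grain d ≤ D.size d i + D.grain d :=
  (Nat.div_mul_le_self _ _).trans (Nat.sub_le _ _)

@[simp] theorem start_zero (d : ℕ) : D.start d 0 = 0 := rfl

theorem start_succ (d i : ℕ) : D.start d (i + 1) = D.start d i + D.cnt d i :=
  Finset.sum_range_succ _ _

theorem start_mono (d : ℕ) : Monotone (D.start d) :=
  monotone_nat_of_le_succ fun i => by rw [start_succ]; omega

theorem kout_le_add (d : ℕ) : D.kout d ≤ D.total d + D.m * D.grain d := by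
  rw [kout, start, total, Finset.sum_mul]
  refine (Finset.sum_le_sum fun i _ => D.cnt_mul_le d i).trans ?_
  simp [Finset.sum_add_distrib]

/-- With grain `1` nothing is rounded. Otherwise each of the `m` symbols loses at most one grain,
and `m * grain ≤ total / q`. -/
theorem mul_kout_le (d : ℕ) : D.q * D.kout d ≤ (D.q + 1) * D.total d := by
  rcases Nat.eq_zero_or_pos (D.total d / (D.q * D.m)) with h | h
  · have hg : D.grain d = 1 := by simp [grain, h]
    have : D.kout d = D.total d := by simp [kout, start, total, cnt, hg]
    rw [this, Nat.succ_mul]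
    omega
  · have hg : D.grain d = D.total d / (D.q * D.m) := max_eq_right h
    have h₁ := D.kout_le_add d
    have h₂ : D.grain d * (D.q * D.m) ≤ D.total d := hg ▸ Nat.div_mul_le_self _ _
    nlinarith

theorem kout_le (hq : 1 ≤ D.q) (d : ℕ) : D.kout d ≤ 2 * D.total d := by
  have := D.mul_kout_le d
  nlinarith

/-- The grain is not much smaller than `total / (q * m)`: `total < (grain + 1) * (q * m) ≤ 2 * grain
* (q * m)`. Rounding adds at most `m * grain`, and the sum is divided by `grain`. This bounds the
length of the array of owners. -/
theorem start_le (hq : 1 ≤ D.q) (hm : 1 ≤ D.m) (d : ℕ) : D.start d D.m ≤ 3 * (D.q * D.m) := by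
  have h₁ := D.kout_le_add d
  have h₂ : D.total d < (D.grain d + 1) * (D.q * D.m) := by
    rw [← Nat.div_lt_iff_lt_mul (by positivity)]
    exact Nat.lt_succ_of_le (le_max_right _ _)
  have h₃ := D.one_le_grain d
  have h₄ : D.m ≤ D.q * D.m := Nat.le_mul_of_pos_left _ hq
  rw [kout] at h₁
  by_contra! h
  have h₅ : 3 * (D.q * D.m) * D.grain d < D.start d D.m * D.grain d := by
    gcongr
  nlinarith

theorem size_le_total {d i : ℕ} (hi : i < D.m) : D.size d i ≤ D.total d :=
  Finset.single_le_sum (f := D.size d) (fun _ _ => Nat.zero_le _) (Finset.mem_range.2 hi)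

theorem grain_le (d : ℕ) : D.grain d ≤ D.total d + 1 :=
  max_le (by omega) ((Nat.div_le_self _ _).trans (by omega))

theorem mn_sub_le {d i : ℕ} (hi : i < D.m) : D.mn d i ≤ D.mout d + D.L := by
  have : D.mn d i ≤ (Finset.range D.m).sup (D.mn d) :=
    Finset.le_sup (f := D.mn d) (Finset.mem_range.2 hi)
  rw [mout]
  omega

theorem owner_le (d c : ℕ) : D.owner d c ≤ D.m := Nat.findGreatest_le _

theorem start_owner_le (d c : ℕ) : D.start d (D.owner d c) ≤ c :=
  Nat.findGreatest_spec (P := fun i => D.start d i ≤ c) (Nat.zero_le _) (by simp)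

/-- For `i = D.m` the last hypothesis is void: `D.m` is the owner of all cells behind those of the
symbols. Symbols of size `0` occupy no cell, and `findGreatest` skips them. -/
theorem owner_eq {d c i : ℕ} (hi : i ≤ D.m) (h : D.start d i ≤ c)
    (h' : i < D.m → c < D.start d (i + 1)) : D.owner d c = i := by
  refine le_antisymm (not_lt.1 fun hlt => ?_) (Nat.le_findGreatest hi h)
  have h₁ := h' (hlt.trans_le (D.owner_le d c))
  have h₂ := D.start_mono d (Nat.succ_le_of_lt hlt)
  have h₃ := D.start_owner_le d c
  simp only [Nat.succ_eq_add_one] at h₂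
  omega

theorem div_grain_lt {d k : ℕ} (h : k < D.kout d) : k / D.grain d < D.start d D.m :=
  (Nat.div_lt_iff_lt_mul (D.one_le_grain d)).2 h

theorem start_mul_add_lt {d i x : ℕ} (hi : i < D.m) (hx : x < D.size d i) :
    D.start d i * D.grain d + x < D.kout d := by
  have h₁ : D.start d (i + 1) ≤ D.start d D.m := D.start_mono d hi
  have h₂ := Nat.mul_le_mul_right (D.grain d) h₁
  have h₃ := D.size_le_cnt_mul d i
  rw [start_succ, add_mul] at h₂
  rw [kout]
  omega

/-- The interval of a symbol consists of whole cells, so the cell alone determines the symbol. -/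
theorem owner_start_mul_add {d i x : ℕ} (hi : i < D.m) (hx : x < D.size d i) :
    D.owner d ((D.start d i * D.grain d + x) / D.grain d) = i := by
  have hg := D.one_le_grain d
  have h₃ := D.size_le_cnt_mul d i
  refine D.owner_eq hi.le ?_ fun _ => ?_
  · rw [Nat.le_div_iff_mul_le hg]
    omega
  · rw [Nat.div_lt_iff_lt_mul hg, start_succ, add_mul]
    omega

/-! ### The lookup table -/

/-- The first address after the description of the parameters. -/
def base : ℕ := 4 + D.n + 3 * (D.n * D.m)

/-- The number of table cells per distribution, in addition to those of the description. -/
def stride : ℕ := D.m + 5 + 3 * (D.q * D.m)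

def record (t : ℕ) : ℕ :=
  if t % 3 = 0 then D.mn (t / 3 / D.m) (t / 3 % D.m)
  else if t % 3 = 1 then D.kn (t / 3 / D.m) (t / 3 % D.m)
  else D.pr (t / 3 / D.m) (t / 3 % D.m)

/-- The entry at offset `m + 1` is a sentinel. Read as the start of a symbol after the last one, it
lets the loop that fills in the owners assign `m` to all cells left over. -/
def block (d o : ℕ) : ℕ :=
  if o ≤ D.m then D.start d o
  else if o = D.m + 1 then 3 * (D.q * D.m)
  else if o = D.m + 2 then D.mout d
  else if o = D.m + 3 then D.kout d
  else if o = D.m + 4 then D.grain d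
  else D.owner d (o - (D.m + 5))

/-- Below `base` the layout is that of `Params.Described`. The table can therefore be built in place
over the description, and queries of input parameters are plain lookups. -/
def table (j : ℕ) : ℕ :=
  if j = 0 then D.w else if j = 1 then D.q else if j = 2 then D.n else if j = 3 then D.m
  else if j < 4 + D.n then D.supp (j - 4)
  else if j < D.base then D.record (j - (4 + D.n))
  else D.block ((j - D.base) / D.stride) ((j - D.base) % D.stride)

def tableLen : ℕ := D.base + D.n * D.stride

/-! ### The entries of the table at given addresses. -/

theorem mul_add_lt {a b x y : ℕ} (hx : x < a) (hy : y < b) : x * b + y < a * b := by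
  have := Nat.mul_le_mul_right b (Nat.succ_le_of_lt hx)
  rw [Nat.succ_mul] at this
  omega

theorem mul_stride_add_le {d : ℕ} (hd : d < D.n) :
    d * D.stride + D.stride ≤ D.n * D.stride := by
  rw [← Nat.succ_mul]
  exact Nat.mul_le_mul_right _ hd

theorem table_supp {d : ℕ} (hd : d < D.n) : D.table (4 + d) = D.supp d := by
  have : 4 + d < 4 + D.n := by omega
  rw [table, if_neg (by omega), if_neg (by omega), if_neg (by omega), if_neg (by omega),
    if_pos this]
  simp

theorem table_record {d i o : ℕ} (hd : d < D.n) (hi : i < D.m) (ho : o < 3) :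
    D.table (4 + D.n + 3 * (d * D.m + i) + o) =
      if o = 0 then D.mn d i else if o = 1 then D.kn d i else D.pr d i := by
  have h := mul_add_lt hd hi
  rw [table, if_neg (by omega), if_neg (by omega), if_neg (by omega), if_neg (by omega),
    if_neg (by omega), if_pos (by rw [base]; omega)]
  have h₁ : 4 + D.n + 3 * (d * D.m + i) + o - (4 + D.n) = 3 * (d * D.m + i) + o := by omega
  have h₂ : (3 * (d * D.m + i) + o) / 3 = d * D.m + i := by omega
  have h₃ : (3 * (d * D.m + i) + o) % 3 = o := by omega
  have h₄ : (d * D.m + i) / D.m = d := by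
    rw [mul_comm, Nat.mul_add_div (by omega), Nat.div_eq_of_lt hi, add_zero]
  have h₅ : (d * D.m + i) % D.m = i := by
    rw [mul_comm, Nat.mul_add_mod, Nat.mod_eq_of_lt hi]
  rw [record, h₁, h₂, h₃, h₄, h₅]

theorem table_mn {d i : ℕ} (hd : d < D.n) (hi : i < D.m) :
    D.table (4 + D.n + 3 * (d * D.m + i)) = D.mn d i :=
  D.table_record hd hi (o := 0) (by norm_num)

theorem table_kn {d i : ℕ} (hd : d < D.n) (hi : i < D.m) :
    D.table (4 + D.n + 3 * (d * D.m + i) + 1) = D.kn d i :=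
  D.table_record hd hi (o := 1) (by norm_num)

theorem table_pr {d i : ℕ} (hd : d < D.n) (hi : i < D.m) :
    D.table (4 + D.n + 3 * (d * D.m + i) + 2) = D.pr d i :=
  D.table_record hd hi (o := 2) (by norm_num)

theorem table_block {d o : ℕ} (ho : o < D.stride) :
    D.table (D.base + d * D.stride + o) = D.block d o := by
  have hb : 4 + D.n ≤ D.base := by rw [base]; omega
  rw [table, if_neg (by omega), if_neg (by omega), if_neg (by omega), if_neg (by omega),
    if_neg (by omega), if_neg (by omega)]
  have h₁ : D.base + d * D.stride + o - D.base = D.stride * d + o := by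
    rw [mul_comm D.stride]; omega
  rw [h₁, Nat.mul_add_div (by omega), Nat.div_eq_of_lt ho, Nat.mul_add_mod, Nat.mod_eq_of_lt ho,
    add_zero]

theorem table_start {d i : ℕ} (hi : i ≤ D.m) :
    D.table (D.base + d * D.stride + i) = D.start d i := by
  rw [table_block _ (by rw [stride]; omega), block, if_pos hi]

theorem table_cells (d : ℕ) :
    D.table (D.base + d * D.stride + D.m + 1) = 3 * (D.q * D.m) := by
  rw [add_assoc _ D.m, table_block _ (by rw [stride]; omega), block, if_neg (by omega),
    if_pos rfl]

theorem table_mout (d : ℕ) : D.table (D.base + d * D.stride + D.m + 2) = D.mout d := by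
  rw [add_assoc _ D.m, table_block _ (by rw [stride]; omega), block, if_neg (by omega),
    if_neg (by omega), if_pos rfl]

theorem table_kout (d : ℕ) : D.table (D.base + d * D.stride + D.m + 3) = D.kout d := by
  rw [add_assoc _ D.m, table_block _ (by rw [stride]; omega), block, if_neg (by omega),
    if_neg (by omega), if_neg (by omega), if_pos rfl]

theorem table_grain (d : ℕ) : D.table (D.base + d * D.stride + D.m + 4) = D.grain d := by
  rw [add_assoc _ D.m, table_block _ (by rw [stride]; omega), block, if_neg (by omega),
    if_neg (by omega), if_neg (by omega), if_neg (by omega), if_pos rfl]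

theorem table_owner {d c : ℕ} (hc : c < 3 * (D.q * D.m)) :
    D.table (D.base + d * D.stride + D.m + 5 + c) = D.owner d c := by
  rw [add_assoc _ D.m, add_assoc, table_block _ (by rw [stride]; omega), block,
    if_neg (by omega), if_neg (by omega), if_neg (by omega), if_neg (by omega),
    if_neg (by omega)]
  congr 1
  omega

/-! ### Bounds that exclude overflow. -/

/-- All numbers that occur in computations fit into `W` bits. -/
structure Fits (W : ℕ) : Prop where
  one_le_w : 1 ≤ D.w
  w_lt : D.w < W
  pow_lt : 2 ^ D.w < 2 ^ W
  one_le_q : 1 ≤ D.q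
  one_le_n : 1 ≤ D.n
  one_le_m : 1 ≤ D.m
  L_lt : D.L < 2 ^ W
  tableLen_lt : D.tableLen < 2 ^ W
  supp_lt : ∀ d, D.supp d < 2 ^ W
  -- Shift amounts `w * (mn - mout)` are computed in registers.
  mul_mn_lt : ∀ d i, D.w * D.mn d i < 2 ^ W
  kn_lt : ∀ d i, D.kn d i < 2 ^ W
  pr_lt : ∀ d i, D.pr d i < 2 ^ W
  -- This covers `kout ≤ 2 * total` and also the intermediate value `size + grain ≤ 2 * total + 1`
  -- in the rounding up of a size.
  total_lt : ∀ d, 2 * D.total d + 1 < 2 ^ W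

namespace Fits

variable {D} {W : ℕ} (h : D.Fits W)
include h

theorem mn_lt (d i : ℕ) : D.mn d i < 2 ^ W :=
  (Nat.le_mul_of_pos_left _ h.one_le_w).trans_lt (h.mul_mn_lt d i)

theorem kout_lt (d : ℕ) : D.kout d < 2 ^ W := by
  have := D.kout_le h.one_le_q d
  have := h.total_lt d
  omega

theorem grain_lt (d : ℕ) : D.grain d < 2 ^ W := by
  have := D.grain_le d
  have := h.total_lt d
  omega

theorem size_lt (d : ℕ) {i : ℕ} (hi : i < D.m) : D.size d i < 2 ^ W := by
  have := D.size_le_total (d := d) hi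
  have := h.total_lt d
  omega

theorem mout_mul_lt (d : ℕ) : D.w * D.mout d < 2 ^ W := by
  obtain ⟨i, -, hi⟩ := Finset.exists_mem_eq_sup (Finset.range D.m)
    ⟨0, Finset.mem_range.2 h.one_le_m⟩ (D.mn d)
  refine lt_of_le_of_lt (Nat.mul_le_mul_left _ ?_) (h.mul_mn_lt d i)
  rw [mout, hi]
  omega

theorem mout_lt (d : ℕ) : D.mout d < 2 ^ W :=
  (Nat.le_mul_of_pos_left _ h.one_le_w).trans_lt (h.mout_mul_lt d)

theorem cells_lt : 3 * (D.q * D.m) < 2 ^ W := by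
  have h₁ := h.tableLen_lt
  have h₂ := Nat.le_mul_of_pos_left D.stride h.one_le_n
  rw [tableLen] at h₁
  rw [stride] at h₁ h₂
  omega

theorem start_lt (d : ℕ) {i : ℕ} (hi : i ≤ D.m) : D.start d i < 2 ^ W :=
  ((D.start_mono d hi).trans (D.start_le h.one_le_q h.one_le_m d)).trans_lt h.cells_lt

theorem m_lt : D.m < 2 ^ W :=
  ((Nat.le_mul_of_pos_left D.m h.one_le_q).trans (by omega)).trans_lt h.cells_lt

theorem q_lt : D.q < 2 ^ W :=
  ((Nat.le_mul_of_pos_right D.q h.one_le_m).trans (by omega)).trans_lt h.cells_lt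

theorem n_lt : D.n < 2 ^ W := by
  have h₁ := h.tableLen_lt
  rw [tableLen, base] at h₁
  omega

theorem w_lt_pow : D.w < 2 ^ W := h.w_lt.trans Nat.lt_two_pow_self

theorem table_lt {j : ℕ} : D.table j < 2 ^ W := by
  have hw := h.w_lt_pow
  have hq := h.q_lt
  have hn := h.n_lt
  have hm := h.m_lt
  unfold table
  split_ifs
  · exact hw
  · exact hq
  · exact hn
  · exact hm
  · exact h.supp_lt _
  · unfold record
    split_ifs
    exacts [h.mn_lt _ _, h.kn_lt _ _, h.pr_lt _ _]
  · unfold block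
    split_ifs with h₁
    exacts [h.start_lt _ h₁, h.cells_lt, h.mout_lt _, h.kout_lt _, h.grain_lt _,
      (D.owner_le _ _).trans_lt hm]

end Fits

end Sizes

end EntropyEncoder

/-! ## Programs for the operations -/

namespace EntropyEncoder

open WordRAM Expr

/-- Load the header of the table (or of the description of the parameters). -/
def header : Prog := .block [
  .assign 5 (load (lit 0)),
  .assign 6 (load (lit 1)),
  .assign 7 (load (lit 2)),
  .assign 8 (load (lit 3)),
  .assign 24 (lit 4 + reg 7 + lit 3 * (reg 7 * reg 8)),
  .assign 25 (reg 8 + lit 5 + lit 3 * (reg 6 * reg 8))]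

/-- The address of the block of distribution `d`. -/
def blockExpr (d : Expr) : Expr := reg 24 + d * reg 25

/-- The address of the record of symbol `i` of distribution `d`. -/
def recordExpr (d i : Expr) : Expr := lit 4 + reg 7 + lit 3 * (d * reg 8 + i)

namespace Sizes

variable (D : Sizes) {w W : ℕ}

/-- The registers contain the header. -/
structure Header (s : State w) : Prop where
  w_eq : s.reg 5 = D.w
  q_eq : s.reg 6 = D.q
  n_eq : s.reg 7 = D.n
  m_eq : s.reg 8 = D.m
  base_eq : s.reg 24 = D.base
  stride_eq : s.reg 25 = D.stride

variable {D}

theorem Fits.base_lt (h : D.Fits W) : D.base < 2 ^ W := by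
  have := h.tableLen_lt
  rw [tableLen] at this
  omega

theorem Fits.stride_lt (h : D.Fits W) : D.stride < 2 ^ W := by
  have h₁ := h.tableLen_lt
  have h₂ := Nat.le_mul_of_pos_left D.stride h.one_le_n
  rw [tableLen] at h₁
  omega

theorem Fits.ne_zero (h : D.Fits W) : W ≠ 0 := by
  have := h.w_lt
  omega

theorem header_spec (h : D.Fits W) (s : State w) (h0 : s.mem 0 = D.w) (h1 : s.mem 1 = D.q)
    (h2 : s.mem 2 = D.n) (h3 : s.mem 3 = D.m) :
    Sat W header header.len 0 s fun s' =>
      D.Header s' ∧ s'.mem = s.mem ∧ s'.vm = s.vm ∧ ∀ j < 5, s'.reg j = s.reg j := by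
  have hb := h.base_lt
  have hs := h.stride_lt
  have hw := h.w_lt_pow
  have hq := h.q_lt
  have hn := h.n_lt
  have hm := h.m_lt
  have hW := h.ne_zero
  rw [base] at hb
  rw [stride] at hs
  refine Sat.set D.w (by simpa) (by simp [h0]; omega) ?_
  refine Sat.set D.q (by simpa) (by simp [h1]; omega) ?_
  refine Sat.set D.n (by simpa) (by simp [h2]; omega) ?_
  refine Sat.set D.m (by simpa) (by simp [h3]; omega) ?_
  refine Sat.set D.base (by simp [base]) (by simp; omega) ?_
  refine Sat.set D.stride (by simp [stride]) (by simp; omega) ?_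
  refine Sat.nil ⟨⟨by simp, by simp, by simp, by simp, by simp, by simp⟩, by simp, by simp, ?_⟩
  intro j hj
  interval_cases j <;> simp

variable (D) in
/-- The table is in memory. -/
def Loads (mem : ℕ → ℕ) : Prop := ∀ j < D.tableLen, mem j = D.table j

namespace Loads

variable {mem : ℕ → ℕ} (hl : D.Loads mem) {d i : ℕ} (hd : d < D.n)
include hl hd

theorem block {o : ℕ} (ho : o < D.stride) :
    mem (D.base + d * D.stride + o) = D.table (D.base + d * D.stride + o) := by
  refine hl _ ?_
  have := D.mul_stride_add_le hd
  rw [tableLen]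
  omega

theorem mout : mem (D.base + d * D.stride + D.m + 2) = D.mout d := by
  rw [← D.table_mout d, add_assoc _ D.m, hl.block hd (by rw [stride]; omega)]

theorem kout : mem (D.base + d * D.stride + D.m + 3) = D.kout d := by
  rw [← D.table_kout d, add_assoc _ D.m, hl.block hd (by rw [stride]; omega)]

theorem grain : mem (D.base + d * D.stride + D.m + 4) = D.grain d := by
  rw [← D.table_grain d, add_assoc _ D.m, hl.block hd (by rw [stride]; omega)]

theorem start (hi : i ≤ D.m) : mem (D.base + d * D.stride + i) = D.start d i := by
  rw [← D.table_start hi, hl.block hd (by rw [stride]; omega)]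

theorem owner {c : ℕ} (hc : c < 3 * (D.q * D.m)) :
    mem (D.base + d * D.stride + D.m + 5 + c) = D.owner d c := by
  rw [← D.table_owner hc, add_assoc _ D.m, add_assoc _ (D.m + 5),
    hl.block hd (by rw [stride]; omega)]

theorem record (hi : i < D.m) {o : ℕ} (ho : o < 3) :
    mem (4 + D.n + 3 * (d * D.m + i) + o) = D.table (4 + D.n + 3 * (d * D.m + i) + o) := by
  refine hl _ ?_
  have := mul_add_lt hd hi
  rw [tableLen, base]
  omega

theorem mn (hi : i < D.m) : mem (4 + D.n + 3 * (d * D.m + i)) = D.mn d i := by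
  rw [← D.table_mn hd hi]
  exact hl.record hd hi (o := 0) (by norm_num)

theorem kn (hi : i < D.m) : mem (4 + D.n + 3 * (d * D.m + i) + 1) = D.kn d i := by
  rw [← D.table_kn hd hi, hl.record hd hi (by norm_num)]

theorem pr (hi : i < D.m) : mem (4 + D.n + 3 * (d * D.m + i) + 2) = D.pr d i := by
  rw [← D.table_pr hd hi, hl.record hd hi (by norm_num)]

end Loads

theorem Loads.header_spec (h : D.Fits W) (s : State w) (hl : D.Loads s.mem) :
    Sat W header header.len 0 s fun s' =>
      D.Header s' ∧ s'.mem = s.mem ∧ s'.vm = s.vm ∧ ∀ j < 5, s'.reg j = s.reg j := by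
  have hb : 4 ≤ D.tableLen := by rw [tableLen, base]; omega
  refine Sizes.header_spec h s ?_ ?_ ?_ ?_
  all_goals rw [hl _ (by omega)]; rfl

/-- Addresses within the block of a distribution do not overflow. -/
theorem Fits.block_lt (h : D.Fits W) {d : ℕ} (hd : d < D.n) :
    D.base + d * D.stride + D.stride < 2 ^ W := by
  have h₁ := h.tableLen_lt
  have := D.mul_stride_add_le hd
  rw [tableLen] at h₁
  omega

/-- Addresses within a record do not overflow. -/
theorem Fits.record_lt (h : D.Fits W) {d i : ℕ} (hd : d < D.n) (hi : i < D.m) :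
    4 + D.n + 3 * (d * D.m + i) + 2 < 2 ^ W := by
  have h₁ := h.base_lt
  have := mul_add_lt hd hi
  rw [base] at h₁
  omega

end Sizes

/-! ### Decoding an output spill into a symbol and an offset. -/

/-- Decode an output spill in register `1` under the distribution in register `0`. -/
def locate : Prog := .block [
  header,
  .assign 9 (blockExpr (reg 0)),
  .assign 10 (load (reg 9 + reg 8 + lit 2)),
  .assign 11 (load (reg 9 + reg 8 + lit 4)),
  .assign 12 (load (reg 9 + reg 8 + lit 5 + reg 1 / reg 11)),
  .assign 13 (load (recordExpr (reg 0) (reg 12))),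
  .assign 14 (load (reg 9 + reg 12) * reg 11),
  .assign 15 (reg 1 - reg 14),
  .assign 16 (reg 5 * (reg 13 - reg 10))]

namespace Sizes

variable {D : Sizes} {w W : ℕ}

/-- The registers contain the result of decoding the output spill
`start d i * grain d + x`. -/
structure Located (D : Sizes) (d i x : ℕ) (s : State w) : Prop extends D.Header s where
  mout_eq : s.reg 10 = D.mout d
  grain_eq : s.reg 11 = D.grain d
  symbol_eq : s.reg 12 = i
  mn_eq : s.reg 13 = D.mn d i
  offset_eq : s.reg 14 = D.start d i * D.grain d
  rest_eq : s.reg 15 = x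
  shift_eq : s.reg 16 = D.w * (D.mn d i - D.mout d)

theorem locate_spec (h : D.Fits W) (s : State w) (hl : D.Loads s.mem) {d i x : ℕ} (hd : d < D.n)
    (hi : i < D.m) (hx : x < D.size d i) (h0 : s.reg 0 = d)
    (h1 : s.reg 1 = D.start d i * D.grain d + x) :
    Sat W locate locate.len 0 s fun s' =>
      D.Located d i x s' ∧ s'.mem = s.mem ∧ s'.vm = s.vm ∧ ∀ j < 5, s'.reg j = s.reg j := by
  refine Sat.bind₀ (hl.header_spec h s) ?_
  rintro s₁ ⟨hH, hm, hv, hr⟩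
  rw [← hm] at hl
  have h0' : s₁.reg 0 = d := by rw [hr _ (by norm_num), h0]
  have h1' : s₁.reg 1 = D.start d i * D.grain d + x := by rw [hr _ (by norm_num), h1]
  have hW := h.ne_zero
  have hB := h.block_lt hd
  have hR := h.record_lt hd hi
  have hmm := h.m_lt
  have hst := h.stride_lt
  have hk := h.kout_lt d
  have hk' := D.start_mul_add_lt hi hx
  have hg := h.grain_lt d
  have hmo := h.mout_lt d
  have hsi := h.start_lt d hi.le
  have hmi := h.mn_lt d i
  have hwm := h.mul_mn_lt d i
  have hw := h.w_lt_pow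
  have hown := D.owner_start_mul_add hi hx
  -- The cell of a valid output spill lies within the array of owners.
  have hc := (D.div_grain_lt hk').trans_le (D.start_le h.one_le_q h.one_le_m d)
  have e10 := hl.mout hd
  have e11 := hl.grain hd
  have e12 := hl.owner hd hc
  have e13 := hl.mn hd hi
  have e14 := hl.start hd hi.le
  have hmul : D.w * (D.mn d i - D.mout d) ≤ D.w * D.mn d i :=
    Nat.mul_le_mul_left _ (Nat.sub_le _ _)
  rw [hown] at e12
  have hS : D.m + 5 + 3 * (D.q * D.m) = D.stride := rfl
  generalize hcc : (D.start d i * D.grain d + x) / D.grain d = c at *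
  refine Sat.set (D.base + d * D.stride)
    (by simp [blockExpr, hH.base_eq, hH.stride_eq, h0'])
    (by simp [blockExpr, hH.base_eq, hH.stride_eq, h0']; omega) ?_
  refine Sat.set (D.mout d) (by simp [hH.m_eq, e10]) (by simp [hH.m_eq, e10]; omega) ?_
  refine Sat.set (D.grain d) (by simp [hH.m_eq, e11]) (by simp [hH.m_eq, e11]; omega) ?_
  refine Sat.set i (by simp [hH.m_eq, h1', hcc, e12])
    (by simp [hH.m_eq, h1', hcc, e12]; omega) ?_
  refine Sat.set (D.mn d i) (by simp [recordExpr, hH.m_eq, hH.n_eq, h0', e13])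
    (by simp [recordExpr, hH.m_eq, hH.n_eq, h0', e13]; omega) ?_
  refine Sat.set (D.start d i * D.grain d) (by simp [e14])
    (by simp [e14]; omega) ?_
  refine Sat.set x (by simp [h1']) (by simp [h1']; omega) ?_
  refine Sat.set (D.w * (D.mn d i - D.mout d)) (by simp [hH.w_eq]) (by simp [hH.w_eq]; omega) ?_
  refine Sat.nil ⟨⟨⟨?_, ?_, ?_, ?_, ?_, ?_⟩, ?_, ?_, ?_, ?_, ?_, ?_, ?_⟩, ?_, ?_, ?_⟩
  all_goals try simp [hH.w_eq, hH.q_eq, hH.n_eq, hH.m_eq, hH.base_eq, hH.stride_eq, hm, hv]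
  intro j hj
  interval_cases j <;> simp [hr]

end Sizes

end EntropyEncoder

/-! ## The code -/

namespace EntropyEncoder

open WordRAM Expr

variable {Φ : Type*}

/-- A function of distributions and symbols as a function of their numbers, padded by `0`. -/
noncomputable def Params.pad (P : Params Φ) (f : ∀ d, (P.dist d).support → ℕ) (d i : ℕ) : ℕ :=
  open Classical in
  if h : ∃ hd : d < P.numDist, i < P.suppSize ⟨d, hd⟩ then
    f ⟨d, h.1⟩ ((P.name ⟨d, h.1⟩).symm ⟨i, h.2⟩)
  else 0

theorem Params.pad_name (P : Params Φ) (f : ∀ d, (P.dist d).support → ℕ) (d : Fin P.numDist)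
    (φ : (P.dist d).support) : P.pad f d (P.name d φ) = f d φ := by
  rw [pad, dif_pos ⟨d.2, (P.name d φ).2⟩]
  simp

theorem Params.pad_of_le (P : Params Φ) (f : ∀ d, (P.dist d).support → ℕ) (d : Fin P.numDist)
    {i : ℕ} (hi : P.suppSize d ≤ i) : P.pad f d i = 0 := by
  rw [pad, dif_neg]
  rintro ⟨_, h⟩
  exact absurd h (not_lt.2 hi)

theorem Params.pad_le (P : Params Φ) (f : ∀ d, (P.dist d).support → ℕ) {B : ℕ}
    (hf : ∀ d φ, f d φ ≤ B) (d i : ℕ) : P.pad f d i ≤ B := by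
  rw [pad]
  split_ifs
  exacts [hf _ _, Nat.zero_le _]

/-- The numbers describing the parameters, with probabilities of `nb` fractional bits. -/
noncomputable def Params.sizes (P : Params Φ) (w q nb L : ℕ) : Sizes where
  w := w
  q := q
  n := P.numDist
  m := P.maxSupp
  L := L
  supp d := if h : d < P.numDist then P.suppSize ⟨d, h⟩ else 0
  mn := P.pad P.Min
  kn := P.pad P.Kin
  pr := P.pad (P.probCode nb)

theorem Params.suppSize_le (P : Params Φ) (d : Fin P.numDist) : P.suppSize d ≤ P.maxSupp :=
  Finset.le_sup (f := P.suppSize) (Finset.mem_univ d)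

theorem Params.name_lt (P : Params Φ) (d : Fin P.numDist) (φ : (P.dist d).support) :
    (P.name d φ : ℕ) < P.maxSupp :=
  (P.name d φ).2.trans_le (P.suppSize_le d)

/-- The content with symbol `φ` whose spill and last words are the digits of `y`. -/
noncomputable def Params.content (P : Params Φ) {w M : ℕ} (d : Fin P.numDist)
    (φ : (P.dist d).support) (vm : Fin M → BitVec w) (y : ℕ) : Option (Content P w d) :=
  if hk : y / 2 ^ (w * (P.Min d φ - M)) < P.Kin d φ then
    some {
      symbol := φ
      vm := fun j =>
        if hj : (j : ℕ) < M then vm ⟨j, hj⟩ else BitVec.ofNat w (y / 2 ^ (w * (j - M)))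
      spill := ⟨_, hk⟩ }
  else none

/-- The entropy encoder. -/
noncomputable def Params.code (P : Params Φ) (w q nb L : ℕ) : Code P w where
  Mout d := (P.sizes w q nb L).mout d
  Kout d := (P.sizes w q nb L).kout d
  decode d vm k :=
    if h : (P.sizes w q nb L).owner d (k / (P.sizes w q nb L).grain d) < P.suppSize d then
      P.content d ((P.name d).symm ⟨_, h⟩) vm (k -
        (P.sizes w q nb L).start d ((P.sizes w q nb L).owner d (k / (P.sizes w q nb L).grain d)) *
          (P.sizes w q nb L).grain d)
    else none
  tableLen := (P.sizes w q nb L).tableLen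
  table := (P.sizes w q nb L).table

/-! ### Encodings in terms of offsets. -/

section
variable {P : Params Φ} {w q nb L : ℕ}

theorem Params.content_eq_some {M : ℕ} {d : Fin P.numDist} {φ : (P.dist d).support}
    {vm : Fin M → BitVec w} {y : ℕ} {x : Content P w d} :
    P.content d φ vm y = some x ↔ φ = x.symbol ∧
      y / 2 ^ (w * (P.Min d x.symbol - M)) = x.spill ∧
      ∀ j, x.vm j =
        if hj : (j : ℕ) < M then vm ⟨j, hj⟩ else BitVec.ofNat w (y / 2 ^ (w * (j - M))) := by
  obtain ⟨ψ, v, k⟩ := x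
  rw [content]
  constructor
  · intro h
    split_ifs at h with hk
    simp only [Option.some.injEq, Content.mk.injEq] at h
    obtain ⟨rfl, hv, hk⟩ := h
    have hv := eq_of_heq hv
    have hk := eq_of_heq hk
    subst hv hk
    exact ⟨rfl, rfl, fun j => rfl⟩
  · rintro ⟨rfl, hk, hv⟩
    simp only at hk hv
    have hlt := k.2
    rw [← hk] at hlt
    rw [dif_pos hlt]
    congr 2
    · exact (funext hv).symm
    · exact Fin.ext hk

theorem Params.size_name (d : Fin P.numDist) (φ : (P.dist d).support) :
    (P.sizes w q nb L).size d (P.name d φ) =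
      P.Kin d φ * 2 ^ (w * (P.Min d φ - (P.sizes w q nb L).mout d)) := by
  rw [Sizes.size]
  simp only [sizes, P.pad_name]

/-- The form in which all operations are verified: `y` is the offset in the interval of the symbol.
The bound `y < size` amounts to the leading part of `y` being below `Kin`, which holds because this
part is the input spill. Output words from `Min` on are irrelevant. -/
theorem Params.encodes_code {d : Fin P.numDist} {vm : ℕ → BitVec w} {k : ℕ}
    {x : Content P w d} :
    (P.code w q nb L).Encodes d vm k x ↔
      ∃ y < (P.sizes w q nb L).size d (P.name d x.symbol),
        k = (P.sizes w q nb L).start d (P.name d x.symbol) * (P.sizes w q nb L).grain d + y ∧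
        y / 2 ^ (w * (P.Min d x.symbol - (P.sizes w q nb L).mout d)) = x.spill ∧
        ∀ j, x.vm j = if (j : ℕ) < (P.sizes w q nb L).mout d then vm j
          else BitVec.ofNat w (y / 2 ^ (w * (j - (P.sizes w q nb L).mout d))) := by
  have hi : (P.name d x.symbol : ℕ) < (P.sizes w q nb L).m := P.name_lt d x.symbol
  constructor
  · rintro ⟨hk, h⟩
    simp only [code] at h
    split_ifs at h with ho
    obtain ⟨h₁, h₂, h₃⟩ := content_eq_some.1 h
    have h₄ : (P.sizes w q nb L).owner d (k / (P.sizes w q nb L).grain d) =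
        P.name d x.symbol := by
      rw [← h₁]
      simp
    have h₅ := (P.sizes w q nb L).start_owner_le d (k / (P.sizes w q nb L).grain d)
    rw [Nat.le_div_iff_mul_le ((P.sizes w q nb L).one_le_grain d)] at h₅
    rw [h₄] at h₂ h₃ h₅
    refine ⟨_, ?_, (Nat.add_sub_of_le h₅).symm, h₂, h₃⟩
    rw [size_name, ← Nat.div_lt_iff_lt_mul (by positivity), h₂]
    exact x.spill.2
  · rintro ⟨y, hy, rfl, h₂, h₃⟩
    refine ⟨(P.sizes w q nb L).start_mul_add_lt hi hy, ?_⟩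
    have h₄ := (P.sizes w q nb L).owner_start_mul_add hi hy
    simp only [code]
    rw [dif_pos (by rw [h₄]; exact (P.name d x.symbol).2), content_eq_some]
    simp only [h₄, Nat.add_sub_cancel_left]
    exact ⟨by simp, h₂, h₃⟩

end

/-! ### Digits -/

/-- The induction splits off the lowest digit, which shifts `f`. -/
theorem exists_digits (w k : ℕ) (t : ℕ) (f : ℕ → ℕ) (hf : ∀ i < t, f i < 2 ^ w) :
    ∃ y, y / 2 ^ (w * t) = k ∧ ∀ i < t, y / 2 ^ (w * i) % 2 ^ w = f i := by
  induction t generalizing f with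
  | zero => exact ⟨k, by simp, by simp⟩
  | succ t ih =>
    obtain ⟨y, hy, hd⟩ := ih (fun i => f (i + 1)) fun i hi => hf _ (by omega)
    have h0 := hf 0 (by omega)
    have hstep : ∀ i, (y * 2 ^ w + f 0) / 2 ^ (w * (i + 1)) = y / 2 ^ (w * i) := by
      intro i
      rw [mul_add, mul_one, add_comm (w * i), pow_add, ← Nat.div_div_eq_div_mul, mul_comm y,
        Nat.mul_add_div (by positivity), Nat.div_eq_of_lt h0, add_zero]
    refine ⟨y * 2 ^ w + f 0, by rw [hstep, hy], fun i hi => ?_⟩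
    cases i with
    | zero => simp [Nat.mod_eq_of_lt h0, Nat.add_mod]
    | succ i => rw [hstep, hd i (by omega)]

/-- Replace the digit number `i` of `y` in base `2 ^ w` by `v`. -/
def setDigit (w i y v : ℕ) : ℕ :=
  (y / 2 ^ (w * i) / 2 ^ w * 2 ^ w + v) * 2 ^ (w * i) + y % 2 ^ (w * i)

theorem setDigit_div (w i y v : ℕ) : setDigit w i y v / 2 ^ (w * i) =
    y / 2 ^ (w * i) / 2 ^ w * 2 ^ w + v := by
  rw [setDigit, mul_comm, Nat.mul_add_div (by positivity),
    Nat.div_eq_of_lt (Nat.mod_lt _ (by positivity)), add_zero]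

theorem setDigit_div_of_lt {w i j y v : ℕ} (hv : v < 2 ^ w) (hij : i < j) :
    setDigit w i y v / 2 ^ (w * j) = y / 2 ^ (w * j) := by
  obtain ⟨t, rfl⟩ := Nat.exists_eq_add_of_lt hij
  have : w * (i + t + 1) = w * i + (w + w * t) := by ring
  rw [this, pow_add, pow_add, ← Nat.div_div_eq_div_mul, ← Nat.div_div_eq_div_mul, setDigit_div,
    mul_comm _ (2 ^ w), Nat.mul_add_div (by positivity), Nat.div_eq_of_lt hv, add_zero,
    ← Nat.div_div_eq_div_mul, ← Nat.div_div_eq_div_mul]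

/-- A digit below position `i` depends only on the residue modulo `2 ^ (w * i)`, which `setDigit`
keeps. -/
theorem setDigit_div_mod_of_gt {w i j y v : ℕ} (hij : j < i) :
    setDigit w i y v / 2 ^ (w * j) % 2 ^ w = y / 2 ^ (w * j) % 2 ^ w := by
  have key : ∀ z : ℕ, z / 2 ^ (w * j) % 2 ^ w = z % 2 ^ (w * i) / 2 ^ (w * j) % 2 ^ w := by
    intro z
    have h : 2 ^ (w * j) * 2 ^ w ∣ 2 ^ (w * i) := by
      rw [← pow_add, ← Nat.mul_succ]
      exact pow_dvd_pow _ (Nat.mul_le_mul_left _ hij)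
    rw [← Nat.mod_mul_right_div_self, ← Nat.mod_mul_right_div_self, Nat.mod_mod_of_dvd _ h]
  rw [key, key y]
  congr 2
  rw [setDigit, add_comm, Nat.add_mul_mod_self_right, Nat.mod_mod]

theorem setDigit_div_mod {w i y v : ℕ} (hv : v < 2 ^ w) :
    setDigit w i y v / 2 ^ (w * i) % 2 ^ w = v := by
  rw [setDigit_div, add_comm, Nat.add_mul_mod_self_right, Nat.mod_eq_of_lt hv]

theorem ofNat_eq_ofNat {w x y : ℕ} (h : x % 2 ^ w = y % 2 ^ w) :
    BitVec.ofNat w x = BitVec.ofNat w y :=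
  BitVec.eq_of_toNat_eq (by simpa using h)

section
variable {P : Params Φ} {w q nb L : ℕ}

/-- Every content has an encoding. -/
theorem Params.total_code (P : Params Φ) (w q nb L : ℕ) : (P.code w q nb L).Total := by
  intro d x
  set M := (P.sizes w q nb L).mout d with hM
  -- Past the input words the output memory may hold anything; zero is chosen.
  let g : ℕ → BitVec w := fun j => if hj : j < P.Min d x.symbol then x.vm ⟨j, hj⟩ else 0
  obtain ⟨y, hy, hd⟩ := exists_digits w x.spill (P.Min d x.symbol - M)
    (fun i => (g (M + i)).toNat) fun i _ => (g (M + i)).isLt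
  refine ⟨g, _, encodes_code.2 ⟨y, ?_, rfl, hy, fun j => ?_⟩⟩
  · rw [size_name, ← Nat.div_lt_iff_lt_mul (by positivity), hy]
    exact x.spill.2
  · have hg : x.vm j = g j := by simp [g]
    split_ifs with hj
    · exact hg
    · rw [hg]
      refine BitVec.eq_of_toNat_eq ?_
      have hjm := j.2
      rw [BitVec.toNat_ofNat, ← hM, hd (j - M) (by omega)]
      congr 2
      omega

end

end EntropyEncoder

/-! ## Queries, and operations that keep the symbol -/

namespace EntropyEncoder

open WordRAM Expr

def querySizes : Prog := .block [
  header,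
  .assign 9 (blockExpr (reg 0)),
  .assign 0 (load (reg 9 + reg 8 + lit 2)),
  .assign 1 (load (reg 9 + reg 8 + lit 3))]

def querySymbol : Prog := .block [
  header,
  .assign 9 (recordExpr (reg 0) (reg 1)),
  .assign 0 (load (reg 9)),
  .assign 1 (load (reg 9 + lit 1)),
  .assign 2 (load (reg 9 + lit 2))]

def readSymbol : Prog := .block [locate, .assign 0 (reg 12)]

def readSpill : Prog := .block [locate, .assign 0 (reg 15 >>> reg 16)]

def writeSpill : Prog := .block [
  locate,
  .assign 0 (reg 14 + (reg 2 <<< reg 16 + reg 15 % (lit 1 <<< reg 16)))]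

def readWord : Prog := .block [
  locate,
  .ite (.lt 2 10)
    (.instr (.vmRead 0 2))
    (.assign 0 ((reg 15 >>> (reg 5 * (reg 2 - reg 10))) % (lit 1 <<< reg 5)))]

def writeWord : Prog := .block [
  locate,
  .ite (.lt 2 10)
    (.block [.instr (.vmWrite 2 3), .assign 0 (reg 1)])
    (.block [
      .assign 17 (reg 5 * (reg 2 - reg 10)),
      .assign 18 (reg 15 >>> reg 17 >>> reg 5 <<< reg 5 + reg 3),
      .assign 0 (reg 14 + (reg 18 <<< reg 17 + reg 15 % (lit 1 <<< reg 17)))])]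

variable {Φ : Type*} {P : Params Φ} {w q nb L W : ℕ}

theorem Params.locate_code (hF : (P.sizes w q nb L).Fits W) {s : State w} {d : Fin P.numDist}
    {x : Content P w d} (hl : (P.code w q nb L).Loaded s.mem) (h0 : s.reg 0 = d)
    (hx : (P.code w q nb L).Encodes d s.vm (s.reg 1) x) :
    ∃ y < (P.sizes w q nb L).size d (P.name d x.symbol),
      y / 2 ^ (w * (P.Min d x.symbol - (P.sizes w q nb L).mout d)) = x.spill ∧
      (∀ j, x.vm j = if (j : ℕ) < (P.sizes w q nb L).mout d then s.vm j
        else BitVec.ofNat w (y / 2 ^ (w * (j - (P.sizes w q nb L).mout d)))) ∧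
      s.reg 1 = (P.sizes w q nb L).start d (P.name d x.symbol) * (P.sizes w q nb L).grain d + y ∧
      Sat W locate locate.len 0 s fun s' =>
        (P.sizes w q nb L).Located d (P.name d x.symbol) y s' ∧ s'.reg 5 = w ∧
        s'.reg 13 = P.Min d x.symbol ∧
        s'.reg 16 = w * (P.Min d x.symbol - (P.sizes w q nb L).mout d) ∧
        s'.mem = s.mem ∧ s'.vm = s.vm ∧ ∀ j < 5, s'.reg j = s.reg j := by
  obtain ⟨y, hy, hk, hs, hv⟩ := encodes_code.1 hx
  refine ⟨y, hy, hs, hv, hk, (Sizes.locate_spec hF s hl d.2 (P.name_lt d x.symbol) hy h0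
    hk).mono le_rfl le_rfl ?_⟩
  rintro s' ⟨hL, hm, hv, hr⟩
  have hmn : (P.sizes w q nb L).mn d (P.name d x.symbol) = P.Min d x.symbol := P.pad_name _ _ _
  refine ⟨hL, hL.w_eq, hL.mn_eq.trans hmn, ?_, hm, hv, hr⟩
  rw [hL.shift_eq, hmn]
  rfl

theorem Params.queriesSizes_code (hF : (P.sizes w q nb L).Fits W) :
    (P.code w q nb L).QueriesSizes W querySizes.len querySizes := by
  intro s d hl h0
  refine Sat.runsTo (post := fun s' => s'.mem = s.mem ∧ s'.vm = s.vm ∧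
    s'.reg 0 = (P.sizes w q nb L).mout d ∧ s'.reg 1 = (P.sizes w q nb L).kout d) ?_
    fun t t' h ⟨h₁, h₂, h₃, h₄⟩ => ⟨h.2.1.trans h₁, h.2.2.trans h₂,
      (h.1 0 (by norm_num)).trans h₃, (h.1 1 (by norm_num)).trans h₄⟩
  replace hl : (P.sizes w q nb L).Loads s.mem := hl
  have hd : (d : ℕ) < (P.sizes w q nb L).n := d.2
  generalize P.sizes w q nb L = D at *
  refine Sat.bind₀ (hl.header_spec hF s) ?_
  rintro s₁ ⟨hH, hm, hv, hr⟩
  rw [← hm] at hl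
  have h0' : s₁.reg 0 = d := by rw [hr _ (by norm_num), h0]
  have hW := hF.ne_zero
  have hB := hF.block_lt hd
  have hmm := hF.m_lt
  have hst := hF.stride_lt
  have hn := hF.n_lt
  have hg := hF.kout_lt d
  have hmo := hF.mout_lt d
  have e0 := hl.mout hd
  have e1 := hl.kout hd
  have hS : D.m + 5 + 3 * (D.q * D.m) = D.stride := rfl
  refine Sat.set (D.base + d * D.stride)
    (by simp [blockExpr, hH.base_eq, hH.stride_eq, h0'])
    (by simp [blockExpr, hH.base_eq, hH.stride_eq, h0']; omega) ?_
  refine Sat.set (D.mout d) (by simp [hH.m_eq, e0]) (by simp [hH.m_eq, e0]; omega) ?_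
  refine Sat.set (D.kout d) (by simp [hH.m_eq, e1]) (by simp [hH.m_eq, e1]; omega) ?_
  exact Sat.nil (by simp [hm, hv])

theorem Params.queriesSymbol_code (hF : (P.sizes w q nb L).Fits W) :
    (P.code w q nb L).QueriesSymbol W nb querySymbol.len querySymbol := by
  intro s d φ hl h0 h1
  refine Sat.runsTo (post := fun s' => s'.mem = s.mem ∧ s'.vm = s.vm ∧
    s'.reg 0 = P.Min d φ ∧ s'.reg 1 = P.Kin d φ ∧ s'.reg 2 = P.probCode nb d φ) ?_
    fun t t' h ⟨h₁, h₂, h₃, h₄, h₅⟩ => ⟨h.2.1.trans h₁, h.2.2.trans h₂,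
      (h.1 0 (by norm_num)).trans h₃, (h.1 1 (by norm_num)).trans h₄,
      (h.1 2 (by norm_num)).trans h₅⟩
  replace hl : (P.sizes w q nb L).Loads s.mem := hl
  have hd : (d : ℕ) < (P.sizes w q nb L).n := d.2
  have hi : (P.name d φ : ℕ) < (P.sizes w q nb L).m := P.name_lt d φ
  have hmn : (P.sizes w q nb L).mn d (P.name d φ) = P.Min d φ := P.pad_name _ _ _
  have hkn : (P.sizes w q nb L).kn d (P.name d φ) = P.Kin d φ := P.pad_name _ _ _
  have hpr : (P.sizes w q nb L).pr d (P.name d φ) = P.probCode nb d φ := P.pad_name _ _ _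
  rw [← hmn, ← hkn, ← hpr]
  generalize P.sizes w q nb L = D at *
  refine Sat.bind₀ (hl.header_spec hF s) ?_
  rintro s₁ ⟨hH, hm, hv, hr⟩
  rw [← hm] at hl
  have h0' : s₁.reg 0 = d := by rw [hr _ (by norm_num), h0]
  have h1' : s₁.reg 1 = P.name d φ := by rw [hr _ (by norm_num), h1]
  have hW := hF.ne_zero
  have hR := hF.record_lt hd hi
  have hmm := hF.m_lt
  have hg := hF.kn_lt d (P.name d φ)
  have hg' := hF.mn_lt d (P.name d φ)
  have hg'' := hF.pr_lt d (P.name d φ)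
  have e0 := hl.mn hd hi
  have e1 := hl.kn hd hi
  have e2 := hl.pr hd hi
  refine Sat.set (4 + D.n + 3 * (d * D.m + P.name d φ))
    (by simp [recordExpr, hH.n_eq, hH.m_eq, h0', h1'])
    (by simp [recordExpr, hH.n_eq, hH.m_eq, h0', h1']; omega) ?_
  refine Sat.set _ (by simp; exact e0) (by simp [e0]; omega) ?_
  refine Sat.set _ (by simp; exact e1) (by simp [e1]; omega) ?_
  refine Sat.set _ (by simp; exact e2) (by simp [e2]; omega) ?_
  exact Sat.nil (by simp [hm, hv])

theorem Params.readsSymbol_code (hF : (P.sizes w q nb L).Fits W) :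
    (P.code w q nb L).ReadsSymbol W readSymbol.len readSymbol := by
  intro s d x hl h0 hx
  refine Sat.runsTo (post := fun s' => s'.mem = s.mem ∧ s'.vm = s.vm ∧
    s'.reg 0 = P.name d x.symbol) ?_ fun t t' h ⟨h₁, h₂, h₃⟩ =>
      ⟨h.2.1.trans h₁, h.2.2.trans h₂, (h.1 0 (by norm_num)).trans h₃⟩
  obtain ⟨y, hy, hs, hw, -, hloc⟩ := locate_code hF hl h0 hx
  refine Sat.bind₀ hloc ?_
  rintro s₁ ⟨hL, h5, h13, h16, hm, hv, hr⟩
  have hi : (P.name d x.symbol : ℕ) < 2 ^ W := (P.name_lt d x.symbol).trans hF.m_lt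
  refine Sat.set (P.name d x.symbol) (by simp [hL.symbol_eq]) (by simp [hL.symbol_eq, hi]) ?_
  exact Sat.nil (by simp [hm, hv])

theorem Params.readsSpill_code (hF : (P.sizes w q nb L).Fits W) :
    (P.code w q nb L).ReadsSpill W readSpill.len readSpill := by
  intro s d x hl h0 hx
  refine Sat.runsTo (post := fun s' => s'.mem = s.mem ∧ s'.vm = s.vm ∧
    s'.reg 0 = x.spill) ?_ fun t t' h ⟨h₁, h₂, h₃⟩ =>
      ⟨h.2.1.trans h₁, h.2.2.trans h₂, (h.1 0 (by norm_num)).trans h₃⟩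
  obtain ⟨y, hy, hs, hw, -, hloc⟩ := locate_code hF hl h0 hx
  refine Sat.bind₀ hloc ?_
  rintro s₁ ⟨hL, h5, h13, h16, hm, hv, hr⟩
  have hy' := hy.trans (hF.size_lt d (P.name_lt d x.symbol))
  have h16' : s₁.reg 16 < 2 ^ W := by
    rw [hL.shift_eq]
    exact (Nat.mul_le_mul_left _ (Nat.sub_le _ _)).trans_lt (hF.mul_mn_lt d _)
  refine Sat.set x.spill (by simp [hL.rest_eq, h16, hs]) (by simp [hL.rest_eq, h16', hy']) ?_
  exact Sat.nil (by simp [hm, hv])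

theorem Params.writesSpill_code (hF : (P.sizes w q nb L).Fits W) :
    (P.code w q nb L).WritesSpill W writeSpill.len writeSpill := by
  intro s d x k hl h0 hx h2
  refine Sat.runsTo (post := fun s' => s'.mem = s.mem ∧ s'.vm = s.vm ∧
    (P.code w q nb L).Encodes d s'.vm (s'.reg 0) { x with spill := k }) ?_
    fun t t' h ⟨h₁, h₂, h₃⟩ => ⟨h.2.1.trans h₁, h.2.2.trans h₂, by
      rw [h.2.2, h.1 0 (by norm_num)]; exact h₃⟩
  obtain ⟨y, hy, hs, hw, -, hloc⟩ := locate_code hF hl h0 hx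
  refine Sat.bind₀ hloc ?_
  rintro s₁ ⟨hL, h5, h13, h16, hm, hv, hr⟩
  have h2' : s₁.reg 2 = k := by rw [hr _ (by norm_num), h2]
  have hW := hF.ne_zero
  have hi : (P.name d x.symbol : ℕ) < (P.sizes w q nb L).m := P.name_lt d x.symbol
  have hy' := hF.size_lt d hi
  have hko := hF.kout_lt d
  have h16' : s₁.reg 16 < 2 ^ W := by
    rw [hL.shift_eq]
    exact (Nat.mul_le_mul_left _ (Nat.sub_le _ _)).trans_lt (hF.mul_mn_lt d _)
  have hsz := P.size_name (w := w) (q := q) (nb := nb) (L := L) d x.symbol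
  rw [h16] at h16'
  set D := P.sizes w q nb L
  set B := w * (P.Min d x.symbol - D.mout d)
  have hmod := Nat.mod_lt y (Nat.two_pow_pos B)
  have hky : k * 2 ^ B + y % 2 ^ B < D.size d (P.name d x.symbol) := by
    have := Nat.mul_le_mul_right (2 ^ B) (Nat.succ_le_of_lt k.2)
    rw [Nat.succ_mul] at this
    rw [hsz]
    omega
  have hout := D.start_mul_add_lt hi hky
  -- Bounds the mask `1 <<< reg 16`; it uses that spill universes are nonempty.
  have hkin : 2 ^ B ≤ D.size d (P.name d x.symbol) := by
    rw [hsz]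
    exact Nat.le_mul_of_pos_left _ (P.Kin_pos _ _)
  have hk : (k : ℕ) ≤ k * 2 ^ B := Nat.le_mul_of_pos_right _ (by positivity)
  refine Sat.set (D.start d (P.name d x.symbol) * D.grain d + (k * 2 ^ B + y % 2 ^ B))
    (by simp [hL.rest_eq, h16, h2', hL.offset_eq])
    (by simp [hL.rest_eq, h16, h2', hL.offset_eq]; omega) ?_
  refine Sat.nil ⟨by simp [hm], by simp [hv], encodes_code.2 ⟨_, hky, by simp [D], ?_, ?_⟩⟩
  · rw [mul_comm, Nat.mul_add_div (by positivity), Nat.div_eq_of_lt hmod, add_zero]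
  · intro j
    refine (hw j).trans ?_
    split_ifs with hj
    · simp [hv]
    · refine ofNat_eq_ofNat ?_
      -- The words kept in the spill occupy the lowest `B` bits, which the new offset shares with
      -- `y`.
      have hdvd : 2 ^ (w * (j - D.mout d)) * 2 ^ w ∣ 2 ^ B := by
        rw [← pow_add, ← Nat.mul_succ]
        exact pow_dvd_pow _ (Nat.mul_le_mul_left _ (by have := j.2; simp only at this hj; omega))
      rw [← Nat.mod_mul_right_div_self, ← Nat.mod_mul_right_div_self, ← Nat.mod_mod_of_dvd _ hdvd,
        ← Nat.mod_mod_of_dvd (_ + _) hdvd, Nat.mul_add_mod', Nat.mod_mod]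

theorem Params.readsWord_code (hF : (P.sizes w q nb L).Fits W) :
    (P.code w q nb L).ReadsWord W readWord.len readWord := by
  intro s d x j hl h0 hx h2
  refine Sat.runsTo (post := fun s' => s'.mem = s.mem ∧ s'.vm = s.vm ∧
    s'.reg 0 = (x.vm j).toNat) ?_ fun t t' h ⟨h₁, h₂, h₃⟩ =>
      ⟨h.2.1.trans h₁, h.2.2.trans h₂, (h.1 0 (by norm_num)).trans h₃⟩
  obtain ⟨y, hy, hs, hw, -, hloc⟩ := locate_code hF hl h0 hx
  refine Sat.bind₀ hloc ?_
  rintro s₁ ⟨hL, h5, h13, h16, hm, hv, hr⟩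
  have h2' : s₁.reg 2 = j := by rw [hr _ (by norm_num), h2]
  have hi : (P.name d x.symbol : ℕ) < (P.sizes w q nb L).m := P.name_lt d x.symbol
  have hW := hF.ne_zero
  have hy' := hy.trans (hF.size_lt d hi)
  have hw_lt : w < 2 ^ W := hF.w_lt_pow
  have hpow : 2 ^ w < 2 ^ W := hF.pow_lt
  have hmo := hF.mout_lt d
  have hmn : (P.sizes w q nb L).mn d (P.name d x.symbol) = P.Min d x.symbol := P.pad_name _ _ _
  have hmul : w * P.Min d x.symbol < 2 ^ W := hmn ▸ hF.mul_mn_lt d (P.name d x.symbol)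
  have hj' : w * (j - (P.sizes w q nb L).mout d) ≤ w * P.Min d x.symbol :=
    Nat.mul_le_mul_left _ ((Nat.sub_le _ _).trans j.2.le)
  have hmin : P.Min d x.symbol < 2 ^ W := hmn ▸ hF.mn_lt d (P.name d x.symbol)
  have hjl := j.2
  refine (Sat.bind (A₁ := 1) (A₂ := 0) (T₂ := (Prog.block []).len) (Q := fun s' =>
    s'.mem = s.mem ∧ s'.vm = s.vm ∧ s'.reg 0 = (x.vm j).toNat)
    (Sat.ite (T₁ := 1) (T₂ := (Prog.assign 0
      ((reg 15 >>> (reg 5 * (reg 2 - reg 10))) % (lit 1 <<< reg 5))).len)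
      (by norm_num) (by norm_num) (fun hlt => ?_) fun hle => ?_)
    fun s' h => Sat.nil h).mono le_rfl (by norm_num) fun _ h => h
  · rw [h2', hL.mout_eq] at hlt
    refine Sat.vmRead (by have := hF.w_lt; exact this.le) (by norm_num) ⟨by simp [hm], by simp [hv], ?_⟩
    simp [h2', hv, hw j, hlt]
  · rw [h2', hL.mout_eq] at hle
    refine (Sat.assign (x.vm j).toNat ?_ ?_ ⟨by simp [hm], by simp [hv], by simp⟩).mono
      le_rfl (by norm_num) fun _ h => h
    · simp [h2', hL.mout_eq, hL.rest_eq, h5, hw j, not_lt.2 hle]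
    · simp [h2', hL.mout_eq, hL.rest_eq, h5]
      omega

theorem Params.writesWord_code (hF : (P.sizes w q nb L).Fits W) :
    (P.code w q nb L).WritesWord W writeWord.len writeWord := by
  intro s d x j v hl h0 hx h2 h3
  refine Sat.runsTo (post := fun s' => s'.mem = s.mem ∧
    (∀ i, (P.sizes w q nb L).mout d ≤ i → s'.vm i = s.vm i) ∧
    (P.code w q nb L).Encodes d s'.vm (s'.reg 0) { x with vm := Function.update x.vm j v }) ?_
    fun t t' h ⟨h₁, h₂, h₃⟩ => ⟨h.2.1.trans h₁, by rw [h.2.2]; exact h₂, by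
      rw [h.2.2, h.1 0 (by norm_num)]; exact h₃⟩
  obtain ⟨y, hy, hs, hw, hk, hloc⟩ := locate_code hF hl h0 hx
  refine Sat.bind₀ hloc ?_
  rintro s₁ ⟨hL, h5, h13, h16, hm, hv, hr⟩
  have h1' := (hr 1 (by norm_num)).trans hk
  have h2' : s₁.reg 2 = j := by rw [hr _ (by norm_num), h2]
  have h3' : s₁.reg 3 = v.toNat := by rw [hr _ (by norm_num), h3]
  have hi : (P.name d x.symbol : ℕ) < (P.sizes w q nb L).m := P.name_lt d x.symbol
  have hW := hF.ne_zero
  have hsize := hF.size_lt d hi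
  have hw_lt : w < 2 ^ W := hF.w_lt_pow
  have hpow : 2 ^ w < 2 ^ W := hF.pow_lt
  have hmo := hF.mout_lt d
  have hko := hF.kout_lt d
  have hkl := (P.sizes w q nb L).start_mul_add_lt hi hy
  have hmn : (P.sizes w q nb L).mn d (P.name d x.symbol) = P.Min d x.symbol := P.pad_name _ _ _
  have hmul : w * P.Min d x.symbol < 2 ^ W := hmn ▸ hF.mul_mn_lt d (P.name d x.symbol)
  have hj' : w * (j - (P.sizes w q nb L).mout d) ≤ w * P.Min d x.symbol :=
    Nat.mul_le_mul_left _ ((Nat.sub_le _ _).trans j.2.le)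
  have hmin : P.Min d x.symbol < 2 ^ W := hmn ▸ hF.mn_lt d (P.name d x.symbol)
  have hjl := j.2
  have hsz := P.size_name (w := w) (q := q) (nb := nb) (L := L) d x.symbol
  set D := P.sizes w q nb L with hD
  refine (Sat.bind (A₁ := 1) (A₂ := 0) (T₂ := (Prog.block []).len) (Q := fun s' =>
    s'.mem = s.mem ∧ (∀ i, D.mout d ≤ i → s'.vm i = s.vm i) ∧
    (P.code w q nb L).Encodes d s'.vm (s'.reg 0) { x with vm := Function.update x.vm j v })
    (Sat.ite (T₁ := (Prog.block [.instr (.vmWrite 2 3), .assign 0 (reg 1)]).len)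
      (T₂ := (Prog.block [
      .assign 17 (reg 5 * (reg 2 - reg 10)),
      .assign 18 (reg 15 >>> reg 17 >>> reg 5 <<< reg 5 + reg 3),
      .assign 0 (reg 14 + (reg 18 <<< reg 17 + reg 15 % (lit 1 <<< reg 17)))]).len)
      (by norm_num) (by norm_num) (fun hlt => ?_) fun hle => ?_)
    fun s' h => Sat.nil h).mono le_rfl (by norm_num) fun _ h => h
  · rw [h2', hL.mout_eq] at hlt
    refine Sat.bind (A₁ := 1) (A₂ := 0) (Sat.vmWrite (by norm_num) (by norm_num) rfl) ?_
    rintro s₂ rfl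
    refine Sat.set _ (by simp; exact h1') (by simp [h1']; omega) (Sat.nil ⟨by simp [hm], ?_, ?_⟩)
    · intro i hi
      rw [h2']
      simp only [State.set_vm, State.write_vm]
      rw [if_neg (by omega), hv]
    · refine encodes_code.2 ⟨y, hy, by simp [D], hs, fun i => ?_⟩
      simp only [Function.update_apply, State.set_vm, State.write_vm, h2', h3']
      by_cases hij : i = j
      · have hij' : (i : ℕ) = j := by rw [hij]
        rw [if_pos hij, if_pos (hij' ▸ hlt), if_pos hij']
        simp
      · have : (i : ℕ) ≠ j := fun h => hij (Fin.ext h)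
        rw [if_neg hij, hw i, if_neg this, hv]
  · rw [h2', hL.mout_eq] at hle
    set p := (j : ℕ) - D.mout d with hp
    have hpr : p < P.Min d x.symbol - D.mout d := by omega
    have hvlt := v.isLt
    have hset : setDigit w p y v.toNat / 2 ^ (w * (P.Min d x.symbol - D.mout d)) = x.spill := by
      rw [setDigit_div_of_lt hvlt hpr, hs]
    have hlt : setDigit w p y v.toNat < D.size d (P.name d x.symbol) := by
      rw [hsz, ← Nat.div_lt_iff_lt_mul (by positivity), hset]
      exact x.spill.2
    have hout := D.start_mul_add_lt hi hlt
    -- This and the next bound keep the intermediate values of `setDigit`, the mask and the upper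
    -- part, below quantities known to fit.
    have hpp : 2 ^ (w * p) ≤ D.size d (P.name d x.symbol) := by
      rw [hsz]
      exact (Nat.pow_le_pow_right (by norm_num) (Nat.mul_le_mul_left _ hpr.le)).trans
        (Nat.le_mul_of_pos_left _ (P.Kin_pos _ _))
    have h18 : y / 2 ^ (w * p) / 2 ^ w * 2 ^ w + v.toNat ≤ setDigit w p y v.toNat :=
      (Nat.le_mul_of_pos_right _ (by positivity)).trans (Nat.le_add_right _ _)
    have hdef : setDigit w p y v.toNat = (y / 2 ^ (w * p) / 2 ^ w * 2 ^ w + v.toNat) * 2 ^ (w * p) +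
      y % 2 ^ (w * p) := rfl
    refine Sat.mono (A := 0) (Sat.set (w * p) ?_ ?_ (Sat.set
      (y / 2 ^ (w * p) / 2 ^ w * 2 ^ w + v.toNat) ?_ ?_ (Sat.set
      (D.start d (P.name d x.symbol) * D.grain d + setDigit w p y v.toNat) ?_ ?_ (Sat.nil
      ⟨by simp [hm], by simp [hv], ?_⟩)))) le_rfl (by norm_num) fun _ h => h
    · simp [h5, h2', hL.mout_eq, hp]
    · simp [h5, h2', hL.mout_eq, ← hp]
      omega
    · simp [hL.rest_eq, h5, h3']
    · simp [hL.rest_eq, h5, h3']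
      omega
    · simp [hL.rest_eq, hL.offset_eq, setDigit]
    · simp [hL.rest_eq, hL.offset_eq]
      omega
    · refine encodes_code.2 ⟨_, hlt, by simp [D], hset, fun i => ?_⟩
      simp only [Function.update_apply, State.set_vm, hv]
      by_cases hij : i = j
      · have hij' : (i : ℕ) = j := by rw [hij]
        rw [if_pos hij, ← hD, hij', if_neg (by omega)]
        refine BitVec.eq_of_toNat_eq ?_
        rw [BitVec.toNat_ofNat, ← hp, setDigit_div_mod hvlt]
      · have hne : (i : ℕ) ≠ j := fun h => hij (Fin.ext h)
        rw [if_neg hij, hw i, ← hD]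
        split_ifs with him
        · rfl
        · refine ofNat_eq_ofNat ?_
          rcases lt_or_gt_of_ne hne with h | h
          · rw [setDigit_div_mod_of_gt (by omega)]
          · rw [setDigit_div_of_lt hvlt (by omega)]

end EntropyEncoder

/-! ## Changing the distribution and the symbol -/

namespace WordRAM

variable {w W : ℕ}

/-- `s` is `s₀` with other values in the registers `R`, up to the virtual memory. -/
def State.SameExcept (R : List ℕ) (s₀ s : State w) : Prop :=
  s.mem = s₀.mem ∧ ∀ r, r ∉ R → s.reg r = s₀.reg r

theorem State.SameExcept.refl (R : List ℕ) (s : State w) : s.SameExcept R s :=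
  ⟨rfl, fun _ _ => rfl⟩

theorem State.SameExcept.trans {R : List ℕ} {s₀ s₁ s₂ : State w} (h : s₀.SameExcept R s₁)
    (h' : s₁.SameExcept R s₂) : s₀.SameExcept R s₂ :=
  ⟨h'.1.trans h.1, fun r hr => (h'.2 r hr).trans (h.2 r hr)⟩

theorem State.SameExcept.set {R : List ℕ} {s₀ s : State w} (h : s₀.SameExcept R s) {r : ℕ}
    (hr : r ∈ R) (v : ℕ) : s₀.SameExcept R (s.set r v) :=
  ⟨h.1, fun k hk => by rw [State.set_reg, if_neg (by rintro rfl; exact hk hr), h.2 k hk]⟩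

theorem State.SameExcept.write {R : List ℕ} {s₀ s : State w} (h : s₀.SameExcept R s) (a : ℕ)
    (v : BitVec w) : s₀.SameExcept R (s.write a v) := h

theorem State.SameExcept.mono {R R' : List ℕ} {s₀ s : State w} (h : s₀.SameExcept R s)
    (hR : R ⊆ R') : s₀.SameExcept R' s :=
  ⟨h.1, fun r hr => h.2 r fun hr' => hr (hR hr')⟩

end WordRAM

namespace EntropyEncoder

open WordRAM Expr

/-- Move word number `reg 21` from the spill `reg 15` to the virtual memory. -/
def spillToVm : Prog := .block [
  .assign 23 (reg 15 >>> (reg 5 * (reg 21 - reg 10))),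
  .instr (.vmWrite 21 23),
  .assign 21 (reg 21 + lit 1)]

/-- Append word number `reg 21 - 1` of the spill `reg 15` to the new spill `reg 0`. -/
def spillToSpill : Prog := .block [
  .assign 21 (reg 21 - lit 1),
  .assign 0 (reg 0 <<< reg 5 + (reg 15 >>> (reg 5 * (reg 21 - reg 10))) % (lit 1 <<< reg 5))]

/-- Append word number `reg 21 - 1` of the virtual memory to the new spill `reg 0`. -/
def vmToSpill : Prog := .block [
  .assign 21 (reg 21 - lit 1),
  .instr (.vmRead 23 21),
  .assign 0 (reg 0 <<< reg 5 + reg 23)]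

def change : Prog := .block [
  locate,
  .assign 17 (blockExpr (reg 2)),
  .assign 18 (load (reg 17 + reg 8 + lit 2)),
  .assign 19 (load (reg 17 + reg 8 + lit 4)),
  .assign 20 (load (recordExpr (reg 2) (reg 3))),
  .assign 21 (reg 10),
  .ite (.lt 18 13) (.assign 22 (reg 18)) (.assign 22 (reg 13)),
  .while (.lt 21 22) spillToVm,
  .ite (.lt 10 18) (.assign 22 (reg 18)) (.assign 22 (reg 10)),
  .assign 21 (reg 20),
  .assign 0 (reg 4),
  .while (.lt 22 21) spillToSpill,
  .while (.lt 18 21) vmToSpill,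
  .assign 0 (load (reg 17 + reg 3) * reg 19 + reg 0)]

variable {w W : ℕ}

/-- The quotient need not be reduced modulo `2 ^ w`, since writing to the memory truncates. The
target `max M l` in the invariant covers `l < M`, where the body never runs. -/
theorem spillToVm_spec {M l y : ℕ} (s₀ : State w) (h5 : s₀.reg 5 = w) (h10 : s₀.reg 10 = M)
    (h15 : s₀.reg 15 = y) (h21 : s₀.reg 21 = M) (h22 : s₀.reg 22 = l) (hW : W ≠ 0)
    (hw : w < 2 ^ W) (hM : M < 2 ^ W) (hl : l < 2 ^ W) (hwl : w * l < 2 ^ W) (hy : y < 2 ^ W) :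
    Sat W (.while (.lt 21 22) spillToVm) ((l - M) * (spillToVm.len + 1) + 1) ((l - M) * 1) s₀
      fun s => s₀.SameExcept [21, 23] s ∧ ∀ j, s.vm j =
        if M ≤ j ∧ j < l then BitVec.ofNat w (y / 2 ^ (w * (j - M))) else s₀.vm j := by
  refine (Sat.while (fun k s => s₀.SameExcept [21, 23] s ∧ s.reg 21 + k = max M l ∧
    M ≤ s.reg 21 ∧ ∀ j, s.vm j = if M ≤ j ∧ j < s.reg 21 then
      BitVec.ofNat w (y / 2 ^ (w * (j - M))) else s₀.vm j)
    (by norm_num) (by norm_num) ?_ ?_ (l - M) s₀ ?_).mono le_rfl le_rfl ?_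
  · rintro k s ⟨hS, hk, hM', hv⟩
    have h5' : s.reg 5 = w := by rw [hS.2 5 (by decide), h5]
    have h10' : s.reg 10 = M := by rw [hS.2 10 (by decide), h10]
    have h15' : s.reg 15 = y := by rw [hS.2 15 (by decide), h15]
    have h22' : s.reg 22 = l := by rw [hS.2 22 (by decide), h22]
    have hlt : s.reg 21 < l := by omega
    have hmul : w * (s.reg 21 - M) ≤ w * l := Nat.mul_le_mul_left _ (by omega)
    refine ⟨by omega, Sat.set (A := 1) _ rfl ?_ (Sat.bind (A₁ := 1) (A₂ := 0)
      (Sat.vmWrite (by norm_num) (by norm_num) rfl) ?_)⟩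
    · simp [h5', h10', h15', hy, hw]
      omega
    · rintro s' rfl
      refine Sat.set (s.reg 21 + 1) (by simp) (by simp; omega)
        (Sat.nil ⟨((hS.set (by decide) _).write _ _).set (by decide) _, by simp; omega,
          by simp; omega, fun j => ?_⟩)
      simp only [State.set_vm, State.write_vm, State.set_reg, State.write_reg, hv, eval_shr,
        eval_mul, eval_sub, eval_reg, h5', h10', h15']
      norm_num
      by_cases hj : j = s.reg 21
      · subst hj
        simp [hM']
      · rw [if_neg hj]
        have : (M ≤ j ∧ j < s.reg 21) ↔ (M ≤ j ∧ j ≤ s.reg 21) := by omega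
        simp only [this]
  · rintro s ⟨hS, hk, -, -⟩
    rw [hS.2 22 (by decide), h22]
    omega
  · exact ⟨.refl _ _, by omega, h21.ge, fun j => by rw [if_neg (by omega)]⟩
  · rintro s ⟨hS, hk, -, hv⟩
    refine ⟨hS, fun j => ?_⟩
    rw [hv]
    have : (M ≤ j ∧ j < s.reg 21) ↔ (M ≤ j ∧ j < l) := by omega
    simp only [this]

/-- The last `N - t` of `N` words and a spill `k` are the digits of `y`. -/
def Digits (w N k : ℕ) (f : ℕ → ℕ) (t y : ℕ) : Prop :=
  y / 2 ^ (w * (N - t)) = k ∧ ∀ i, t ≤ i → i < N → y / 2 ^ (w * (i - t)) % 2 ^ w = f i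

theorem Digits.init (w N k : ℕ) (f : ℕ → ℕ) : Digits w N k f N k :=
  ⟨by simp, fun i h h' => absurd h (not_le.2 h')⟩

/-- A step of Horner's scheme: words are appended from the last to the first, so the words already
present move up by one position. -/
theorem Digits.step {N k : ℕ} {f : ℕ → ℕ} {t y v : ℕ} (h : Digits w N k f (t + 1) y)
    (ht : t < N) (hv : f t = v) (hvw : v < 2 ^ w) : Digits w N k f t (y * 2 ^ w + v) := by
  have hstep : ∀ i, (y * 2 ^ w + v) / 2 ^ (w * (i + 1)) = y / 2 ^ (w * i) := by
    intro i
    rw [mul_add, mul_one, add_comm (w * i), pow_add, ← Nat.div_div_eq_div_mul, mul_comm y,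
      Nat.mul_add_div (by positivity), Nat.div_eq_of_lt hvw, add_zero]
  refine ⟨?_, fun i hi hi' => ?_⟩
  · rw [← h.1, ← hstep]
    congr 3
    omega
  · rcases hi.eq_or_lt with rfl | hlt
    · simp [Nat.mod_eq_of_lt hvw, Nat.add_mod, hv]
    · rw [← h.2 i hlt hi', ← hstep]
      congr 4
      omega

/-- Excludes overflow inside the loops: as long as `M ≤ t`, the partial spill stays below the bound
for the finished one. -/
theorem Digits.lt {N k K : ℕ} {f : ℕ → ℕ} {t y M : ℕ} (h : Digits w N k f t y) (hk : k < K)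
    (hM : M ≤ t) : y < K * 2 ^ (w * (N - M)) := by
  have : y < K * 2 ^ (w * (N - t)) := by
    rw [← Nat.div_lt_iff_lt_mul (by positivity), h.1]
    exact hk
  refine this.trans_le (Nat.mul_le_mul_left _ (Nat.pow_le_pow_right (by norm_num)
    (Nat.mul_le_mul_left _ (by omega))))

/-- In its use `U = max M M'`: the words from there on lie outside both the old and the new memory,
so they pass from spill to spill without any memory access. -/
theorem spillToSpill_spec {M U M' N k K y : ℕ} {f : ℕ → ℕ} (s₀ : State w) (h0 : s₀.reg 0 = k)
    (h5 : s₀.reg 5 = w) (h10 : s₀.reg 10 = M) (h15 : s₀.reg 15 = y) (h21 : s₀.reg 21 = N)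
    (h22 : s₀.reg 22 = U) (hMU : M ≤ U) (hMU' : M' ≤ U) (hW : W ≠ 0) (hw : w < 2 ^ W)
    (hpow : 2 ^ w < 2 ^ W) (hM : M < 2 ^ W) (hN : N < 2 ^ W) (hwN : w * N < 2 ^ W)
    (hy : y < 2 ^ W) (hk : k < K) (hK : K * 2 ^ (w * (N - M')) < 2 ^ W)
    (hf : ∀ i, M ≤ i → f i = y / 2 ^ (w * (i - M)) % 2 ^ w) :
    Sat W (.while (.lt 22 21) spillToSpill) ((N - U) * (spillToSpill.len + 1) + 1) 0 s₀
      fun s => s₀.SameExcept [0, 21] s ∧ s.vm = s₀.vm ∧ s.reg 21 = min N U ∧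
        Digits w N k f (s.reg 21) (s.reg 0) := by
  refine (Sat.while (A := 0) (fun j s => s₀.SameExcept [0, 21] s ∧ s.vm = s₀.vm ∧
    s.reg 21 = min N U + j ∧ s.reg 21 ≤ N ∧ Digits w N k f (s.reg 21) (s.reg 0))
    (by norm_num) (by norm_num) ?_ ?_ (N - U) s₀ ?_).mono le_rfl (by simp) ?_
  · rintro j s ⟨hS, hv, hj, hle, hD⟩
    have h5' : s.reg 5 = w := by rw [hS.2 5 (by decide), h5]
    have h10' : s.reg 10 = M := by rw [hS.2 10 (by decide), h10]
    have h15' : s.reg 15 = y := by rw [hS.2 15 (by decide), h15]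
    have h22' : s.reg 22 = U := by rw [hS.2 22 (by decide), h22]
    have hUN : U < s.reg 21 := by omega
    refine ⟨by omega, ?_⟩
    generalize ht : s.reg 21 = t at *
    obtain ⟨t, rfl⟩ : ∃ t', t = t' + 1 := ⟨t - 1, by omega⟩
    have hD' := hD.step (v := y / 2 ^ (w * (t - M)) % 2 ^ w) (by omega) (hf t (by omega))
      (Nat.mod_lt _ (by positivity))
    have hlt := (hD'.lt hk (show M' ≤ t by omega)).trans hK
    have hmul : w * (t - M) ≤ w * N := Nat.mul_le_mul_left _ (by omega)
    have h0' : s.reg 0 ≤ s.reg 0 * 2 ^ w := Nat.le_mul_of_pos_right _ (by positivity)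
    refine Sat.set t (by simp [ht]) (by simp [ht]; omega) (Sat.set
      (s.reg 0 * 2 ^ w + y / 2 ^ (w * (t - M)) % 2 ^ w) (by simp [h5', h10', h15'])
      (by simp [h5', h10', h15']; omega) (Sat.nil
      ⟨(hS.set (by decide) _).set (by decide) _, by simp [hv], by simp; omega, by simp; omega,
        by simpa using hD'⟩))
  · rintro s ⟨hS, -, hj, hle, -⟩
    rw [hS.2 22 (by decide), h22]
    omega
  · exact ⟨.refl _ _, rfl, by omega, by omega, by rw [h0, h21]; exact .init _ _ _ _⟩
  · rintro s ⟨hS, hv, hj, hle, hD⟩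
    exact ⟨hS, hv, hj, hD⟩

/-- Handles the words that were in memory and lie behind the new memory size `M'`. If `t₀ ≤ M'` the
loop is empty, hence the minimum in the conclusion. -/
theorem vmToSpill_spec {M' N k K t₀ : ℕ} {f : ℕ → ℕ} (s₀ : State w)
    (h5 : s₀.reg 5 = w) (h18 : s₀.reg 18 = M') (h21 : s₀.reg 21 = t₀) (htN : t₀ ≤ N)
    (hD : Digits w N k f t₀ (s₀.reg 0)) (hW : W ≠ 0) (hw : w < 2 ^ W) (hwW : w ≤ W)
    (hN : N < 2 ^ W) (hk : k < K) (hK : K * 2 ^ (w * (N - M')) < 2 ^ W)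
    (hf : ∀ i, M' ≤ i → i < t₀ → f i = (s₀.vm i).toNat) :
    Sat W (.while (.lt 18 21) vmToSpill) ((t₀ - M') * (vmToSpill.len + 1) + 1) ((t₀ - M') * 1) s₀
      fun s => s₀.SameExcept [0, 21, 23] s ∧ s.vm = s₀.vm ∧
        Digits w N k f (min t₀ M') (s.reg 0) := by
  refine (Sat.while (fun j s => s₀.SameExcept [0, 21, 23] s ∧ s.vm = s₀.vm ∧
    s.reg 21 = min t₀ M' + j ∧ s.reg 21 ≤ t₀ ∧ Digits w N k f (s.reg 21) (s.reg 0))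
    (by norm_num) (by norm_num) ?_ ?_ (t₀ - M') s₀ ?_).mono le_rfl le_rfl ?_
  · rintro j s ⟨hS, hv, hj, hle, hD⟩
    have h5' : s.reg 5 = w := by rw [hS.2 5 (by decide), h5]
    have h18' : s.reg 18 = M' := by rw [hS.2 18 (by decide), h18]
    have hUN : M' < s.reg 21 := by omega
    refine ⟨by omega, ?_⟩
    generalize ht : s.reg 21 = t at *
    obtain ⟨t, rfl⟩ : ∃ t', t = t' + 1 := ⟨t - 1, by omega⟩
    have hD' := hD.step (v := (s₀.vm t).toNat) (by omega) (hf t (by omega) (by omega))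
      (BitVec.isLt _)
    have hlt := (hD'.lt hk (show M' ≤ t by omega)).trans hK
    have h0' : s.reg 0 ≤ s.reg 0 * 2 ^ w := Nat.le_mul_of_pos_right _ (by positivity)
    refine Sat.set (A := 1) t (by simp [ht]) (by simp [ht]; omega) (Sat.bind (A₁ := 1) (A₂ := 0)
      (Sat.vmRead hwW (by norm_num) rfl) ?_)
    rintro s' rfl
    refine Sat.set (s.reg 0 * 2 ^ w + (s₀.vm t).toNat) (by simp [h5', hv])
      (by simp [h5', hv]; omega) (Sat.nil
      ⟨((hS.set (by decide) _).set (by decide) _).set (by decide) _, by simp [hv],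
        by simp; omega, by simp; omega, by simpa using hD'⟩)
  · rintro s ⟨hS, -, hj, hle, -⟩
    rw [hS.2 18 (by decide), h18]
    omega
  · exact ⟨.refl _ _, rfl, by omega, by omega, by rw [h21]; exact hD⟩
  · rintro s ⟨hS, hv, hj, hle, hD⟩
    refine ⟨hS, hv, ?_⟩
    rw [hj] at hD
    exact hD

/-- A bound for the running time of `change`. -/
def changeTime (L : ℕ) : ℕ :=
  change.len + L * (spillToVm.len + 1) + L * (spillToSpill.len + 1) + L * (vmToSpill.len + 1)

variable {Φ : Type*} {P : Params Φ} {q nb L : ℕ}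

theorem Params.changes_code (hF : (P.sizes w q nb L).Fits W) :
    (P.code w q nb L).Changes W (changeTime L) change := by
  intro s d d' x φ' k' hl h0 hx h2 h3 h4
  refine Sat.runsTo (post := fun s' => s'.mem = s.mem ∧
    (∀ i, max ((P.sizes w q nb L).mout d) ((P.sizes w q nb L).mout d') ≤ i → s'.vm i = s.vm i) ∧
    ∃ m' : Fin (P.Min d' φ') → BitVec w,
      (∀ (i : ℕ) (h : i < P.Min d x.symbol) (h' : i < P.Min d' φ'), m' ⟨i, h'⟩ = x.vm ⟨i, h⟩) ∧
      (P.code w q nb L).Encodes d' s'.vm (s'.reg 0) ⟨φ', m', k'⟩) ?_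
    fun t t' h ⟨h₁, h₂, h₃⟩ => ⟨h.2.1.trans h₁, by rw [h.2.2]; exact h₂, by
      rw [h.2.2, h.1 0 (by norm_num)]; exact h₃⟩
  obtain ⟨y, hy, hs, hw, -, hloc⟩ := locate_code hF hl h0 hx
  replace hl : (P.sizes w q nb L).Loads s.mem := hl
  have hi : (P.name d x.symbol : ℕ) < (P.sizes w q nb L).m := P.name_lt d x.symbol
  have hi' : (P.name d' φ' : ℕ) < (P.sizes w q nb L).m := P.name_lt d' φ'
  have hd' : (d' : ℕ) < (P.sizes w q nb L).n := d'.2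
  have hW := hF.ne_zero
  have hyW := hy.trans (hF.size_lt d hi)
  have hwlt : w < 2 ^ W := hF.w_lt_pow
  have hwW : w ≤ W := (show w < W from hF.w_lt).le
  have hpow : 2 ^ w < 2 ^ W := hF.pow_lt
  have hmn : (P.sizes w q nb L).mn d (P.name d x.symbol) = P.Min d x.symbol := P.pad_name _ _ _
  have hmn' : (P.sizes w q nb L).mn d' (P.name d' φ') = P.Min d' φ' := P.pad_name _ _ _
  have hN : P.Min d x.symbol < 2 ^ W := hmn ▸ hF.mn_lt d (P.name d x.symbol)
  have hN' : P.Min d' φ' < 2 ^ W := hmn' ▸ hF.mn_lt d' (P.name d' φ')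
  have hwN : w * P.Min d x.symbol < 2 ^ W := hmn ▸ hF.mul_mn_lt d (P.name d x.symbol)
  have hwN' : w * P.Min d' φ' < 2 ^ W := hmn' ▸ hF.mul_mn_lt d' (P.name d' φ')
  have hL := (P.sizes w q nb L).mn_sub_le (d := d) hi
  have hL' := (P.sizes w q nb L).mn_sub_le (d := d') hi'
  have hLL : (P.sizes w q nb L).L = L := rfl
  rw [hmn] at hL
  rw [hmn'] at hL'
  have hsz' := P.size_name (w := w) (q := q) (nb := nb) (L := L) d' φ'
  have hszW := hF.size_lt d' hi'
  rw [hsz'] at hszW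
  set D := P.sizes w q nb L with hD
  generalize hM : D.mout d = M at *
  generalize hM' : D.mout d' = M' at *
  have hMW : M < 2 ^ W := hM ▸ hF.mout_lt d
  have hMW' : M' < 2 ^ W := hM' ▸ hF.mout_lt d'
  have hB := hF.block_lt hd'
  have hR := hF.record_lt hd' hi'
  have hmm := hF.m_lt
  have hst := hF.stride_lt
  have hnn := hF.n_lt
  have hg := hF.grain_lt d'
  have hsi := hF.start_lt d' hi'.le
  have hko := hF.kout_lt d'
  have hS : D.m + 5 + 3 * (D.q * D.m) = D.stride := rfl
  have e18 := hl.mout hd'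
  have e19 := hl.grain hd'
  have e20 := hl.mn hd' hi'
  have e0 := hl.start hd' hi'.le
  rw [hM'] at e18
  rw [hmn'] at e20
  set N := P.Min d x.symbol with hNdef
  set N' := P.Min d' φ' with hN'def
  -- The old words by index. From `N` on the values have no meaning, but they are what the loops
  -- copy, and new input words may be arbitrary.
  set f : ℕ → ℕ := fun i => if i < M then (s.vm i).toNat else y / 2 ^ (w * (i - M)) % 2 ^ w with hf
  -- Only two loops access the memory. The first is empty unless `M < M'`, the second unless `M' <
  -- M`, so together they make at most `|M' - M|` accesses.
  refine Sat.mono (A := (min M' N - M) * 1 + (min N' (max M M') - M') * 1) (T := locate.len + (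
      (Prog.assign 17 (blockExpr (reg 2))).len + (
      (Prog.assign 18 (load (reg 17 + reg 8 + lit 2))).len + (
      (Prog.assign 19 (load (reg 17 + reg 8 + lit 4))).len + (
      (Prog.assign 20 (load (recordExpr (reg 2) (reg 3)))).len + (
      (Prog.assign 21 (reg 10)).len + (
      ((Prog.assign 22 (reg 18)).len + (Prog.assign 22 (reg 13)).len + 1) + (
      ((min M' N - M) * (spillToVm.len + 1) + 1) + (
      ((Prog.assign 22 (reg 18)).len + (Prog.assign 22 (reg 10)).len + 1) + (
      (Prog.assign 21 (reg 20)).len + (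
      (Prog.assign 0 (reg 4)).len + (
      ((N' - max M M') * (spillToSpill.len + 1) + 1) + (
      ((min N' (max M M') - M') * (vmToSpill.len + 1) + 1) + (
      ((Prog.assign 0 (load (reg 17 + reg 3) * reg 19 + reg 0)).len + (Prog.block []).len)))))))))))))))
    ?hS ?hT ?hA
    (fun _ h => h)
  case hS =>
    refine Sat.bind₀ hloc ?_
    rintro s₁ ⟨hLo, h5, h13, h16, hm, hv, hr⟩
    have h2' : s₁.reg 2 = d' := by rw [hr _ (by norm_num), h2]
    have h3' : s₁.reg 3 = P.name d' φ' := by rw [hr _ (by norm_num), h3]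
    have h4' : s₁.reg 4 = k' := by rw [hr _ (by norm_num), h4]
    rw [← hm] at e18 e19 e20 e0
    have h10 := hLo.mout_eq
    rw [hM] at h10
    refine Sat.set (D.base + d' * D.stride)
      (by simp [blockExpr, hLo.base_eq, hLo.stride_eq, h2'])
      (by simp [blockExpr, hLo.base_eq, hLo.stride_eq, h2']; omega) ?_
    refine Sat.set M' (by simp [hLo.m_eq, e18]) (by simp [hLo.m_eq, e18]; omega) ?_
    refine Sat.set (D.grain d') (by simp [hLo.m_eq, e19]) (by simp [hLo.m_eq, e19]; omega) ?_
    refine Sat.set N' (by simp [recordExpr, hLo.m_eq, hLo.n_eq, h2', h3', e20])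
      (by simp [recordExpr, hLo.m_eq, hLo.n_eq, h2', h3', e20]; omega) ?_
    refine Sat.set M (by simp [h10]) (by simp [h10]; omega) ?_
    generalize hs₂ : ((((s₁.set 17 _).set 18 _).set 19 _).set 20 _).set 21 _ = s₂
    have m₂ : s₂.mem = s.mem := by simp [← hs₂, hm]
    have v₂ : s₂.vm = s.vm := by simp [← hs₂, hv]
    have r3 : s₂.reg 3 = P.name d' φ' := by simp [← hs₂, h3']
    have r4 : s₂.reg 4 = k' := by simp [← hs₂, h4']
    have r5 : s₂.reg 5 = w := by simp [← hs₂, h5]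
    have r10 : s₂.reg 10 = M := by simp [← hs₂, h10]
    have r13 : s₂.reg 13 = N := by simp [← hs₂, h13]
    have r15 : s₂.reg 15 = y := by simp [← hs₂, hLo.rest_eq]
    have r17 : s₂.reg 17 = D.base + d' * D.stride := by simp [← hs₂]
    have r18 : s₂.reg 18 = M' := by simp [← hs₂]
    have r19 : s₂.reg 19 = D.grain d' := by simp [← hs₂]
    have r20 : s₂.reg 20 = N' := by simp [← hs₂]
    have r21 : s₂.reg 21 = M := by simp [← hs₂]
    clear hs₂ hLo h5 h13 h16 hr h10 h2' h3' h4'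
    refine Sat.bind₀ (Q := fun s' => s' = s₂.set 22 (min M' N)) (Sat.ite (by norm_num)
      (by norm_num) (fun h => Sat.assign M' (by simp [r18]) (by simp [r18]; omega) ?_)
      fun h => Sat.assign N (by simp [r13]) (by simp [r13]; omega) ?_) ?_
    · rw [r18, r13] at h
      rw [min_eq_left h.le]
    · rw [r18, r13] at h
      rw [min_eq_right h]
    rintro _ rfl
    -- If the memory grows, the old words in `[M, M')` enter it. Addresses from `N` on correspond to
    -- fresh words and are left alone.
    refine Sat.bind (A₁ := (min M' N - M) * 1) (spillToVm_spec (M := M) (l := min M' N) (y := y) _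
      (by simp [r5]) (by simp [r10]) (by simp [r15]) (by simp [r21]) (by simp) hW hwlt hMW
      (by omega) ((Nat.mul_le_mul_left _ (min_le_right _ _)).trans_lt hwN) hyW) ?_
    rintro s₃ ⟨hS₃, v₃⟩
    replace hS₃ : s₂.SameExcept [21, 22, 23] s₃ :=
      ((State.SameExcept.refl _ s₂).set (by decide) _).trans (hS₃.mono (by decide))
    replace v₃ : ∀ j, s₃.vm j = if M ≤ j ∧ j < min M' N then
      BitVec.ofNat w (y / 2 ^ (w * (j - M))) else s.vm j := by simpa [v₂] using v₃
    have r10' : s₃.reg 10 = M := by rw [hS₃.2 10 (by decide), r10]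
    have r18' : s₃.reg 18 = M' := by rw [hS₃.2 18 (by decide), r18]
    refine Sat.bind₀ (Q := fun s' => s' = s₃.set 22 (max M M')) (Sat.ite (by norm_num)
      (by norm_num) (fun h => Sat.assign M' (by simp [r18']) (by simp [r18']; omega) ?_)
      fun h => Sat.assign M (by simp [r10']) (by simp [r10']; omega) ?_) ?_
    · rw [r18', r10'] at h
      rw [max_eq_right h.le]
    · rw [r18', r10'] at h
      rw [max_eq_left h]
    rintro _ rfl
    have r20' : s₃.reg 20 = N' := by rw [hS₃.2 20 (by decide), r20]
    have r4' : s₃.reg 4 = k' := by rw [hS₃.2 4 (by decide), r4]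
    have hkin : P.Kin d' φ' ≤ P.Kin d' φ' * 2 ^ (w * (N' - M')) :=
      Nat.le_mul_of_pos_right _ (by positivity)
    refine Sat.set N' (by simp [r20']) (by simp [r20']; omega) ?_
    refine Sat.set k' (by simp [r4']) (by simp [r4']; omega) ?_
    refine Sat.bind₀ (spillToSpill_spec (M := M) (U := max M M') (M' := M') (N := N') (k := k')
      (K := P.Kin d' φ') (y := y) (f := f) _ (by simp) ?_ ?_ ?_ (by simp) (by simp)
      (le_max_left _ _) (le_max_right _ _) hW hwlt hpow hMW hN' hwN' hyW k'.2 hszW ?_) ?_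
    · simp [hS₃.2 5, r5]
    · simp [hS₃.2 10, r10]
    · simp [hS₃.2 15, r15]
    · intro i hi
      simp [hf, not_lt.2 hi]
    rintro s₄ ⟨hS₄, v₄, t₄, D₄⟩
    replace hS₄ : s₂.SameExcept [0, 21, 22, 23] s₄ :=
      (((hS₃.mono (by decide)).set (by decide) _).set (by decide) _).set (by decide) _ |>.trans
        (hS₄.mono (by decide))
    replace v₄ : s₄.vm = s₃.vm := v₄
    refine Sat.bind (A₁ := (min N' (max M M') - M') * 1) (A₂ := 0) (vmToSpill_spec (M' := M')
      (N := N') (k := k') (K := P.Kin d' φ') (t₀ := min N' (max M M')) (f := f) s₄ ?_ ?_ t₄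
      (min_le_left _ _) (t₄ ▸ D₄) hW hwlt hwW hN' k'.2 hszW ?_) ?_
    · rw [hS₄.2 5 (by decide), r5]
    · rw [hS₄.2 18 (by decide), r18]
    · intro i hi hi'
      have : i < M := by omega
      simp only [hf, if_pos this]
      -- A word with `M' ≤ i < M` was not touched by the first loop, so the memory still holds its
      -- old value.
      rw [v₄, v₃, if_neg (by omega)]
    rintro s₅ ⟨hS₅, v₅, D₅⟩
    replace hS₅ : s₂.SameExcept [0, 21, 22, 23] s₅ := hS₄.trans (hS₅.mono (by decide))
    rw [v₄] at v₅
    rw [show min (min N' (max M M')) M' = min N' M' by omega] at D₅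
    have hlt := D₅.lt k'.2 le_rfl
    have hNM : N' - min N' M' = N' - M' := by omega
    rw [hNM, ← hsz'] at hlt
    have hout := D.start_mul_add_lt hi' hlt
    have q3 : s₅.reg 3 = P.name d' φ' := by rw [hS₅.2 3 (by decide), r3]
    have q17 : s₅.reg 17 = D.base + d' * D.stride := by rw [hS₅.2 17 (by decide), r17]
    have q19 : s₅.reg 19 = D.grain d' := by rw [hS₅.2 19 (by decide), r19]
    rw [hm, ← m₂, ← hS₅.1] at e0
    refine Sat.set (D.start d' (P.name d' φ') * D.grain d' + s₅.reg 0) (by simp [q3, q17, q19, e0])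
      (by simp [q3, q17, q19, e0]; omega) (Sat.nil ⟨?_, ?_, ?_⟩)
    · simp [hS₅.1, m₂]
    · intro i hi
      simp only [State.set_vm]
      rw [v₅, v₃, if_neg (by omega)]
    -- The new input words are read off the result: the memory below `M'`, the digits of the new
    -- spill from `M'` on.
    · refine ⟨fun i => if (i : ℕ) < M' then s₃.vm i else
        BitVec.ofNat w (s₅.reg 0 / 2 ^ (w * (i - M'))), ?_, ?_⟩
      · intro i h h'
        rw [hw]
        simp only [v₃]
        by_cases hiM' : i < M'
        -- For `i` below both `N` and `M'`, the word either came from the old spill or was in memory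
        -- all along.
        · have : (M ≤ i ∧ i < min M' N) ↔ ¬ i < M := by omega
          simp only [if_pos hiM', this]
          split_ifs <;> simp_all
        · have hD₅ := D₅.2 i (by omega) h'
          have : min N' M' = M' := by omega
          rw [this] at hD₅
          rw [if_neg hiM']
          refine BitVec.eq_of_toNat_eq ?_
          rw [BitVec.toNat_ofNat, hD₅]
          simp only [hf]
          split_ifs <;> simp
      · refine encodes_code.2 ⟨s₅.reg 0, hlt, by simp [D], ?_, fun j => ?_⟩
        · have := D₅.1
          rw [← hD, hM']
          rw [hNM] at this
          exact this
        · simp only [← hD, hM', State.set_vm, v₅]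
  case hT =>
    -- Each iteration handles a word that lies in the old or the new spill, so no loop runs more
    -- than `L` times, however far apart `M` and `M'` are.
    have h₁ := Nat.mul_le_mul_right (spillToVm.len + 1) (show min M' N - M ≤ L by omega)
    have h₂ := Nat.mul_le_mul_right (spillToSpill.len + 1) (show N' - max M M' ≤ L by omega)
    have h₃ := Nat.mul_le_mul_right (vmToSpill.len + 1)
      (show min N' (max M M') - M' ≤ L by omega)
    have h₄ : ∀ (b : Test) (p : Prog), (Prog.while b p).len = p.len + 1 := fun _ _ => rfl
    have h₅ : ∀ (b : Test) (p r : Prog), (Prog.ite b p r).len = p.len + r.len + 1 :=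
      fun _ _ _ => rfl
    have h₆ : ∀ (p : Prog) (l : List Prog), (Prog.block (p :: l)).len = p.len + (Prog.block l).len :=
      fun _ _ => rfl
    rw [changeTime, change]
    simp only [h₄, h₅, h₆]
    omega
  case hA =>
    show _ ≤ Nat.dist (D.mout d') (D.mout d)
    rw [hM, hM', Nat.dist]
    omega

end EntropyEncoder

/-! ## Computing the table -/

namespace WordRAM

variable {w : ℕ}

/-- The states agree on all registers except those in `R`. -/
def State.SameRegs (R : List ℕ) (s₀ s : State w) : Prop := ∀ r, r ∉ R → s.reg r = s₀.reg r

theorem State.SameRegs.refl (R : List ℕ) (s : State w) : s.SameRegs R s := fun _ _ => rfl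

theorem State.SameRegs.trans {R : List ℕ} {s₀ s₁ s₂ : State w} (h : s₀.SameRegs R s₁)
    (h' : s₁.SameRegs R s₂) : s₀.SameRegs R s₂ := fun r hr => (h' r hr).trans (h r hr)

theorem State.SameRegs.set {R : List ℕ} {s₀ s : State w} (h : s₀.SameRegs R s) {r : ℕ}
    (hr : r ∈ R) (v : ℕ) : s₀.SameRegs R (s.set r v) :=
  fun k hk => by rw [State.set_reg, if_neg (by rintro rfl; exact hk hr), h k hk]

theorem State.SameRegs.put {R : List ℕ} {s₀ s : State w} (h : s₀.SameRegs R s) (a v : ℕ) :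
    s₀.SameRegs R (s.put a v) := h

theorem State.SameRegs.mono {R R' : List ℕ} {s₀ s : State w} (h : s₀.SameRegs R s)
    (hR : R ⊆ R') : s₀.SameRegs R' s := fun r hr => h r fun hr' => hr (hR hr')

end WordRAM

namespace EntropyEncoder

open WordRAM Expr

def padSymbol : Prog := .block [
  .ite (.lt 11 12)
    (.block [])
    (.block [
      .put (reg 10) (lit 0),
      .put (reg 10 + lit 1) (lit 0),
      .put (reg 10 + lit 2) (lit 0)]),
  .assign 10 (reg 10 + lit 3),
  .assign 11 (reg 11 + lit 1)]

def padDist : Prog := .block [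
  .assign 11 (lit 0),
  .assign 12 (load (lit 4 + reg 9)),
  .while (.lt 11 8) padSymbol,
  .assign 9 (reg 9 + lit 1)]

def maxSymbol : Prog := .block [
  .assign 14 (load (reg 12 + lit 3 * reg 11)),
  .ite (.lt 13 14) (.block [.assign 13 (reg 14)]) (.block []),
  .assign 11 (reg 11 + lit 1)]

/-- The size of symbol `reg 11` of the distribution with records from `reg 12` on and output
memory size `reg 13`. -/
def sizeExpr : Expr :=
  load (reg 12 + lit 3 * reg 11 + lit 1) <<<
    (reg 5 * (load (reg 12 + lit 3 * reg 11) - reg 13))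

def totalSymbol : Prog := .block [
  .assign 15 (reg 15 + sizeExpr),
  .assign 11 (reg 11 + lit 1)]

def startSymbol : Prog := .block [
  .put (reg 10) (reg 17),
  .assign 10 (reg 10 + lit 1),
  .assign 17 (reg 17 + (sizeExpr + reg 16 - lit 1) / reg 16),
  .assign 11 (reg 11 + lit 1)]

def cellStep : Prog := .block [
  .assign 20 (load (reg 21 + reg 11 + lit 1)),
  .ite (.lt 19 20)
    (.block [
      .put (reg 10) (reg 11),
      .assign 10 (reg 10 + lit 1),
      .assign 19 (reg 19 + lit 1)])
    (.block [.assign 11 (reg 11 + lit 1)])]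

def buildGrain : Prog := .block [
  .assign 16 (reg 15 / (reg 6 * reg 8)),
  .assign 17 (lit 1),
  .ite (.lt 16 17) (.block [.assign 16 (lit 1)]) (.block [])]

def buildSizes : Prog := .block [
  .assign 18 (lit 3 * (reg 6 * reg 8)),
  .put (reg 10) (reg 17),
  .put (reg 10 + lit 1) (reg 18),
  .put (reg 10 + lit 2) (reg 13),
  .put (reg 10 + lit 3) (reg 17 * reg 16),
  .put (reg 10 + lit 4) (reg 16),
  .assign 10 (reg 10 + lit 5)]

def buildDist (L : ℕ) : Prog := .block [
  .assign 12 (recordExpr (reg 9) (lit 0)),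
  .assign 21 (reg 10),
  .assign 13 (lit 0),
  .assign 11 (lit 0),
  .while (.lt 11 8) maxSymbol,
  .assign 13 (reg 13 - lit L),
  .assign 15 (lit 0),
  .assign 11 (lit 0),
  .while (.lt 11 8) totalSymbol,
  buildGrain,
  .assign 17 (lit 0),
  .assign 11 (lit 0),
  .while (.lt 11 8) startSymbol,
  buildSizes,
  .assign 11 (lit 0),
  .assign 19 (lit 0),
  .while (.lt 19 18) cellStep,
  .assign 9 (reg 9 + lit 1)]

/-- Compute the table from a description of the parameters. -/
def build (L : ℕ) : Prog := .block [
  header,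
  .assign 9 (lit 0),
  .assign 10 (lit 4 + reg 7),
  .while (.lt 9 7) padDist,
  .assign 9 (lit 0),
  .while (.lt 9 7) (buildDist L)]

/-! ### Correctness and running time of the construction of the table. -/

namespace Sizes

variable {D : Sizes} {w W : ℕ}

theorem Header.of_sameRegs {R : List ℕ} {s₀ s : State w} (h : D.Header s₀)
    (hs : s₀.SameRegs R s) (hR : ∀ r ∈ R, r ∉ [5, 6, 7, 8, 24, 25]) : D.Header s where
  w_eq := by rw [hs 5 fun h => hR _ h (by decide), h.w_eq]
  q_eq := by rw [hs 6 fun h => hR _ h (by decide), h.q_eq]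
  n_eq := by rw [hs 7 fun h => hR _ h (by decide), h.n_eq]
  m_eq := by rw [hs 8 fun h => hR _ h (by decide), h.m_eq]
  base_eq := by rw [hs 24 fun h => hR _ h (by decide), h.base_eq]
  stride_eq := by rw [hs 25 fun h => hR _ h (by decide), h.stride_eq]

variable (D) in
/-- The first `a` cells of the memory contain the first `a` cells of the table. -/
def Upto (a : ℕ) (mem : ℕ → ℕ) : Prop := ∀ j < a, mem j = D.table j

theorem Upto.put {s : State w} {a i v : ℕ} (h : D.Upto a s.mem) (hi : i = a)
    (hv : v = D.table a) : D.Upto (a + 1) (s.put i v).mem := by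
  intro j hj
  subst hi
  rw [State.put_mem]
  split_ifs with hji
  · rw [hv, hji]
  · exact h j (by omega)

theorem record_lt_base {d i : ℕ} (hd : d < D.n) (hi : i < D.m) :
    4 + D.n + 3 * (d * D.m) + 3 * i + 2 < D.base := by
  have := mul_add_lt hd hi
  rw [base]
  omega

theorem Upto.mn {a d i : ℕ} {mem : ℕ → ℕ} (h : D.Upto a mem) (ha : D.base ≤ a) (hd : d < D.n)
    (hi : i < D.m) : mem (4 + D.n + 3 * (d * D.m) + 3 * i) = D.mn d i := by
  rw [h _ (by have := record_lt_base hd hi; omega), ← D.table_mn hd hi]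
  congr 1
  ring

theorem Upto.kn {a d i : ℕ} {mem : ℕ → ℕ} (h : D.Upto a mem) (ha : D.base ≤ a) (hd : d < D.n)
    (hi : i < D.m) : mem (4 + D.n + 3 * (d * D.m) + 3 * i + 1) = D.kn d i := by
  rw [h _ (by have := record_lt_base hd hi; omega), ← D.table_kn hd hi]
  congr 1
  ring

/-- The numbers of `D` are in memory, without the padding. -/
structure Described (D : Sizes) (mem : ℕ → ℕ) : Prop where
  head : ∀ j < 4 + D.n, mem j = D.table j
  record : ∀ d < D.n, ∀ i < D.supp d, ∀ o < 3,
    mem (4 + D.n + 3 * (d * D.m + i) + o) = D.table (4 + D.n + 3 * (d * D.m + i) + o)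
  pad : ∀ d < D.n, ∀ i, D.supp d ≤ i → D.mn d i = 0 ∧ D.kn d i = 0 ∧ D.pr d i = 0

/-- A description leaves the records past the support arbitrary, while the later loops run over all
`m` records; zeros contribute nothing to maxima and sums. The invariant: cells below the pointer are
final, cells from it on are as in the beginning. -/
theorem padSymbol_spec (h : D.Fits W) {mem₀ : ℕ → ℕ} (hD : D.Described mem₀) {d : ℕ}
    (hd : d < D.n) (s₀ : State w) (hH : D.Header s₀) (h10 : s₀.reg 10 = 4 + D.n + 3 * (d * D.m))
    (h11 : s₀.reg 11 = 0) (h12 : s₀.reg 12 = D.supp d)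
    (hm : D.Upto (s₀.reg 10) s₀.mem) (hm₀ : ∀ j, s₀.reg 10 ≤ j → s₀.mem j = mem₀ j) :
    Sat W (.while (.lt 11 8) padSymbol) (D.m * (padSymbol.len + 1) + 1) 0 s₀ fun s =>
      s₀.SameRegs [10, 11] s ∧ s.reg 10 = 4 + D.n + 3 * ((d + 1) * D.m) ∧
        D.Upto (s.reg 10) s.mem ∧ ∀ j, s.reg 10 ≤ j → s.mem j = mem₀ j := by
  refine (Sat.while (A := 0) (fun k s => s₀.SameRegs [10, 11] s ∧ s.reg 11 + k = D.m ∧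
    s.reg 10 = 4 + D.n + 3 * (d * D.m + s.reg 11) ∧
    D.Upto (s.reg 10) s.mem ∧ ∀ j, s.reg 10 ≤ j → s.mem j = mem₀ j)
    (by norm_num) (by norm_num) ?_ ?_ D.m s₀ ?_).mono le_rfl (by simp) ?_
  · rintro k s ⟨hS, hk, ha, hu, hu₀⟩
    have hH' : D.Header s := hH.of_sameRegs hS (by decide)
    have h12' : s.reg 12 = D.supp d := by rw [hS 12 (by decide), h12]
    have hi : s.reg 11 < D.m := by omega
    have hR := h.record_lt hd hi
    have hb := record_lt_base hd hi
    have hbl := h.base_lt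
    have hmW := h.m_lt
    have hW := h.ne_zero
    refine ⟨by rw [hH'.m_eq]; exact hi, ?_⟩
    generalize hi' : s.reg 11 = i at *
    generalize haa : s.reg 10 = a at *
    refine Sat.bind₀ (Q := fun s' => s.SameRegs [] s' ∧ D.Upto (a + 3) s'.mem ∧
      ∀ j, a + 3 ≤ j → s'.mem j = mem₀ j)
      (Sat.ite (by norm_num) (by norm_num) (fun hlt => Sat.nil ⟨.refl _ _, ?_, ?_⟩) fun hle => ?_) ?_
    · intro j hj
      rw [hi', h12'] at hlt
      rcases lt_or_ge j a with hja | hja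
      · exact hu j hja
      · obtain ⟨o, rfl⟩ := Nat.exists_eq_add_of_le hja
        rw [hu₀ _ hja, ha]
        exact hD.record d hd i hlt o (by omega)
    · intro j hj
      exact hu₀ j (by omega)
    · rw [hi', h12'] at hle
      obtain ⟨z₁, z₂, z₃⟩ := hD.pad d hd i hle
      refine Sat.store a 0 (by simp [haa]) (by simp) (by simp [haa]; omega) (by simp) ?_
      refine Sat.store (a + 1) 0 (by simp [haa]) (by simp) (by simp [haa]; omega) (by simp) ?_
      refine Sat.store (a + 2) 0 (by simp [haa]) (by simp) (by simp [haa]; omega) (by simp) ?_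
      refine Sat.nil ⟨.refl _ _, ?_, ?_⟩
      · refine ((hu.put rfl ?_).put rfl ?_).put rfl ?_
        · rw [ha, D.table_mn hd hi, z₁]
        · rw [ha, D.table_kn hd hi, z₂]
        · rw [ha, add_assoc, D.table_pr hd hi, z₃]
      · intro j hj
        rw [State.put_mem, if_neg (by omega), State.put_mem, if_neg (by omega), State.put_mem,
          if_neg (by omega)]
        exact hu₀ j (by omega)
    rintro s' ⟨hS', hu', hu₀'⟩
    have e10 : s'.reg 10 = a := by rw [hS' 10 (by decide), haa]
    have e11 : s'.reg 11 = i := by rw [hS' 11 (by decide), hi']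
    refine Sat.set (a + 3) (by simp [e10]) (by simp [e10]; omega) ?_
    refine Sat.set (i + 1) (by simp [e11]) (by simp [e11]; omega) ?_
    refine Sat.nil ⟨?_, by simp; omega, by simp; omega, by simpa using hu', by simpa using hu₀'⟩
    exact ((hS.trans (hS'.mono (by decide))).set (by decide) _).set (by decide) _
  · rintro s ⟨hS, hk, -⟩
    rw [hS 8 (by decide), hH.m_eq]
    omega
  · exact ⟨.refl _ _, by omega, by rw [h10, h11]; rfl, hm, hm₀⟩
  · rintro s ⟨hS, hk, ha, hu⟩
    refine ⟨hS, ?_, hu⟩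
    rw [ha, Nat.add_mul, one_mul]
    omega

theorem padDist_spec (h : D.Fits W) {mem₀ : ℕ → ℕ} (hD : D.Described mem₀)
    (s₀ : State w) (hH : D.Header s₀) (h9 : s₀.reg 9 = 0) (h10 : s₀.reg 10 = 4 + D.n)
    (hm : s₀.mem = mem₀) :
    Sat W (.while (.lt 9 7) padDist) (D.n * (padDist.len + D.m * (padSymbol.len + 1) + 1) + 1) 0 s₀
      fun s => D.Header s ∧ s.reg 10 = D.base ∧ D.Upto D.base s.mem := by
  refine (Sat.while (A := 0) (fun k s => s₀.SameRegs [9, 10, 11, 12] s ∧ s.reg 9 + k = D.n ∧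
    s.reg 10 = 4 + D.n + 3 * (s.reg 9 * D.m) ∧
    D.Upto (s.reg 10) s.mem ∧ ∀ j, s.reg 10 ≤ j → s.mem j = mem₀ j)
    (by norm_num) (by norm_num) ?_ ?_ D.n s₀ ?_).mono le_rfl (by simp) ?_
  · rintro k s ⟨hS, hk, ha, hu, hu₀⟩
    have hH' : D.Header s := hH.of_sameRegs hS (by decide)
    have hd : s.reg 9 < D.n := by omega
    have hbl := h.base_lt
    have hn := h.n_lt
    have hW := h.ne_zero
    have hsup := h.supp_lt (s.reg 9)
    have hb4 : 4 + D.n ≤ D.base := by rw [base]; omega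
    refine ⟨by rw [hH'.n_eq]; exact hd, ?_⟩
    generalize hd' : s.reg 9 = d at *
    have hmem : s.mem (4 + d) = D.supp d := by rw [hu _ (by omega), D.table_supp hd]
    refine Sat.mono (T := (Prog.assign 11 (lit 0)).len + ((Prog.assign 12 (load (lit 4 + reg 9))).len
      + (D.m * (padSymbol.len + 1) + 1 + ((Prog.assign 9 (reg 9 + lit 1)).len +
        (Prog.block []).len)))) (A := 0) ?_ ?_ le_rfl (fun _ h => h)
    · refine Sat.set 0 (by simp) (by simp) ?_
      refine Sat.set (D.supp d) (by simp [hd', hmem]) (by simp [hd', hmem]; omega) ?_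
      refine Sat.bind₀ (padSymbol_spec h hD hd _ (hH'.of_sameRegs (R := [11, 12])
        (((State.SameRegs.refl _ s).set (by decide) _).set (by decide) _) (by decide))
        (by simp [ha]) (by simp) (by simp) (by simpa using hu) (by simpa using hu₀)) ?_
      rintro s' ⟨hS', ha', hu', hu₀'⟩
      have e9 : s'.reg 9 = d := by rw [hS' 9 (by decide)]; simp [hd']
      refine Sat.set (d + 1) (by simp [e9]) (by simp [e9]; omega) (Sat.nil
        ⟨?_, by simp; omega, by simp [ha'], by simpa using hu', by simpa using hu₀'⟩)
      exact (((hS.set (by decide) _).set (by decide) _).trans (hS'.mono (by decide))).set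
        (by decide) _
    · have h₄ : ∀ (b : Test) (p : Prog), (Prog.while b p).len = p.len + 1 := fun _ _ => rfl
      have h₆ : ∀ (p : Prog) (l : List Prog),
        (Prog.block (p :: l)).len = p.len + (Prog.block l).len := fun _ _ => rfl
      rw [padDist]
      simp only [h₄, h₆]
      omega
  · rintro s ⟨hS, hk, -⟩
    rw [hS 7 (by decide), hH.n_eq]
    omega
  · refine ⟨.refl _ _, by omega, by rw [h10, h9]; simp, ?_, fun j _ => by rw [hm]⟩
    rw [h10, hm]
    exact hD.head
  · rintro s ⟨hS, hk, ha, hu, -⟩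
    have : s.reg 10 = D.base := by
      rw [ha, base, show s.reg 9 = D.n by omega]
    exact ⟨hH.of_sameRegs hS (by decide), this, this ▸ hu⟩

theorem maxSymbol_spec (h : D.Fits W) {d a : ℕ} (hd : d < D.n) (ha : D.base ≤ a) (s₀ : State w)
    (hH : D.Header s₀) (h11 : s₀.reg 11 = 0) (h12 : s₀.reg 12 = 4 + D.n + 3 * (d * D.m))
    (h13 : s₀.reg 13 = 0) (hm : D.Upto a s₀.mem) :
    Sat W (.while (.lt 11 8) maxSymbol) (D.m * (maxSymbol.len + 1) + 1) 0 s₀ fun s =>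
      s₀.SameRegs [11, 13, 14] s ∧ s.mem = s₀.mem ∧
        s.reg 13 = (Finset.range D.m).sup (D.mn d) := by
  refine (Sat.while (A := 0) (fun k s => s₀.SameRegs [11, 13, 14] s ∧ s.reg 11 + k = D.m ∧
    s.mem = s₀.mem ∧ s.reg 13 = (Finset.range (s.reg 11)).sup (D.mn d))
    (by norm_num) (by norm_num) ?_ ?_ D.m s₀ ?_).mono le_rfl (by simp) ?_
  · rintro k s ⟨hS, hk, hmem, hsup⟩
    have hH' : D.Header s := hH.of_sameRegs hS (by decide)
    have h12' : s.reg 12 = 4 + D.n + 3 * (d * D.m) := by rw [hS 12 (by decide), h12]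
    have hi : s.reg 11 < D.m := by omega
    have hb := record_lt_base hd hi
    have hbl := h.base_lt
    have hmW := h.m_lt
    have hW := h.ne_zero
    rw [← hmem] at hm
    have e := hm.mn ha hd hi
    have hmn := h.mn_lt d (s.reg 11)
    refine ⟨by rw [hH'.m_eq]; exact hi, ?_⟩
    generalize hi' : s.reg 11 = i at *
    refine Sat.set (D.mn d i) (by simp [h12', hi', e]) (by simp [h12', hi', e]; omega) ?_
    refine Sat.bind₀ (Q := fun s' => s.SameRegs [13, 14] s' ∧ s'.mem = s₀.mem ∧
      s'.reg 13 = max (s.reg 13) (D.mn d i))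
      (Sat.ite (by norm_num) (by norm_num) (fun hlt => ?_) fun hle => Sat.nil ⟨?_, by simp [hmem], ?_⟩) ?_
    · simp only [State.set_reg] at hlt
      norm_num at hlt
      refine Sat.set (D.mn d i) (by simp) (by simp [hmn]) (Sat.nil ⟨?_, by simp [hmem], ?_⟩)
      · exact ((State.SameRegs.refl _ s).set (by decide) _).set (by decide) _
      · simp [max_eq_right hlt.le]
    · exact (State.SameRegs.refl _ s).set (by decide) _
    · simp only [State.set_reg] at hle
      norm_num at hle
      simp [max_eq_left hle]
    rintro s' ⟨hS', hm', e13⟩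
    have e11 : s'.reg 11 = i := by rw [hS' 11 (by decide), hi']
    refine Sat.set (i + 1) (by simp [e11]) (by simp [e11]; omega) (Sat.nil
      ⟨(hS.trans (hS'.mono (by decide))).set (by decide) _, by simp; omega, by simp [hm'], ?_⟩)
    simp [e13, hsup, Finset.range_add_one, max_comm]
  · rintro s ⟨hS, hk, -⟩
    rw [hS 8 (by decide), hH.m_eq]
    omega
  · exact ⟨.refl _ _, by omega, rfl, by simp [h11, h13]⟩
  · rintro s ⟨hS, hk, hmem, hsup⟩
    exact ⟨hS, hmem, by rw [hsup, show s.reg 11 = D.m by omega]⟩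

theorem sizeExpr_eval {d a i : ℕ} (hd : d < D.n) (hi : i < D.m) (ha : D.base ≤ a) {s : State w}
    (hH : D.Header s) (h11 : s.reg 11 = i) (h12 : s.reg 12 = 4 + D.n + 3 * (d * D.m))
    (h13 : s.reg 13 = D.mout d) (hm : D.Upto a s.mem) : sizeExpr.eval s = D.size d i := by
  simp [sizeExpr, h11, h12, h13, hm.mn ha hd hi, hm.kn ha hd hi, hH.w_eq, size]

theorem sizeExpr_ok (h : D.Fits W) {d a i : ℕ} (hd : d < D.n) (hi : i < D.m) (ha : D.base ≤ a)
    {s : State w} (hH : D.Header s) (h11 : s.reg 11 = i)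
    (h12 : s.reg 12 = 4 + D.n + 3 * (d * D.m))
    (h13 : s.reg 13 = D.mout d) (hm : D.Upto a s.mem) : sizeExpr.Ok W s := by
  have hb := record_lt_base hd hi
  have hbl := h.base_lt
  have hW := h.ne_zero
  have hmn := h.mn_lt d i
  have hwm := h.mul_mn_lt d i
  have hkn := h.kn_lt d i
  have hmo := h.mout_lt d
  have hw := h.w_lt_pow
  have hmul : D.w * (D.mn d i - D.mout d) ≤ D.w * D.mn d i :=
    Nat.mul_le_mul_left _ (Nat.sub_le _ _)
  have hs := h.size_lt d hi
  rw [size] at hs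
  simp [sizeExpr, h11, h12, h13, hm.mn ha hd hi, hm.kn ha hd hi, hH.w_eq]
  omega

theorem totalSymbol_spec (h : D.Fits W) {d a : ℕ} (hd : d < D.n) (ha : D.base ≤ a) (s₀ : State w)
    (hH : D.Header s₀) (h11 : s₀.reg 11 = 0) (h12 : s₀.reg 12 = 4 + D.n + 3 * (d * D.m))
    (h13 : s₀.reg 13 = D.mout d) (h15 : s₀.reg 15 = 0) (hm : D.Upto a s₀.mem) :
    Sat W (.while (.lt 11 8) totalSymbol) (D.m * (totalSymbol.len + 1) + 1) 0 s₀ fun s =>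
      s₀.SameRegs [11, 15] s ∧ s.mem = s₀.mem ∧ s.reg 15 = D.total d := by
  refine (Sat.while (A := 0) (fun k s => s₀.SameRegs [11, 15] s ∧ s.reg 11 + k = D.m ∧
    s.mem = s₀.mem ∧ s.reg 15 = ∑ i ∈ Finset.range (s.reg 11), D.size d i)
    (by norm_num) (by norm_num) ?_ ?_ D.m s₀ ?_).mono le_rfl (by simp) ?_
  · rintro k s ⟨hS, hk, hmem, hsum⟩
    have hH' : D.Header s := hH.of_sameRegs hS (by decide)
    have h12' : s.reg 12 = 4 + D.n + 3 * (d * D.m) := by rw [hS 12 (by decide), h12]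
    have h13' : s.reg 13 = D.mout d := by rw [hS 13 (by decide), h13]
    have hi : s.reg 11 < D.m := by omega
    have hmW := h.m_lt
    have hW := h.ne_zero
    have htot := h.total_lt d
    rw [← hmem] at hm
    refine ⟨by rw [hH'.m_eq]; exact hi, ?_⟩
    have e := sizeExpr_eval hd hi ha hH' rfl h12' h13' hm
    have o := sizeExpr_ok h hd hi ha hH' rfl h12' h13' hm
    have hle : ∑ i ∈ Finset.range (s.reg 11 + 1), D.size d i ≤ D.total d :=
      Finset.sum_le_sum_of_subset (Finset.range_subset_range.2 hi)
    have hsucc := Finset.sum_range_succ (D.size d) (s.reg 11)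
    refine Sat.set (∑ i ∈ Finset.range (s.reg 11 + 1), D.size d i) (by simp [e, hsum, hsucc])
      (by simp [e, o, hsum]; omega) ?_
    refine Sat.set (s.reg 11 + 1) (by simp) (by simp; omega) (Sat.nil
      ⟨(hS.set (by decide) _).set (by decide) _, by simp; omega, by simp [hmem], by simp⟩)
  · rintro s ⟨hS, hk, -⟩
    rw [hS 8 (by decide), hH.m_eq]
    omega
  · exact ⟨.refl _ _, by omega, rfl, by simp [h11, h15]⟩
  · rintro s ⟨hS, hk, hmem, hsum⟩
    exact ⟨hS, hmem, by rw [hsum, show s.reg 11 = D.m by omega]; rfl⟩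

theorem buildGrain_spec (h : D.Fits W) {d : ℕ} (s₀ : State w)
    (hH : D.Header s₀) (h15 : s₀.reg 15 = D.total d) :
    Sat W buildGrain buildGrain.len 0 s₀ fun s =>
      s₀.SameRegs [16, 17] s ∧ s.mem = s₀.mem ∧ s.reg 16 = D.grain d := by
  have hW := h.ne_zero
  have htot := h.total_lt d
  have hq := h.q_lt
  have hm := h.m_lt
  have hc := h.cells_lt
  have hdl := Nat.div_le_self (D.total d) (D.q * D.m)
  refine Sat.set (D.total d / (D.q * D.m)) (by simp [h15, hH.q_eq, hH.m_eq])
    (by simp [h15, hH.q_eq, hH.m_eq]; omega) ?_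
  refine Sat.set 1 (by simp) (by simp; omega) ?_
  refine Sat.bind₀ (Sat.ite (by norm_num) (by norm_num)
    (fun hlt => Sat.set 1 (by simp) (by simp; omega) (Sat.nil ?_))
    (fun hle => Sat.nil ?_)) fun s' h => Sat.nil h
  · simp only [State.set_reg] at hlt
    norm_num at hlt
    refine ⟨(((State.SameRegs.refl _ s₀).set (by decide) _).set (by decide) _).set (by decide) _,
      by simp, ?_⟩
    have : D.total d / (D.q * D.m) = 0 := Nat.div_eq_zero_iff.2 (by
      have := h.one_le_q
      have := h.one_le_m
      omega)
    simp [grain, this]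
  · simp only [State.set_reg] at hle
    norm_num at hle
    refine ⟨((State.SameRegs.refl _ s₀).set (by decide) _).set (by decide) _, by simp, ?_⟩
    simp only [State.set_reg, grain]
    norm_num
    omega

/-- Each partial sum is stored before the next count is added. The last one, `start d m`, is left in
register `17` for `buildSizes`. -/
theorem startSymbol_spec (h : D.Fits W) {d : ℕ} (hd : d < D.n) (s₀ : State w)
    (hH : D.Header s₀) (h10 : s₀.reg 10 = D.base + d * D.stride) (h11 : s₀.reg 11 = 0)
    (h12 : s₀.reg 12 = 4 + D.n + 3 * (d * D.m)) (h13 : s₀.reg 13 = D.mout d)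
    (h16 : s₀.reg 16 = D.grain d) (h17 : s₀.reg 17 = 0) (hm : D.Upto (s₀.reg 10) s₀.mem) :
    Sat W (.while (.lt 11 8) startSymbol) (D.m * (startSymbol.len + 1) + 1) 0 s₀ fun s =>
      s₀.SameRegs [10, 11, 17] s ∧ s.reg 10 = D.base + d * D.stride + D.m ∧
        D.Upto (s.reg 10) s.mem ∧ s.reg 17 = D.start d D.m := by
  refine (Sat.while (A := 0) (fun k s => s₀.SameRegs [10, 11, 17] s ∧ s.reg 11 + k = D.m ∧
    s.reg 10 = D.base + d * D.stride + s.reg 11 ∧ D.Upto (s.reg 10) s.mem ∧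
    s.reg 17 = D.start d (s.reg 11))
    (by norm_num) (by norm_num) ?_ ?_ D.m s₀ ?_).mono le_rfl (by simp) ?_
  · rintro k s ⟨hS, hk, ha, hu, hst⟩
    have hi : s.reg 11 < D.m := by omega
    have hmW := h.m_lt
    have hW := h.ne_zero
    have hB := h.block_lt hd
    have htot := h.total_lt d
    have hg := D.grain_le d
    have hst' := h.start_lt d hi.le
    have hst'' := h.start_lt d (i := s.reg 11 + 1) hi
    have hsz := D.size_le_total (d := d) hi
    have hS' : D.m + 5 + 3 * (D.q * D.m) = D.stride := rfl
    have hT := D.table_start (d := d) hi.le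
    refine ⟨by rw [hS 8 (by decide), hH.m_eq]; exact hi, ?_⟩
    have hu' := hu.put rfl (hst.trans (by rw [ha, hT]))
    generalize haa : s.reg 10 = a at *
    refine Sat.store a (s.reg 17) (by simp [haa]) (by simp) (by simp [haa]; omega)
      (by simp; omega) ?_
    refine Sat.set (a + 1) (by simp [haa]) (by simp [haa]; omega) ?_
    have hS₁ : s₀.SameRegs [10, 11, 17] ((s.put a (s.reg 17)).set 10 (a + 1)) :=
      (hS.put _ _).set (by decide) _
    generalize hs₁ : (s.put a (s.reg 17)).set 10 (a + 1) = s₁ at *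
    have hu₁ : D.Upto (a + 1) s₁.mem := by rw [← hs₁]; exact hu'
    have e10 : s₁.reg 10 = a + 1 := by simp [← hs₁]
    have e11 : s₁.reg 11 = s.reg 11 := by simp [← hs₁]
    have e17 : s₁.reg 17 = s.reg 17 := by simp [← hs₁]
    have e12 : s₁.reg 12 = 4 + D.n + 3 * (d * D.m) := by rw [hS₁ 12 (by decide), h12]
    have e13 : s₁.reg 13 = D.mout d := by rw [hS₁ 13 (by decide), h13]
    have e16 : s₁.reg 16 = D.grain d := by rw [hS₁ 16 (by decide), h16]
    have hH₁ : D.Header s₁ := hH.of_sameRegs hS₁ (by decide)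
    have e := sizeExpr_eval hd hi (by omega) hH₁ e11 e12 e13 hu₁
    have o := sizeExpr_ok h hd hi (by omega) hH₁ e11 e12 e13 hu₁
    have hsucc := D.start_succ d (s.reg 11)
    rw [cnt] at hsucc
    refine Sat.set (D.start d (s.reg 11 + 1)) (by simp [e, e16, e17, hst, hsucc])
      (by simp [e, o, e16, e17, hst]; omega) ?_
    refine Sat.set (s.reg 11 + 1) (by simp [e11]) (by simp [e11]; omega) (Sat.nil
      ⟨(hS₁.set (by decide) _).set (by decide) _, by simp; omega, by simp [e10]; omega,
        by simpa [e10] using hu₁, by simp⟩)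
  · rintro s ⟨hS, hk, -⟩
    rw [hS 8 (by decide), hH.m_eq]
    omega
  · exact ⟨.refl _ _, by omega, by omega, hm, by rw [h17, h11]; rfl⟩
  · rintro s ⟨hS, hk, ha, hu, hst⟩
    have : s.reg 11 = D.m := by omega
    exact ⟨hS, by rw [ha, this], hu, by rw [hst, this]⟩

theorem buildSizes_spec (h : D.Fits W) {d : ℕ} (hd : d < D.n) (s₀ : State w)
    (hH : D.Header s₀) (h10 : s₀.reg 10 = D.base + d * D.stride + D.m)
    (h13 : s₀.reg 13 = D.mout d) (h16 : s₀.reg 16 = D.grain d) (h17 : s₀.reg 17 = D.start d D.m)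
    (hm : D.Upto (s₀.reg 10) s₀.mem) :
    Sat W buildSizes buildSizes.len 0 s₀ fun s =>
      s₀.SameRegs [10, 18] s ∧ s.reg 10 = D.base + d * D.stride + D.m + 5 ∧
        D.Upto (s.reg 10) s.mem ∧ s.reg 18 = 3 * (D.q * D.m) := by
  have hW := h.ne_zero
  have hB := h.block_lt hd
  have hq := h.q_lt
  have hmW := h.m_lt
  have hc := h.cells_lt
  have hg := h.grain_lt d
  have hmo := h.mout_lt d
  have hst := h.start_lt d le_rfl
  have hko := h.kout_lt d
  rw [kout] at hko
  have hS' : D.m + 5 + 3 * (D.q * D.m) = D.stride := rfl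
  have hT := D.table_start (d := d) le_rfl
  have hu := ((((hm.put rfl (h17.trans (by rw [h10, hT]))).put rfl
    (show 3 * (D.q * D.m) = _ by rw [h10, D.table_cells])).put rfl
    (show D.mout d = _ by rw [h10, D.table_mout])).put rfl
    (show D.kout d = _ by rw [h10, D.table_kout])).put rfl
    (show D.grain d = _ by rw [h10, D.table_grain])
  refine Sat.set (3 * (D.q * D.m)) (by simp [hH.q_eq, hH.m_eq])
    (by simp [hH.q_eq, hH.m_eq]; omega) ?_
  refine Sat.store (s₀.reg 10) (s₀.reg 17) (by simp) (by simp) (by simp; omega) (by simp; omega) ?_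
  refine Sat.store (s₀.reg 10 + 1) (3 * (D.q * D.m)) (by simp) (by simp) (by simp; omega)
    (by simp; omega) ?_
  refine Sat.store (s₀.reg 10 + 2) (D.mout d) (by simp) (by simp [h13]) (by simp; omega)
    (by simp; omega) ?_
  refine Sat.store (s₀.reg 10 + 3) (D.kout d) (by simp) (by simp [h16, h17, kout])
    (by simp; omega) (by simp [h16, h17]; omega) ?_
  refine Sat.store (s₀.reg 10 + 4) (D.grain d) (by simp) (by simp [h16])
    (by simp; omega) (by simp [h16]; omega) ?_
  refine Sat.set (s₀.reg 10 + 5) (by simp) (by simp; omega) (Sat.nil ⟨?_, by simp [h10], ?_, ?_⟩)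
  · intro r hr
    simp only [List.mem_cons, not_or] at hr
    simp [hr.1, hr.2.1]
  · simp
    exact hu
  · simp

/-- A merge of the sorted starts with the cells. A pair of pointers, symbol `i` and cell `c`,
satisfies `start d i ≤ c`, and each iteration advances one of them; hence linear time. The loop
stops when `c` reaches the end, possibly before `i` reaches `m`, so only an upper bound for the
number of iterations is available. -/
theorem cellStep_spec (h : D.Fits W) {d : ℕ} (hd : d < D.n) (s₀ : State w)
    (h10 : s₀.reg 10 = D.base + d * D.stride + D.m + 5) (h11 : s₀.reg 11 = 0)
    (h18 : s₀.reg 18 = 3 * (D.q * D.m)) (h19 : s₀.reg 19 = 0)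
    (h21 : s₀.reg 21 = D.base + d * D.stride)
    (hm : D.Upto (s₀.reg 10) s₀.mem) :
    Sat W (.while (.lt 19 18) cellStep) ((D.m + 3 * (D.q * D.m)) * (cellStep.len + 1) + 1) 0 s₀
      fun s => s₀.SameRegs [10, 11, 19, 20] s ∧ s.reg 10 = D.base + (d + 1) * D.stride ∧
        D.Upto (s.reg 10) s.mem := by
  refine (Sat.while_of_le (A := 0) (fun k s => s₀.SameRegs [10, 11, 19, 20] s ∧
    (D.m - s.reg 11) + (3 * (D.q * D.m) - s.reg 19) = k ∧ s.reg 11 ≤ D.m ∧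
    D.start d (s.reg 11) ≤ s.reg 19 ∧ s.reg 19 ≤ 3 * (D.q * D.m) ∧
    s.reg 10 = D.base + d * D.stride + D.m + 5 + s.reg 19 ∧ D.Upto (s.reg 10) s.mem)
    (by norm_num) (by norm_num) ?_ ?_ (D.m + 3 * (D.q * D.m)) s₀ ?_).mono le_rfl (by simp) ?_
  · rintro k s ⟨hS, hk, hi, hsc, hc, ha, hu⟩ hlt
    rw [hS 18 (by decide), h18] at hlt
    have e21 : s.reg 21 = D.base + d * D.stride := by rw [hS 21 (by decide), h21]
    have hmW := h.m_lt
    have hW := h.ne_zero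
    have hB := h.block_lt hd
    have hcW := h.cells_lt
    have hS' : D.m + 5 + 3 * (D.q * D.m) = D.stride := rfl
    have hT := D.table_owner (d := d) hlt
    generalize hi' : s.reg 11 = i at *
    generalize hc' : s.reg 19 = c at *
    generalize haa : s.reg 10 = a at *
    -- The value read is the start of the next symbol, or the sentinel if `i = m`. As `c` is below
    -- the sentinel, `i` never passes `m`.
    obtain ⟨v, hv, hvW, hv₁, hv₂⟩ : ∃ v, s.mem (D.base + d * D.stride + i + 1) = v ∧ v < 2 ^ W ∧
        (c < v → D.owner d c = i) ∧ (v ≤ c → i < D.m ∧ D.start d (i + 1) ≤ c) := by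
      rcases hi.lt_or_eq with hi'' | rfl
      · refine ⟨D.start d (i + 1), ?_, h.start_lt d hi'', fun h => D.owner_eq hi hsc fun _ => h,
          fun h => ⟨hi'', h⟩⟩
        rw [hu _ (by omega), add_assoc, D.table_start hi'']
      · refine ⟨3 * (D.q * D.m), ?_, hcW, fun _ => D.owner_eq hi hsc fun h => absurd h (lt_irrefl _),
          fun h => absurd hlt (not_lt.2 h)⟩
        rw [hu _ (by omega), D.table_cells]
    refine Sat.set v (by simp [e21, hi', hv]) (by simp [e21, hi', hv]; omega) ?_
    refine Sat.bind₀ (Sat.ite (by norm_num) (by norm_num) (fun hlt' => ?_) fun hle => ?_)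
      fun s' h => Sat.nil h
    · simp only [State.set_reg] at hlt'
      norm_num [hc'] at hlt'
      have hu' := hu.put (v := i) rfl (by rw [ha, hT, hv₁ hlt'])
      refine Sat.store a i (by simp [haa]) (by simp [hi']) (by simp [haa]; omega)
        (by simp [hi']; omega) ?_
      refine Sat.set (a + 1) (by simp [haa]) (by simp [haa]; omega) ?_
      refine Sat.set (c + 1) (by simp [hc']) (by simp [hc']; omega) (Sat.nil
        ⟨(((hS.set (by decide) _).put _ _).set (by decide) _).set (by decide) _,
          by simp [hi']; omega, by simp [hi']; omega, by simp [hi']; omega, by simp; omega,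
          by simp; omega, ?_⟩)
      simp
      exact hu'
    · simp only [State.set_reg] at hle
      norm_num [hc'] at hle
      obtain ⟨h₁, h₂⟩ := hv₂ hle
      refine Sat.set (i + 1) (by simp [hi']) (by simp [hi']; omega) (Sat.nil
        ⟨(hS.set (by decide) _).set (by decide) _, by simp [hc']; omega, by simp; omega,
          by simp [hc', h₂], by simp [hc']; omega, by simp [haa, hc', ha], by simpa [haa] using hu⟩)
  · rintro s ⟨hS, hk, -⟩
    rw [hS 18 (by decide), h18]
    omega
  · exact ⟨.refl _ _, by omega, by omega, by simp [h11], by omega, by omega, hm⟩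
  · rintro s ⟨⟨k, hS, hk, hi, hsc, hc, ha, hu⟩, hle⟩
    rw [hS 18 (by decide), h18] at hle
    refine ⟨hS, ?_, hu⟩
    have hS' : D.m + 5 + 3 * (D.q * D.m) = D.stride := rfl
    rw [ha, Nat.add_mul, one_mul]
    omega

/-- The running time of `buildDist`. -/
def distTime (D : Sizes) : ℕ :=
  (buildDist D.L).len + D.m * (maxSymbol.len + 1) + D.m * (totalSymbol.len + 1) +
    D.m * (startSymbol.len + 1) + (D.m + 3 * (D.q * D.m)) * (cellStep.len + 1)

theorem buildDist_spec (h : D.Fits W) {d : ℕ} (hd : d < D.n) (s₀ : State w)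
    (hH : D.Header s₀) (h9 : s₀.reg 9 = d) (h10 : s₀.reg 10 = D.base + d * D.stride)
    (hm : D.Upto (s₀.reg 10) s₀.mem) :
    Sat W (buildDist D.L) D.distTime 0 s₀ fun s =>
      s₀.SameRegs [9, 10, 11, 12, 13, 14, 15, 16, 17, 18, 19, 20, 21] s ∧ s.reg 9 = d + 1 ∧
        s.reg 10 = D.base + (d + 1) * D.stride ∧ D.Upto (s.reg 10) s.mem := by
  have hW := h.ne_zero
  have hB := h.block_lt hd
  have hn := h.n_lt
  have hmW := h.m_lt
  have hR := h.record_lt hd h.one_le_m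
  have hmo := h.mout_lt d
  have hLW := h.L_lt
  have hsupW : (Finset.range D.m).sup (D.mn d) < 2 ^ W :=
    (Finset.sup_lt_iff (by positivity)).2 fun i _ => h.mn_lt d i
  have hdm := Nat.le_mul_of_pos_right d h.one_le_m
  refine Sat.mono (A := 0) (T := (Prog.assign 12 (recordExpr (reg 9) (lit 0))).len + (
    (Prog.assign 21 (reg 10)).len + (
    (Prog.assign 13 (lit 0)).len + (
    (Prog.assign 11 (lit 0)).len + (
    D.m * (maxSymbol.len + 1) + 1 + (
    (Prog.assign 13 (reg 13 - lit D.L)).len + (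
    (Prog.assign 15 (lit 0)).len + (
    (Prog.assign 11 (lit 0)).len + (
    D.m * (totalSymbol.len + 1) + 1 + (
    buildGrain.len + (
    (Prog.assign 17 (lit 0)).len + (
    (Prog.assign 11 (lit 0)).len + (
    D.m * (startSymbol.len + 1) + 1 + (
    buildSizes.len + (
    (Prog.assign 11 (lit 0)).len + (
    (Prog.assign 19 (lit 0)).len + (
    (D.m + 3 * (D.q * D.m)) * (cellStep.len + 1) + 1 + (
    (Prog.assign 9 (reg 9 + lit 1)).len + (Prog.block []).len))))))))))))))))))
    ?_ ?_ le_rfl (fun _ h => h)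
  · refine Sat.set (4 + D.n + 3 * (d * D.m)) (by simp [recordExpr, hH.n_eq, hH.m_eq, h9])
      (by simp [recordExpr, hH.n_eq, hH.m_eq, h9]; omega) ?_
    refine Sat.set (D.base + d * D.stride) (by simp [h10]) (by simp [h10]; omega) ?_
    refine Sat.set 0 (by simp) (by simp) ?_
    refine Sat.set 0 (by simp) (by simp) ?_
    generalize hs₁ : (((s₀.set 12 _).set 21 _).set 13 _).set 11 _ = s₁
    have S₁ : s₀.SameRegs [9, 10, 11, 12, 13, 14, 15, 16, 17, 18, 19, 20, 21] s₁ := by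
      rw [← hs₁]
      exact ((((State.SameRegs.refl _ s₀).set (by decide) _).set (by decide) _).set
        (by decide) _).set (by decide) _
    have a9 : s₁.reg 9 = d := by simp [← hs₁, h9]
    have a10 : s₁.reg 10 = D.base + d * D.stride := by simp [← hs₁, h10]
    have a11 : s₁.reg 11 = 0 := by simp [← hs₁]
    have a12 : s₁.reg 12 = 4 + D.n + 3 * (d * D.m) := by simp [← hs₁]
    have a13 : s₁.reg 13 = 0 := by simp [← hs₁]
    have a21 : s₁.reg 21 = D.base + d * D.stride := by simp [← hs₁]
    have aU : D.Upto (D.base + d * D.stride) s₁.mem := by rw [← hs₁, ← h10]; exact hm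
    clear hs₁
    refine Sat.bind₀ (maxSymbol_spec h hd (Nat.le_add_right _ _) s₁
      (hH.of_sameRegs S₁ (by decide)) a11 a12 a13 aU) ?_
    rintro s₂ ⟨R₂, m₂, b13⟩
    refine Sat.set (D.mout d) (by simp [b13, mout])
      (by
        simp only [ok_sub, ok_reg, ok_lit, b13]
        exact ⟨⟨by norm_num, hsupW⟩, hLW⟩) ?_
    refine Sat.set 0 (by simp) (by simp) ?_
    refine Sat.set 0 (by simp) (by simp) ?_
    generalize hs₃ : ((s₂.set 13 _).set 15 _).set 11 _ = s₃
    have R₃ : s₁.SameRegs [11, 13, 14, 15] s₃ := by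
      rw [← hs₃]
      exact (((R₂.mono (by decide)).set (by decide) _).set (by decide) _).set (by decide) _
    have S₃ := S₁.trans (R₃.mono (by decide))
    have m₃ : s₃.mem = s₁.mem := by simp [← hs₃, m₂]
    have c11 : s₃.reg 11 = 0 := by simp [← hs₃]
    have c13 : s₃.reg 13 = D.mout d := by simp [← hs₃]
    have c15 : s₃.reg 15 = 0 := by simp [← hs₃]
    have c12 : s₃.reg 12 = 4 + D.n + 3 * (d * D.m) := by rw [R₃ 12 (by decide), a12]
    clear hs₃ R₂ b13
    rw [← m₃] at aU
    refine Sat.bind₀ (totalSymbol_spec h hd (Nat.le_add_right _ _) s₃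
      (hH.of_sameRegs S₃ (by decide)) c11 c12 c13 c15 aU) ?_
    rintro s₄ ⟨R₄, m₄, d15⟩
    have S₄ := S₃.trans (R₄.mono (by decide))
    refine Sat.bind₀ (buildGrain_spec h s₄ (hH.of_sameRegs S₄ (by decide)) d15) ?_
    rintro s₅ ⟨R₅, m₅, e16⟩
    refine Sat.set 0 (by simp) (by simp) ?_
    refine Sat.set 0 (by simp) (by simp) ?_
    generalize hs₆ : (s₅.set 17 _).set 11 _ = s₆
    have R₆ : s₁.SameRegs [11, 13, 14, 15, 16, 17] s₆ := by
      rw [← hs₆]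
      exact ((((R₃.mono (by decide)).trans (R₄.mono (by decide))).trans
        (R₅.mono (by decide))).set (by decide) _).set (by decide) _
    have S₆ := S₁.trans (R₆.mono (by decide))
    have m₆ : s₆.mem = s₃.mem := by simp [← hs₆, m₄, m₅]
    have f10 : s₆.reg 10 = D.base + d * D.stride := by rw [R₆ 10 (by decide), a10]
    have f11 : s₆.reg 11 = 0 := by simp [← hs₆]
    have f12 : s₆.reg 12 = 4 + D.n + 3 * (d * D.m) := by rw [R₆ 12 (by decide), a12]
    have f13 : s₆.reg 13 = D.mout d := by
      rw [← c13, ← R₄ 13 (by decide), ← R₅ 13 (by decide), ← hs₆]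
      simp
    have f16 : s₆.reg 16 = D.grain d := by simp [← hs₆, e16]
    have f17 : s₆.reg 17 = 0 := by simp [← hs₆]
    clear hs₆ R₅ m₅ m₄ d15 R₄
    rw [← m₆, ← f10] at aU
    refine Sat.bind₀ (startSymbol_spec h hd s₆ (hH.of_sameRegs S₆ (by decide)) f10 f11 f12 f13
      f16 f17 aU) ?_
    rintro s₇ ⟨R₇, g10, gU, g17⟩
    have S₇ := S₆.trans (R₇.mono (by decide))
    refine Sat.bind₀ (buildSizes_spec h hd s₇ (hH.of_sameRegs S₇ (by decide)) g10
      ((R₇ 13 (by decide)).trans f13) ((R₇ 16 (by decide)).trans f16) g17 gU) ?_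
    rintro s₈ ⟨R₈, i10, iU, i18⟩
    have S₈ := S₇.trans (R₈.mono (by decide))
    have i21 : s₈.reg 21 = D.base + d * D.stride := by
      rw [R₈ 21 (by decide), R₇ 21 (by decide), R₆ 21 (by decide), a21]
    refine Sat.set 0 (by simp) (by simp) ?_
    refine Sat.set 0 (by simp) (by simp) ?_
    refine Sat.bind₀ (cellStep_spec h hd _ (by simp [i10]) (by simp) (by simp [i18]) (by simp)
      (by simp [i21]) (by simpa using iU)) ?_
    rintro s₉ ⟨R₉, j10, jU⟩
    have j9 : s₉.reg 9 = d := by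
      rw [R₉ 9 (by decide)]
      simp only [State.set_reg]
      norm_num
      rw [R₈ 9 (by decide), R₇ 9 (by decide), R₆ 9 (by decide), a9]
    refine Sat.set (d + 1) (by simp [j9]) (by simp [j9]; omega) (Sat.nil
      ⟨?_, by simp, by simp [j10], by simpa using jU⟩)
    exact (((S₈.set (by decide) _).set (by decide) _).trans (R₉.mono (by decide))).set
      (by decide) _
  · have h₄ : ∀ (b : Test) (p : Prog), (Prog.while b p).len = p.len + 1 := fun _ _ => rfl
    have h₆ : ∀ (p : Prog) (l : List Prog),
      (Prog.block (p :: l)).len = p.len + (Prog.block l).len := fun _ _ => rfl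
    rw [distTime, buildDist]
    simp only [h₄, h₆]
    omega

/-- A factor for the running time of `build`. -/
def buildFactor (L : ℕ) : ℕ :=
  (build L).len + padDist.len + padSymbol.len + (buildDist L).len + maxSymbol.len +
    totalSymbol.len + startSymbol.len + 4 * cellStep.len + 12

/-- The time per distribution is `O(q * m)`, dominated by the merge, and the padding takes `O(n *
m)` in all. -/
theorem build_spec (h : D.Fits W) (s₀ : State w) (hD : D.Described s₀.mem) :
    Sat W (build D.L) (buildFactor D.L * (D.n * (D.q * D.m))) 0 s₀ fun s => D.Loads s.mem := by
  have hb4 : 4 + D.n ≤ D.base := by rw [base]; omega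
  have hbl := h.base_lt
  have hn := h.n_lt
  have hW := h.ne_zero
  refine Sat.mono (A := 0) (T := header.len + (
    (Prog.assign 9 (lit 0)).len + (
    (Prog.assign 10 (lit 4 + reg 7)).len + (
    D.n * (padDist.len + D.m * (padSymbol.len + 1) + 1) + 1 + (
    (Prog.assign 9 (lit 0)).len + (
    D.n * (D.distTime + 1) + 1 + (Prog.block []).len))))))
    ?_ ?_ le_rfl (fun _ h => h)
  · refine Sat.bind₀ (header_spec h s₀ ((hD.head 0 (by omega)).trans rfl)
      ((hD.head 1 (by omega)).trans rfl) ((hD.head 2 (by omega)).trans rfl)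
      ((hD.head 3 (by omega)).trans rfl)) ?_
    rintro s₁ ⟨hH, hm, -, -⟩
    refine Sat.set 0 (by simp) (by simp) ?_
    refine Sat.set (4 + D.n) (by simp [hH.n_eq]) (by simp [hH.n_eq]; omega) ?_
    refine Sat.bind₀ (padDist_spec h hD _ (hH.of_sameRegs (R := [9, 10])
      (((State.SameRegs.refl _ s₁).set (by decide) _).set (by decide) _) (by decide))
      (by simp) (by simp) (by simp [hm])) ?_
    rintro s₂ ⟨hH₂, h10, hU⟩
    refine Sat.set 0 (by simp) (by simp) ?_
    refine Sat.bind₀ (Sat.while (A := 0) (T := D.distTime) (fun k s => D.Header s ∧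
      s.reg 9 + k = D.n ∧ s.reg 10 = D.base + s.reg 9 * D.stride ∧ D.Upto (s.reg 10) s.mem)
      (by norm_num) (by norm_num) ?_ ?_ D.n _ ?_ |>.mono le_rfl (by simp) fun _ h => h) ?_
    · rintro k s ⟨hs, hk, h10', hU'⟩
      have hd : s.reg 9 < D.n := by omega
      refine ⟨by rw [hs.n_eq]; exact hd, (buildDist_spec h hd s hs rfl h10' hU').mono le_rfl le_rfl ?_⟩
      rintro s' ⟨hS, h9, h10'', hU''⟩
      exact ⟨hs.of_sameRegs hS (by decide), by omega, by rw [h10'', h9], hU''⟩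
    · rintro s ⟨hs, hk, -⟩
      rw [hs.n_eq]
      omega
    · refine ⟨hH₂.of_sameRegs (R := [9]) ((State.SameRegs.refl _ s₂).set (by decide) _)
        (by decide), by simp, by simp [h10], by simpa [h10] using hU⟩
    · rintro s ⟨-, hk, h10', hU'⟩
      refine Sat.nil ?_
      rw [h10', show s.reg 9 = D.n by omega] at hU'
      exact hU'
  · have h₄ : ∀ (b : Test) (p : Prog), (Prog.while b p).len = p.len + 1 := fun _ _ => rfl
    have h₆ : ∀ (p : Prog) (l : List Prog),
      (Prog.block (p :: l)).len = p.len + (Prog.block l).len := fun _ _ => rfl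
    have hbuild : header.len + (Prog.assign 9 (lit 0)).len + (Prog.assign 10 (lit 4 + reg 7)).len +
        (Prog.assign 9 (lit 0)).len + 2 + (Prog.block []).len ≤ (build D.L).len := by
      rw [build]
      simp only [h₄, h₆]
      omega
    have h₁ := h.one_le_n
    have h₂ : D.m ≤ D.q * D.m := Nat.le_mul_of_pos_left _ h.one_le_q
    have h₃ : D.n ≤ D.n * (D.q * D.m) :=
      Nat.le_mul_of_pos_right _ (Nat.mul_pos h.one_le_q h.one_le_m)
    have h₅ := Nat.mul_le_mul_left D.n h₂
    have h₇ : 1 ≤ D.n * (D.q * D.m) := h₁.trans h₃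
    rw [distTime, buildFactor]
    generalize hX : D.n * (D.q * D.m) = X at *
    generalize header.len = l₁ at *
    generalize (Prog.assign 9 (lit 0)).len = l₂ at *
    generalize (Prog.assign 10 (lit 4 + reg 7)).len = l₃ at *
    generalize (Prog.block []).len = l₄ at *
    generalize (build D.L).len = l₅ at *
    generalize padDist.len = l₆
    generalize padSymbol.len = l₇
    generalize (buildDist D.L).len = l₈
    generalize maxSymbol.len = l₉
    generalize totalSymbol.len = l₁₀
    generalize startSymbol.len = l₁₁
    generalize cellStep.len = l₁₂
    -- The costs are grouped by their order `1`, `n`, `n * m` and `n * q * m`; each order is at most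
    -- `X`.
    calc _ = (l₁ + l₂ + l₃ + l₂ + 2 + l₄) * 1 + (l₆ + l₈ + 2) * D.n +
          (l₇ + l₉ + l₁₀ + l₁₁ + l₁₂ + 5) * (D.n * D.m) + 3 * (l₁₂ + 1) * X := by
          rw [← hX]; ring
      _ ≤ l₅ * X + (l₆ + l₈ + 2) * X + (l₇ + l₉ + l₁₀ + l₁₁ + l₁₂ + 5) * X +
          3 * (l₁₂ + 1) * X := by gcongr
      _ = (l₅ + l₆ + l₇ + l₈ + l₉ + l₁₀ + l₁₁ + 4 * l₁₂ + 10) * X := by ring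
      _ ≤ _ := Nat.mul_le_mul_right _ (by omega)

end Sizes

end EntropyEncoder

/-! ## The main theorem -/

namespace EntropyEncoder

open WordRAM

variable {Φ : Type*}

theorem Params.described_sizes {P : Params Φ} {w q nb L : ℕ} {mem : ℕ → ℕ}
    (h : P.Described w q nb mem) : (P.sizes w q nb L).Described mem := by
  obtain ⟨h0, h1, h2, h3, hd⟩ := h
  constructor
  · intro j hj
    rcases lt_or_ge j 4 with hj4 | hj4
    · interval_cases j
      exacts [h0, h1, h2, h3]
    · obtain ⟨d, rfl⟩ := Nat.exists_eq_add_of_le hj4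
      have hdn : d < P.numDist := by
        have : (P.sizes w q nb L).n = P.numDist := rfl
        omega
      rw [Sizes.table_supp _ hdn, (hd ⟨d, hdn⟩).1]
      simp [sizes, hdn]
  · intro d hdn i hi o ho
    have hdn' : d < P.numDist := hdn
    have hi' : i < P.suppSize ⟨d, hdn'⟩ := by simpa [sizes, hdn'] using hi
    have hφ := (hd ⟨d, hdn'⟩).2 ((P.name ⟨d, hdn'⟩).symm ⟨i, hi'⟩)
    have hpad : ∀ f : ∀ d, (P.dist d).support → ℕ,
        P.pad f d i = f ⟨d, hdn'⟩ ((P.name ⟨d, hdn'⟩).symm ⟨i, hi'⟩) := fun f => by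
      rw [pad, dif_pos ⟨hdn', hi'⟩]
    rw [Equiv.apply_symm_apply] at hφ
    rw [Sizes.table_record _ hdn (hi'.trans_le (P.suppSize_le _)) ho]
    simp only [sizes, hpad]
    interval_cases o
    exacts [hφ.1, hφ.2.1, hφ.2.2]
  · intro d hdn i hi
    have hdn' : d < P.numDist := hdn
    have hi' : P.suppSize ⟨d, hdn'⟩ ≤ i := by simpa [sizes, hdn'] using hi
    exact ⟨P.pad_of_le _ ⟨d, hdn'⟩ hi', P.pad_of_le _ ⟨d, hdn'⟩ hi', P.pad_of_le _ ⟨d, hdn'⟩ hi'⟩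

theorem Params.builds_code {P : Params Φ} {w q nb L W : ℕ} (hF : (P.sizes w q nb L).Fits W) :
    (P.code w q nb L).Builds W q nb (Sizes.buildFactor L * (P.numDist * (q * P.maxSupp))) (build L) := by
  intro s hs
  refine (Sizes.build_spec hF s (described_sizes hs)).runsTo ?_
  intro t t' h hl
  rw [h.2.1]
  exact hl

/-! ### Bounds for the table length and for the register width. -/

theorem Params.suppSize_pos (P : Params Φ) (d : Fin P.numDist) : 0 < P.suppSize d := by
  obtain ⟨φ, hφ⟩ := (P.dist d).support_nonempty
  exact (Nat.zero_le _).trans_lt (P.name d ⟨φ, hφ⟩).2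

theorem Params.maxSupp_pos (P : Params Φ) (hn : 1 ≤ P.numDist) : 0 < P.maxSupp :=
  (P.suppSize_pos ⟨0, hn⟩).trans_le (P.suppSize_le _)

theorem Params.maxKin_pos (P : Params Φ) (hn : 1 ≤ P.numDist) : 0 < P.maxKin := by
  let d : Fin P.numDist := ⟨0, hn⟩
  let i : Fin (P.suppSize d) := ⟨0, P.suppSize_pos d⟩
  refine (P.Kin_pos d ((P.name d).symm i)).trans_le ?_
  exact (Finset.le_sup (f := fun i : Fin (P.suppSize d) => P.Kin d ((P.name d).symm i))
    (Finset.mem_univ i)).trans (Finset.le_sup (f := fun d => Finset.univ.sup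
      fun i : Fin (P.suppSize d) => P.Kin d ((P.name d).symm i)) (Finset.mem_univ d))

/-- The encoder stays within the bound without its last factor, of which only positivity is used. -/
theorem Params.le_tableBound (P : Params Φ) {q : ℕ} (hq : 1 ≤ q) (hn : 1 ≤ P.numDist) :
    P.numDist * (q * P.maxSupp) ≤ P.tableBound q := by
  rw [tableBound, mul_comm q, ← mul_assoc]
  exact Nat.le_mul_of_pos_right _ (lt_min hq (P.maxKin_pos hn))

/-- The constant is the sum `4 + 1 + 3 + 1 + 5 + 3` of the coefficients, each term being at most a
multiple of `n * q * m`. -/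
theorem Sizes.tableLen_le {D : Sizes} (hq : 1 ≤ D.q) (hn : 1 ≤ D.n) (hm : 1 ≤ D.m) :
    D.tableLen ≤ 17 * (D.n * (D.q * D.m)) := by
  have h₁ : D.m ≤ D.q * D.m := Nat.le_mul_of_pos_left _ hq
  have h₂ : D.n ≤ D.n * (D.q * D.m) := Nat.le_mul_of_pos_right _ (Nat.mul_pos hq hm)
  have h₃ := Nat.mul_le_mul_left D.n h₁
  have h₄ : D.tableLen = 4 + D.n + 3 * (D.n * D.m) +
      (D.n * D.m + 5 * D.n + 3 * (D.n * (D.q * D.m))) := by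
    rw [tableLen, base, stride]
    ring
  omega

theorem Params.probCode_le (P : Params Φ) (n : ℕ) (d : Fin P.numDist)
    (φ : (P.dist d).support) : P.probCode n d φ ≤ 2 ^ n := by
  refine Nat.floor_le_of_le ?_
  push_cast
  have h : ((P.dist d) φ).toReal ≤ 1 := ENNReal.toReal_le_of_le_ofReal zero_le_one
    (by simpa using (P.dist d).coe_le_one φ)
  exact mul_le_of_le_one_left (by positivity) h

/-- The largest quantity is `total`: at most `2 ^ (c * w)` symbols, each with a spill below `2 ^ (c
* w)` and `3 * c` further words, which accounts for `5 * c` words. Probabilities need `b` words. The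
last `5` words absorb constant factors such as `17 < 2 ^ 5`, as `w ≥ 1`. -/
theorem Params.fits_sizes (P : Params Φ) {w q c b C : ℕ} (hw : 1 ≤ w) (hq : 1 ≤ q)
    (hn : 1 ≤ P.numDist) (hq' : q ≤ 2 ^ (c * w)) (hn' : P.numDist ≤ 2 ^ (c * w))
    (hs : ∀ d, P.suppSize d ≤ 2 ^ (c * w)) (hK : ∀ d φ, P.Kin d φ ≤ 2 ^ (c * w))
    (hM : ∀ d φ, P.Min d φ ≤ 2 ^ (c * w)) (hC : 5 * c + b + 5 ≤ C) :
    (P.sizes w q (b * w) (3 * c)).Fits (C * w) := by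
  have hm : 1 ≤ P.maxSupp := P.maxSupp_pos hn
  have hm' : P.maxSupp ≤ 2 ^ (c * w) := Finset.sup_le fun d _ => hs d
  have hpow : ∀ a, a ≤ C * w → 2 ^ a ≤ 2 ^ (C * w) := fun a ha =>
    Nat.pow_le_pow_right (by norm_num) ha
  have hCw : (5 * c + b + 5) * w ≤ C * w := Nat.mul_le_mul_right _ hC
  have hexp : (5 * c + b + 5) * w = 5 * (c * w) + b * w + 5 * w := by ring
  rw [hexp] at hCw
  have hlt : ∀ {x a : ℕ}, x ≤ 2 ^ a → a < C * w → x < 2 ^ (C * w) := fun hx ha =>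
    hx.trans_lt (Nat.pow_lt_pow_right (by norm_num) ha)
  have hww : w < 2 ^ w := Nat.lt_two_pow_self
  refine ⟨hw, ?_, ?_, hq, hn, hm, ?_, ?_, ?_, ?_, ?_, ?_, ?_⟩
  · show w < C * w
    omega
  · exact Nat.pow_lt_pow_right (by norm_num) (show w < C * w by omega)
  · have h₁ : 3 * c ≤ 3 * (c * w) := Nat.mul_le_mul_left _ (Nat.le_mul_of_pos_right _ hw)
    exact (Nat.lt_two_pow_self (n := 3 * c)).trans_le (hpow _ (by omega))
  · refine (Sizes.tableLen_le (D := P.sizes w q (b * w) (3 * c)) hq hn hm).trans_lt ?_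
    have h₁ : P.numDist * (q * P.maxSupp) ≤ 2 ^ (c * w) * (2 ^ (c * w) * 2 ^ (c * w)) :=
      Nat.mul_le_mul hn' (Nat.mul_le_mul hq' hm')
    have h₂ : 2 ^ (c * w) * (2 ^ (c * w) * 2 ^ (c * w)) * 2 ^ 5 ≤ 2 ^ (C * w) := by
      rw [← pow_add, ← pow_add, ← pow_add]
      exact hpow _ (by omega)
    have h₃ : 0 < 2 ^ (c * w) * (2 ^ (c * w) * 2 ^ (c * w)) := by positivity
    show 17 * (P.numDist * (q * P.maxSupp)) < _
    omega
  · intro d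
    show (if h : d < P.numDist then P.suppSize ⟨d, h⟩ else 0) < _
    split_ifs
    · exact hlt (hs _) (by omega)
    · positivity
  · intro d i
    have h₁ : w * P.pad P.Min d i ≤ 2 ^ w * 2 ^ (c * w) :=
      Nat.mul_le_mul hww.le (P.pad_le _ hM d i)
    rw [← pow_add] at h₁
    exact hlt h₁ (by omega)
  · exact fun d i => hlt (P.pad_le _ hK d i) (by omega)
  · exact fun d i => hlt (P.pad_le _ (P.probCode_le _) d i) (by omega)
  · intro d
    have h₁ : (P.sizes w q (b * w) (3 * c)).total d ≤
        2 ^ (c * w) * (2 ^ (c * w) * 2 ^ (w * (3 * c))) := by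
      rw [Sizes.total]
      refine (Finset.sum_le_card_nsmul _ _ (2 ^ (c * w) * 2 ^ (w * (3 * c))) fun i hi => ?_).trans ?_
      · have hi' := Finset.mem_range.1 hi
        have h₂ := (P.sizes w q (b * w) (3 * c)).mn_sub_le (d := d) hi'
        refine Nat.mul_le_mul (P.pad_le _ hK d i) (Nat.pow_le_pow_right (by norm_num)
          (Nat.mul_le_mul_left _ (Nat.sub_le_iff_le_add'.2 h₂)))
      · rw [Finset.card_range, smul_eq_mul]
        exact Nat.mul_le_mul_right _ hm'
    -- The factor `2 ^ 2` makes room for `2 * total + 1`.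
    have h₂ : 2 ^ (c * w) * (2 ^ (c * w) * 2 ^ (w * (3 * c))) * 2 ^ 2 ≤ 2 ^ (C * w) := by
      rw [← pow_add, ← pow_add, ← pow_add]
      have : w * (3 * c) = 3 * (c * w) := by ring
      exact hpow _ (by omega)
    have h₃ : 0 < 2 ^ (c * w) * (2 ^ (c * w) * 2 ^ (w * (3 * c))) := by positivity
    omega

/-! ### Redundancy -/

/-- The number of contents of distribution `d`. -/
def Sizes.contents (D : Sizes) (d : ℕ) : ℕ :=
  ∑ i ∈ Finset.range D.m, D.kn d i * 2 ^ (D.w * D.mn d i)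

/-- Outputs exceed contents only through symbols shorter than the output memory, each costing at
most `B * 2 ^ (w * mout)`. All `m` of these costs together are at most `1 / q` of the contents of a
single longest symbol, which keeps `L` full words in its spill. -/
theorem Sizes.mul_total_le {D : Sizes} {d B : ℕ} (hB : D.q * (D.m * B) ≤ 2 ^ (D.w * D.L))
    (hK : ∀ i, D.kn d i ≤ B)
    (hi : ∃ i < D.m, 0 < D.kn d i ∧ ∀ j < D.m, D.mn d j ≤ D.mn d i) :
    D.q * (D.total d * 2 ^ (D.w * D.mout d)) ≤ (D.q + 1) * D.contents d := by
  obtain ⟨i, him, hki, hmax⟩ := hi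
  have hsup : (Finset.range D.m).sup (D.mn d) = D.mn d i :=
    le_antisymm (Finset.sup_le fun j hj => hmax j (Finset.mem_range.1 hj))
      (Finset.le_sup (f := D.mn d) (Finset.mem_range.2 him))
  have hmo : D.mout d = D.mn d i - D.L := by rw [mout, hsup]
  -- If even the longest symbol has fewer than `L` words, the output memory is empty and nothing is
  -- wasted.
  rcases lt_or_ge (D.mn d i) D.L with hlt | hge
  · have h0 : D.mout d = 0 := by omega
    have : D.total d = D.contents d := by simp [total, contents, size, h0]
    rw [this, h0, Nat.succ_mul]
    simp
  · have h₁ : D.total d * 2 ^ (D.w * D.mout d) ≤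
        D.contents d + D.m * B * 2 ^ (D.w * D.mout d) := by
      have h₂ : ∀ j ∈ Finset.range D.m, D.size d j * 2 ^ (D.w * D.mout d) ≤
          D.kn d j * 2 ^ (D.w * D.mn d j) + B * 2 ^ (D.w * D.mout d) := by
        intro j _
        rw [size]
        rcases le_total (D.mn d j) (D.mout d) with hle | hle
        · rw [Nat.sub_eq_zero_of_le hle]
          simp only [mul_zero, pow_zero, mul_one]
          exact (Nat.mul_le_mul_right _ (hK j)).trans (Nat.le_add_left _ _)
        · rw [mul_assoc, ← pow_add, ← mul_add, Nat.sub_add_cancel hle]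
          exact Nat.le_add_right _ _
      rw [total, Finset.sum_mul]
      refine (Finset.sum_le_sum h₂).trans ?_
      rw [Finset.sum_add_distrib, Finset.sum_const, Finset.card_range, smul_eq_mul, contents,
        mul_assoc]
    have h₃ : D.q * (D.m * B) * 2 ^ (D.w * D.mout d) ≤ D.contents d := by
      refine (Nat.mul_le_mul_right _ hB).trans ?_
      rw [← pow_add, ← mul_add, hmo, Nat.add_sub_cancel' hge]
      refine (Nat.le_mul_of_pos_left _ hki).trans ?_
      exact Finset.single_le_sum (f := fun i => D.kn d i * 2 ^ (D.w * D.mn d i))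
        (fun _ _ => Nat.zero_le _) (Finset.mem_range.2 him)
    calc _ ≤ D.q * (D.contents d + D.m * B * 2 ^ (D.w * D.mout d)) := Nat.mul_le_mul_left _ h₁
      _ = D.q * D.contents d + D.q * (D.m * B) * 2 ^ (D.w * D.mout d) := by ring
      _ ≤ D.q * D.contents d + D.contents d := Nat.add_le_add_left h₃ _
      _ = _ := by ring

/-- The number of contents is a lower bound for `2 ^ Hin`. -/
theorem Params.contents_le (P : Params Φ) (w q nb L : ℕ) (d : Fin P.numDist) :
    ((P.sizes w q nb L).contents d : ℝ) ≤ 2 ^ P.Hin w d := by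
  classical
  let e := P.name d
  have : Fintype (P.dist d).support := Fintype.ofEquiv _ e.symm
  have h₁ : (P.sizes w q nb L).contents d =
      ∑ φ : (P.dist d).support, P.Kin d φ * 2 ^ (w * P.Min d φ) := by
    rw [Sizes.contents]
    have h₂ : ∀ i, P.suppSize d ≤ i → (P.sizes w q nb L).kn d i = 0 := fun i hi =>
      P.pad_of_le _ d hi
    have h₃ : Finset.range (P.suppSize d) ⊆ Finset.range (P.sizes w q nb L).m :=
      Finset.range_subset_range.2 (P.suppSize_le d)
    rw [← Finset.sum_subset h₃ fun i _ hi => by rw [h₂ i (by simpa using hi), zero_mul],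
      Finset.sum_range, ← e.sum_comp]
    refine Finset.sum_congr rfl fun φ _ => ?_
    have h₄ := P.pad_name P.Kin d φ
    have h₅ := P.pad_name P.Min d φ
    simp only [sizes, e, h₄, h₅]
  -- The term of `φ` in the maximum `Hin`, exponentiated. Summing over `φ` leaves the total
  -- probability as a factor.
  have h₂ : ∀ φ : (P.dist d).support,
      (P.Kin d φ * 2 ^ (w * P.Min d φ) : ℝ) ≤ ((P.dist d) φ).toReal * 2 ^ P.Hin w d := by
    intro φ
    have hp : 0 < ((P.dist d) φ).toReal :=
      ENNReal.toReal_pos ((P.dist d).mem_support_iff φ |>.1 φ.2) ((P.dist d).apply_ne_top φ)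
    have hk : (0 : ℝ) < P.Kin d φ := by exact_mod_cast P.Kin_pos d φ
    have hH : Real.logb 2 (1 / ((P.dist d) φ).toReal) + (w : ℝ) * (P.Min d φ : ℝ) +
        Real.logb 2 (P.Kin d φ : ℝ) ≤ P.Hin w d :=
      le_ciSup (f := fun ψ : (P.dist d).support =>
        Real.logb 2 (1 / ((P.dist d) ψ).toReal) + (w : ℝ) * (P.Min d ψ : ℝ) +
          Real.logb 2 (P.Kin d ψ : ℝ)) (Set.finite_range _).bddAbove φ
    have hpow := Real.rpow_le_rpow_of_exponent_le (one_le_two (α := ℝ)) hH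
    rw [Real.rpow_add two_pos, Real.rpow_add two_pos, Real.rpow_logb two_pos (by norm_num)
      (by positivity), Real.rpow_logb two_pos (by norm_num) hk, ← Nat.cast_mul,
      Real.rpow_natCast, one_div, mul_assoc, inv_mul_le_iff₀ hp] at hpow
    linarith
  rw [h₁]
  push_cast
  refine (Finset.sum_le_sum fun φ _ => h₂ φ).trans ?_
  rw [← Finset.sum_mul]
  have h₃ : ∑ φ : (P.dist d).support, ((P.dist d) φ).toReal = 1 := by
    have h := ENNReal.toReal_sum (s := Finset.univ) (f := fun φ : (P.dist d).support => (P.dist d) φ)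
      fun φ _ => (P.dist d).apply_ne_top φ
    rw [← h, ← tsum_fintype (L := .unconditional _)]
    have : ∑' φ : (P.dist d).support, (P.dist d) φ = 1 := by
      rw [← (P.dist d).tsum_coe]
      exact tsum_subtype_support _
    rw [this, ENNReal.toReal_one]
  rw [h₃, one_mul]

/-- From `log (1 + x) ≤ x`; the constant `3` is an upper bound for `2 / log 2`. -/
theorem two_mul_logb_le {q : ℝ} (hq : 0 < q) : 2 * Real.logb 2 (1 + 1 / q) ≤ 3 / q := by
  have h₁ : Real.log (1 + 1 / q) ≤ 1 / q := by
    have := Real.log_le_sub_one_of_pos (show 0 < 1 + 1 / q by positivity)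
    linarith
  have h₂ : (2 / 3 : ℝ) ≤ Real.log 2 := by
    have := Real.log_two_gt_d9
    linarith
  have h₃ : (0 : ℝ) ≤ 1 / q := by positivity
  rw [Real.logb, mul_div_assoc', div_le_iff₀ (by linarith)]
  have : 3 / q = 3 * (1 / q) := by ring
  rw [this]
  nlinarith

theorem Params.redundancy (P : Params Φ) {w q c nb : ℕ} (hq : 1 ≤ q)
    (hq' : q ≤ 2 ^ (c * w)) (hs : ∀ d, P.suppSize d ≤ 2 ^ (c * w))
    (hK : ∀ d φ, P.Kin d φ ≤ 2 ^ (c * w)) (d : Fin P.numDist) :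
    (w : ℝ) * ((P.code w q nb (3 * c)).Mout d : ℝ) +
      Real.logb 2 ((P.code w q nb (3 * c)).Kout d : ℝ) ≤ P.Hin w d + 3 / q := by
  show (w : ℝ) * ((P.sizes w q nb (3 * c)).mout d : ℝ) +
      Real.logb 2 ((P.sizes w q nb (3 * c)).kout d : ℝ) ≤ P.Hin w d + 3 / q
  have hcont := P.contents_le w q nb (3 * c) d
  have hm' : P.maxSupp ≤ 2 ^ (c * w) := Finset.sup_le fun d _ => hs d
  have hkn : ∀ i < P.suppSize d, 0 < (P.sizes w q nb (3 * c)).kn d i := by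
    intro i hi
    show 0 < P.pad P.Kin d i
    have := P.pad_name P.Kin d ((P.name d).symm ⟨i, hi⟩)
    rw [Equiv.apply_symm_apply] at this
    rw [this]
    exact P.Kin_pos _ _
  have htot : (P.sizes w q nb (3 * c)).q * ((P.sizes w q nb (3 * c)).total d *
      2 ^ ((P.sizes w q nb (3 * c)).w * (P.sizes w q nb (3 * c)).mout d)) ≤
      ((P.sizes w q nb (3 * c)).q + 1) * (P.sizes w q nb (3 * c)).contents d := by
    refine Sizes.mul_total_le (B := 2 ^ (c * w)) ?_ (fun i => P.pad_le _ hK d i) ?_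
    -- This is where `L = 3 * c` comes from: one factor `2 ^ (c * w)` each for `q`, the support size
    -- and the input spill.
    · refine (Nat.mul_le_mul hq' (Nat.mul_le_mul_right _ hm')).trans ?_
      rw [← pow_add, ← pow_add]
      refine Nat.pow_le_pow_right (by norm_num) (le_of_eq ?_)
      show _ = w * (3 * c)
      ring
    · obtain ⟨i, hi, hmax⟩ := Finset.exists_max_image (Finset.range (P.suppSize d))
        ((P.sizes w q nb (3 * c)).mn d) ⟨0, Finset.mem_range.2 (P.suppSize_pos d)⟩
      rw [Finset.mem_range] at hi
      refine ⟨i, hi.trans_le (P.suppSize_le d), hkn i hi, fun j _ => ?_⟩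
      rcases lt_or_ge j (P.suppSize d) with hj | hj
      · exact hmax j (Finset.mem_range.2 hj)
      · rw [show (P.sizes w q nb (3 * c)).mn d j = 0 from P.pad_of_le _ d hj]
        exact Nat.zero_le _
  have hkout := (P.sizes w q nb (3 * c)).mul_kout_le d
  -- Needed to split the logarithm of the product `K * 2 ^ (w * M)`.
  have hpos : 0 < (P.sizes w q nb (3 * c)).kout d := by
    refine (Nat.zero_le _).trans_lt ((P.sizes w q nb (3 * c)).start_mul_add_lt (d := d) (i := 0)
      (x := 0) ((P.suppSize_pos d).trans_le (P.suppSize_le d)) ?_)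
    rw [Sizes.size]
    exact Nat.mul_pos (hkn 0 (P.suppSize_pos d)) (by positivity)
  have hDw : (P.sizes w q nb (3 * c)).w = w := rfl
  have hDq : (P.sizes w q nb (3 * c)).q = q := rfl
  rw [hDw, hDq] at htot
  rw [hDq] at hkout
  generalize (P.sizes w q nb (3 * c)).kout d = K at *
  generalize (P.sizes w q nb (3 * c)).mout d = M at *
  generalize (P.sizes w q nb (3 * c)).total d = S at *
  generalize (P.sizes w q nb (3 * c)).contents d = N at *
  have hq₀ : (0 : ℝ) < q := by exact_mod_cast hq
  have hK₀ : (0 : ℝ) < K := by exact_mod_cast hpos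
  -- One factor `1 + 1 / q` is for the rounding to cells, the other for unused output words.
  have hkey : (K : ℝ) * 2 ^ (w * M) ≤ (1 + 1 / q) ^ 2 * 2 ^ P.Hin w d := by
    have h₁ : (q : ℝ) * (S * 2 ^ (w * M)) ≤ (q + 1) * N := by exact_mod_cast htot
    have h₂ : (q : ℝ) * K ≤ (q + 1) * S := by exact_mod_cast hkout
    have h₃ : (1 + 1 / q : ℝ) = (q + 1) / q := by field_simp
    rw [h₃, div_pow, div_mul_eq_mul_div, le_div_iff₀ (by positivity)]
    calc (K : ℝ) * 2 ^ (w * M) * q ^ 2 = q * 2 ^ (w * M) * (q * K) := by ring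
      _ ≤ q * 2 ^ (w * M) * ((q + 1) * S) := by gcongr
      _ = (q + 1) * (q * (S * 2 ^ (w * M))) := by ring
      _ ≤ (q + 1) * ((q + 1) * N) := by gcongr
      _ ≤ (q + 1) * ((q + 1) * 2 ^ P.Hin w d) := by gcongr
      _ = _ := by ring
  have hlog := Real.logb_le_logb_of_le one_lt_two (by positivity) hkey
  rw [Real.logb_mul hK₀.ne' (by positivity), Real.logb_mul (by positivity) (by positivity),
    Real.logb_rpow two_pos (by norm_num), Real.logb_pow, Real.logb_pow,
    Real.logb_self_eq_one one_lt_two] at hlog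
  have := two_mul_logb_le hq₀
  push_cast at hlog
  linarith

end EntropyEncoder

open EntropyEncoder in
/-- The programs of the encoder that keeps up to `L` words of its input in the output spill. -/
def EntropyEncoder.programs (L : ℕ) : Programs where
  build := build L
  querySizes := querySizes
  querySymbol := querySymbol
  readSymbol := readSymbol
  readSpill := readSpill
  writeSpill := writeSpill
  readWord := readWord
  writeWord := writeWord
  change := change


/-- Registers and memory cells have `C * w` bits, i.e. `C` words, for a constant `C`. The
constants and the programs are independent of the word size and of all other parameters. -/
theorem mainTheorem3 :
    ∃ A : ℝ, ∀ c b : ℕ, ∃ (C : ℕ) (R : EntropyEncoder.Programs),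
      ∀ (Φ : Type*) (P : EntropyEncoder.Params Φ) (w q : ℕ),
        1 ≤ w → 1 ≤ q → 1 ≤ P.numDist →
        q ≤ 2 ^ (c * w) →
        P.numDist ≤ 2 ^ (c * w) →
        (∀ d, P.suppSize d ≤ 2 ^ (c * w)) →
        (∀ d φ, P.Kin d φ ≤ 2 ^ (c * w)) →
        (∀ d φ, P.Min d φ ≤ 2 ^ (c * w)) →
        ∃ E : EntropyEncoder.Code P w,
          E.Total ∧
          (∀ d, (w : ℝ) * (E.Mout d : ℝ) + Real.logb 2 (E.Kout d : ℝ) ≤ P.Hin w d + A / q) ∧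
          (∀ d, E.Kout d ≤ 2 ^ (C * w)) ∧
          E.TableFits (C * w) (C * P.tableBound q) ∧
          E.Builds (C * w) q (b * w) (C * P.tableBound q) R.build ∧
          E.QueriesSizes (C * w) C R.querySizes ∧
          E.QueriesSymbol (C * w) (b * w) C R.querySymbol ∧
          E.ReadsSymbol (C * w) C R.readSymbol ∧
          E.ReadsSpill (C * w) C R.readSpill ∧
          E.WritesSpill (C * w) C R.writeSpill ∧
          E.ReadsWord (C * w) C R.readWord ∧
          E.WritesWord (C * w) C R.writeWord ∧
          E.Changes (C * w) C R.change := by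
  refine ⟨3, fun c b => ?_⟩
  obtain ⟨C, h₀, h₁, h₂, h₃, h₄, h₅, h₆, h₇, h₈, h₉, h₁₀⟩ : ∃ C, 5 * c + b + 5 ≤ C ∧ 17 ≤ C ∧
      EntropyEncoder.Sizes.buildFactor (3 * c) ≤ C ∧ EntropyEncoder.querySizes.len ≤ C ∧
      EntropyEncoder.querySymbol.len ≤ C ∧ EntropyEncoder.readSymbol.len ≤ C ∧
      EntropyEncoder.readSpill.len ≤ C ∧ EntropyEncoder.writeSpill.len ≤ C ∧
      EntropyEncoder.readWord.len ≤ C ∧ EntropyEncoder.writeWord.len ≤ C ∧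
      EntropyEncoder.changeTime (3 * c) ≤ C := by
    generalize EntropyEncoder.Sizes.buildFactor (3 * c) = x₁, EntropyEncoder.querySizes.len = x₂,
      EntropyEncoder.querySymbol.len = x₃, EntropyEncoder.readSymbol.len = x₄,
      EntropyEncoder.readSpill.len = x₅, EntropyEncoder.writeSpill.len = x₆,
      EntropyEncoder.readWord.len = x₇, EntropyEncoder.writeWord.len = x₈,
      EntropyEncoder.changeTime (3 * c) = x₉
    exact ⟨5 * c + b + 5 + 17 + x₁ + x₂ + x₃ + x₄ + x₅ + x₆ + x₇ + x₈ + x₉, by omega⟩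
  -- The programs depend on the parameters only through the literal `L = 3 * c`.
  refine ⟨C, EntropyEncoder.programs (3 * c), fun Φ P w q hw hq hn hq' hn' hs hK hM => ?_⟩
  have hF := P.fits_sizes (b := b) hw hq hn hq' hn' hs hK hM h₀
  have hB := P.le_tableBound hq hn
  have hm := P.maxSupp_pos hn
  refine ⟨P.code w q (b * w) (3 * c), P.total_code _ _ _ _, P.redundancy hq hq' hs hK,
    fun d => (hF.kout_lt d).le, ⟨?_, fun j _ => hF.table_lt⟩, ?_, ?_, ?_, ?_, ?_, ?_, ?_, ?_, ?_⟩
  · exact (EntropyEncoder.Sizes.tableLen_le (D := P.sizes w q (b * w) (3 * c)) hq hn hm).trans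
      (Nat.mul_le_mul h₁ hB)
  · exact fun s hs => (EntropyEncoder.Params.builds_code hF s hs).mono
      (Nat.mul_le_mul h₂ hB) le_rfl fun _ h => h
  · exact fun s d hl h => (EntropyEncoder.Params.queriesSizes_code hF s d hl h).mono
      h₃ le_rfl fun _ h => h
  · exact fun s d φ hl h h' => (EntropyEncoder.Params.queriesSymbol_code hF s d φ hl h h').mono
      h₄ le_rfl fun _ h => h
  · exact fun s d x hl h h' => (EntropyEncoder.Params.readsSymbol_code hF s d x hl h h').mono
      h₅ le_rfl fun _ h => h
  · exact fun s d x hl h h' => (EntropyEncoder.Params.readsSpill_code hF s d x hl h h').mono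
      h₆ le_rfl fun _ h => h
  · exact fun s d x k hl h h' h'' =>
      (EntropyEncoder.Params.writesSpill_code hF s d x k hl h h' h'').mono
      h₇ le_rfl fun _ h => h
  · exact fun s d x j hl h h' h'' =>
      (EntropyEncoder.Params.readsWord_code hF s d x j hl h h' h'').mono
      h₈ le_rfl fun _ h => h
  · exact fun s d x j v hl h h' h'' h''' =>
      (EntropyEncoder.Params.writesWord_code hF s d x j v hl h h' h'' h''').mono
      h₉ le_rfl fun _ h => h
  · exact fun s d d' x φ' k' hl h h' h'' h''' h4 =>
      (EntropyEncoder.Params.changes_code hF s d d' x φ' k' hl h h' h'' h''' h4).mono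
      h₁₀ le_rfl fun _ h => h
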